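/- Let $\tau\in\mathbb{H}$, $q=e^{2\pi i\tau}$ and $q^{r}:=e^{2\pi i r\tau}$ for $r\in\mathbb{R}$. Write $(a;q)_n=(a)_n=\prod_{j=0}^{n-1}(1-aq^j)$, and $\operatorname{sgn}(x)=x/|x|$ for $x\neq0$, $\operatorname{sgn}(0)=0$. Define $$L_1=\sum_{1\le k\le n}\frac{(-1)^{n+k}(q)_{n-1}q^{\frac{n(n+1)}2+\frac{k(k+1)}2}}{(1-q^{2k-1})(q)_{n-k}(q)_{k-1}},\qquad L_2=\sum_{0\le k\le n}\frac{(-1)^{n+k}(q)_{n}q^{\frac{n(n+1)}2+\frac{k(k+1)}2}}{(1-q^{2k+1})(q)_{n-k}(q)_{k}},$$ $$L_3=q\sum_{1\le k\le n}\frac{(-1)^{n+k}(q)_{n-1}q^{\frac{n(n+1)}2+\frac{k(k-1)}2}}{(1-q^{2k-1})(q)_{n-k}(q)_{k-1}},\qquad L_4=-1+\sum_{0\le k\le n}\frac{(-1)^{n+k}(q)_{n}q^{\frac{n(n+1)}2+\frac{k(k-1)}2}}{(1-q^{2k+1})(q)_{n-k}(q)_{k}},$$ $$L_5=q\sum_{1\le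 k\le n}\frac{(-1)^{n+k}(-1)_n(q)_{n-1}q^{n+k^2-k}}{(1-q^{2k-1})(q)_{n-k}(q^2;q^2)_{k-1}},\qquad L_6=\sum_{1\le k\le n}\frac{(-1)^{n+k}(-1)_n(q)_{n-1}q^{n+k^2}}{(1-q^{2k-1})(q)_{n-k}(q^2;q^2)_{k-1}},$$ $$L_7=2\sum_{0\le k\le n}{}^{*}\frac{(-1)^{n+k}(q^2;q^2)_nq^{k^2+k}}{(1-q^{2k+1})(q)_{n-k}(q^2;q^2)_k},\qquad L_8=-1+2\sum_{0\le k\le n}{}^{*}\frac{(-1)^{n+k}(q^2;q^2)_nq^{k^2}}{(1-q^{2k+1})(q)_{n-k}(q^2;q^2)_k},$$ $$L_9=\sum_{1\le k\le n}\frac{(-1)^{n+k}(-1)_n(q)_{n-1}q^{n+\frac{k(k+1)}2}}{(1-q^{2k-1})(q)_{n-k}(q)_{k-1}},\qquad L_{10}=q\sum_{1\le k\le n}\frac{(-1)^{n+k}(-1)_n(q)_{n-1}q^{n+\frac{k(k-1)}2}}{(1-q^{2k-1})(q)_{n-k}(q)_{k-1}},$$ $$L_{11}=2\sum_{0\le k\le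 n}{}^{*}\frac{(-1)^{n+k}(q^2;q^2)_nq^{\frac{k(k+1)}2}}{(1-q^{2k+1})(q)_{n-k}(q)_k},\qquad L_{12}=-2+2\sum_{0\le k\le n}{}^{*}\frac{(-1)^{n+k}(q^2;q^2)_nq^{\frac{k(k-1)}2}}{(1-q^{2k+1})(q)_{n-k}(q)_k},$$ where $*$ means the average of the limits of the even and of the odd partial sums in $n$. For $a>b>0$ and $S\subset\mathbb{R}^2$ put $$\theta^{a,b}_S(\tau)=\frac12\sum_{\boldsymbol n\in S}\bigl(1+\operatorname{sgn}(n_1+n_2)\operatorname{sgn}(n_1-n_2)\bigr)q^{an_1^2-bn_2^2}$$ and write $\theta^{a,b}_{\boldsymbol\mu}$ for $S=\mathbb{Z}^2+\boldsymbol\mu$. For $Q(\boldsymbol n)=an_1^2-bn_2^2$, with bilinear form $B(\boldsymbol n,\boldsymbol m)=2an_1m_1-2bn_2m_2$, and vectors $\boldsymbol c_j=\bigl(\tfrac{\sinh t_j}{\sqrt a},\tfrac{\cosh t_j}{\sqrt b}\bigr)$, $j=1,2$, put $$\vartheta_{\boldsymbol\mu}(\tau)=-\frac{t_2-t_1}{\pi}\delta_{\boldsymbol\mu\in\mathbb{Z}^2}+\frac{\operatorname{sgn}(t_2-t_1)}2\sum_{\substack{\boldsymbol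 n\in\mathbb{Z}^2+\boldsymbol\mu\\ \boldsymbol n\neq\boldsymbol0}}\bigl(1-\operatorname{sgn}(B(\boldsymbol n,\boldsymbol c_1))\operatorname{sgn}(B(\boldsymbol n,\boldsymbol c_2))\bigr)q^{Q(\boldsymbol n)} .$$ Let $\boldsymbol\lambda=(\frac12,\frac12)$, and for $j\in\{0,1,2,3\}$ let $f_j,g_j,h_j$ each be $\vartheta_{\boldsymbol\mu_j}+\vartheta_{\boldsymbol\mu_j+\boldsymbol\lambda}$, where * for $f_j$: $Q=8n_1^2-4n_2^2$, $\boldsymbol c_1=\frac1{2\sqrt2}(-1,2)$, $\boldsymbol c_2=\frac1{2\sqrt2}(1,2)$, $\boldsymbol\mu_j=(\frac{2j+1}{16},\frac18)$; * for $g_j$: $Q=6n_1^2-2n_2^2$, $\boldsymbol c_1=\frac1{2\sqrt3}(-1,3)$, $\boldsymbol c_2=\frac1{2\sqrt3}(1,3)$, $\boldsymbol\mu_j=(\frac j6,0)$; * for $h_j$: $Q=6n_1^2-4n_2^2$, $\boldsymbol c_1=\frac1{2\sqrt3}(-2,3)$, $\boldsymbol c_2=\frac1{2\sqrt3}(2,3)$,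 $\boldsymbol\mu_j=(\frac j6,\frac18)$. Then for every $\tau\in\mathbb{H}$ the unstarred double series defining the $L_j$ converge absolutely, for the starred ones the even and the odd partial sums in $n$ converge, for each of the three choices of $(Q,\boldsymbol c_1,\boldsymbol c_2)$ and every $\boldsymbol\mu\in\mathbb{R}^2$ the series in $\theta_{\boldsymbol\mu}$ and $\vartheta_{\boldsymbol\mu}$ converge absolutely, and the following identities hold. 1. $(a,b)=(8,4)$: $$q^{-\frac{17}{32}}L_1=\theta_{(\frac1{16},\frac38)}+\theta_{(\frac7{16},\frac18)}=f_3,\qquad q^{\frac7{32}}L_2=\theta_{(\frac3{16},\frac18)}+\theta_{(\frac5{16},\frac38)}=f_1,$$ $$q^{-\frac{33}{32}}L_3=\theta_{(\frac1{16},\frac18)}+\theta_{(\frac7{16},\frac38)}=f_0,\qquad q^{-\frac9{32}}L_4=\theta_{(\frac3{16},\frac38)}+\theta_{(\frac5{16},\frac18)}=f_2.$$ 2. $(a,b)=(6,2)$: $$q^{-1}L_5=\theta_{\mathbb{Z}^2\setminus\{\boldsymbol0\}}+\theta_{(\frac12,\frac12)},\qquad q^{-1}L_5-\frac2\pi\operatorname{arctanh}\Bigl(\frac1{\sqrt3}\Bigr)=g_0,\qquad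 q^{-\frac12}L_6=\theta_{(0,\frac12)}+\theta_{(\frac12,0)}=g_3,$$ $$q^{\frac16}L_7=\theta_{(\frac13,\frac12)}+\theta_{(\frac16,0)}=g_1,\qquad q^{-\frac13}L_8=\theta_{(\frac16,\frac12)}+\theta_{(\frac13,0)}=g_2.$$ 3. $(a,b)=(6,4)$: $$q^{-\frac9{16}}L_9=\theta_{(0,\frac38)}+\theta_{(\frac12,\frac78)}=h_3,\qquad q^{-\frac{17}{16}}L_{10}=\theta_{(0,\frac18)}+\theta_{(\frac12,\frac58)}=h_0,$$ $$q^{\frac5{48}}L_{11}=\theta_{(\frac16,\frac18)}+\theta_{(\frac23,\frac58)}=h_1,\qquad q^{-\frac{19}{48}}L_{12}=\theta_{(\frac16,\frac38)}+\theta_{(\frac23,\frac78)}=h_2.$$ -/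

import Mathlib

noncomputable section

namespace FalseIndefiniteTheta

open Filter Topology

/-- `nome τ r` is `q ^ r`, where `q = exp (2 π i τ)` and `r` is real. -/
def nome (τ : ℂ) (r : ℝ) : ℂ :=
  Complex.exp (2 * (Real.pi : ℂ) * Complex.I * (r : ℂ) * τ)

/-! ### The twelve hypergeometric series -/

/-- The Pochhammer symbol `(a; q)_n = ∏_{j < n} (1 - a q ^ j)`. -/
def qPoch (a q : ℂ) (n : ℕ) : ℂ :=
  ∏ j ∈ Finset.range n, (1 - a * q ^ j)

/-- The index pairs `(k, n)` with `m ≤ k ≤ n`. -/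
def indexPairs (m : ℕ) : Set (ℕ × ℕ) :=
  {p | m ≤ p.1 ∧ p.1 ≤ p.2}

/-- The sum of `a k n` over `m ≤ k ≤ n`. -/
def doubleSum (m : ℕ) (a : ℕ → ℕ → ℂ) : ℂ :=
  ∑' p : indexPairs m, a p.1.1 p.1.2

/-- (Absolute) convergence of the sum of `a k n` over `m ≤ k ≤ n`. -/
def DoubleSummable (m : ℕ) (a : ℕ → ℕ → ℂ) : Prop :=
  Summable (fun p : indexPairs m => a p.1.1 p.1.2)

/-- The partial sum in `n`, that is, the sum of `a k n` over `0 ≤ k ≤ n ≤ N`. -/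
def partialSum (a : ℕ → ℕ → ℂ) (N : ℕ) : ℂ :=
  ∑ n ∈ Finset.range (N + 1), ∑ k ∈ Finset.range (n + 1), a k n

/-- The starred sum over `0 ≤ k ≤ n`: the average of the limit of the even partial sums and the
limit of the odd partial sums (in `n`). -/
def starSum (a : ℕ → ℕ → ℂ) : ℂ :=
  (limUnder atTop (fun N : ℕ => partialSum a (2 * N)) +
    limUnder atTop (fun N : ℕ => partialSum a (2 * N + 1))) / 2

/-- The even partial sums converge, and so do the odd ones. -/
def StarSummable (a : ℕ → ℕ → ℂ) : Prop :=
  (∃ l : ℂ, Tendsto (fun N : ℕ => partialSum a (2 * N)) atTop (𝓝 l)) ∧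
    ∃ l : ℂ, Tendsto (fun N : ℕ => partialSum a (2 * N + 1)) atTop (𝓝 l)

/-- Summand of `L₁`, for `1 ≤ k ≤ n`. -/
def term1 (q : ℂ) (k n : ℕ) : ℂ :=
  (-1) ^ (n + k) * qPoch q q (n - 1) * q ^ (n * (n + 1) / 2 + k * (k + 1) / 2) /
    ((1 - q ^ (2 * k - 1)) * qPoch q q (n - k) * qPoch q q (k - 1))

/-- Summand of `L₂`, for `0 ≤ k ≤ n`. -/
def term2 (q : ℂ) (k n : ℕ) : ℂ :=
  (-1) ^ (n + k) * qPoch q q n * q ^ (n * (n + 1) / 2 + k * (k + 1) / 2) /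
    ((1 - q ^ (2 * k + 1)) * qPoch q q (n - k) * qPoch q q k)

/-- Summand of `L₃`, for `1 ≤ k ≤ n`. -/
def term3 (q : ℂ) (k n : ℕ) : ℂ :=
  (-1) ^ (n + k) * qPoch q q (n - 1) * q ^ (n * (n + 1) / 2 + k * (k - 1) / 2) /
    ((1 - q ^ (2 * k - 1)) * qPoch q q (n - k) * qPoch q q (k - 1))

/-- Summand of `L₄`, for `0 ≤ k ≤ n`. -/
def term4 (q : ℂ) (k n : ℕ) : ℂ :=
  (-1) ^ (n + k) * qPoch q q n * q ^ (n * (n + 1) / 2 + k * (k - 1) / 2) /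
    ((1 - q ^ (2 * k + 1)) * qPoch q q (n - k) * qPoch q q k)

/-- Summand of `L₅`, for `1 ≤ k ≤ n`. -/
def term5 (q : ℂ) (k n : ℕ) : ℂ :=
  (-1) ^ (n + k) * qPoch (-1) q n * qPoch q q (n - 1) * q ^ (n + (k ^ 2 - k)) /
    ((1 - q ^ (2 * k - 1)) * qPoch q q (n - k) * qPoch (q ^ 2) (q ^ 2) (k - 1))

/-- Summand of `L₆`, for `1 ≤ k ≤ n`. -/
def term6 (q : ℂ) (k n : ℕ) : ℂ :=
  (-1) ^ (n + k) * qPoch (-1) q n * qPoch q q (n - 1) * q ^ (n + k ^ 2) /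
    ((1 - q ^ (2 * k - 1)) * qPoch q q (n - k) * qPoch (q ^ 2) (q ^ 2) (k - 1))

/-- Summand of `L₇`, for `0 ≤ k ≤ n`. -/
def term7 (q : ℂ) (k n : ℕ) : ℂ :=
  (-1) ^ (n + k) * qPoch (q ^ 2) (q ^ 2) n * q ^ (k ^ 2 + k) /
    ((1 - q ^ (2 * k + 1)) * qPoch q q (n - k) * qPoch (q ^ 2) (q ^ 2) k)

/-- Summand of `L₈`, for `0 ≤ k ≤ n`. -/
def term8 (q : ℂ) (k n : ℕ) : ℂ :=
  (-1) ^ (n + k) * qPoch (q ^ 2) (q ^ 2) n * q ^ (k ^ 2) /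
    ((1 - q ^ (2 * k + 1)) * qPoch q q (n - k) * qPoch (q ^ 2) (q ^ 2) k)

/-- Summand of `L₉`, for `1 ≤ k ≤ n`. -/
def term9 (q : ℂ) (k n : ℕ) : ℂ :=
  (-1) ^ (n + k) * qPoch (-1) q n * qPoch q q (n - 1) * q ^ (n + k * (k + 1) / 2) /
    ((1 - q ^ (2 * k - 1)) * qPoch q q (n - k) * qPoch q q (k - 1))

/-- Summand of `L₁₀`, for `1 ≤ k ≤ n`. -/
def term10 (q : ℂ) (k n : ℕ) : ℂ :=
  (-1) ^ (n + k) * qPoch (-1) q n * qPoch q q (n - 1) * q ^ (n + k * (k - 1) / 2) /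
    ((1 - q ^ (2 * k - 1)) * qPoch q q (n - k) * qPoch q q (k - 1))

/-- Summand of `L₁₁`, for `0 ≤ k ≤ n`. -/
def term11 (q : ℂ) (k n : ℕ) : ℂ :=
  (-1) ^ (n + k) * qPoch (q ^ 2) (q ^ 2) n * q ^ (k * (k + 1) / 2) /
    ((1 - q ^ (2 * k + 1)) * qPoch q q (n - k) * qPoch q q k)

/-- Summand of `L₁₂`, for `0 ≤ k ≤ n`. -/
def term12 (q : ℂ) (k n : ℕ) : ℂ :=
  (-1) ^ (n + k) * qPoch (q ^ 2) (q ^ 2) n * q ^ (k * (k - 1) / 2) /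
    ((1 - q ^ (2 * k + 1)) * qPoch q q (n - k) * qPoch q q k)

def L1 (q : ℂ) : ℂ := doubleSum 1 (term1 q)

def L2 (q : ℂ) : ℂ := doubleSum 0 (term2 q)

def L3 (q : ℂ) : ℂ := q * doubleSum 1 (term3 q)

def L4 (q : ℂ) : ℂ := -1 + doubleSum 0 (term4 q)

def L5 (q : ℂ) : ℂ := q * doubleSum 1 (term5 q)

def L6 (q : ℂ) : ℂ := doubleSum 1 (term6 q)

def L7 (q : ℂ) : ℂ := 2 * starSum (term7 q)

def L8 (q : ℂ) : ℂ := -1 + 2 * starSum (term8 q)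

def L9 (q : ℂ) : ℂ := doubleSum 1 (term9 q)

def L10 (q : ℂ) : ℂ := q * doubleSum 1 (term10 q)

def L11 (q : ℂ) : ℂ := 2 * starSum (term11 q)

def L12 (q : ℂ) : ℂ := -2 + 2 * starSum (term12 q)

/-! ### False-indefinite theta series -/

/-- The shifted lattice `ℤ² + μ`. -/
def shiftedLattice (μ : ℝ × ℝ) : Set (ℝ × ℝ) :=
  {n | ∃ m : ℤ × ℤ, n = ((m.1 : ℝ) + μ.1, (m.2 : ℝ) + μ.2)}

/-- The quadratic form `Q(n) = a n₁² - b n₂²`. -/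
def quadForm (a b : ℝ) (n : ℝ × ℝ) : ℝ :=
  a * n.1 ^ 2 - b * n.2 ^ 2

/-- The bilinear form of `Q`, normalised by `B(n, n) = 2 Q(n)`. -/
def bilinForm (a b : ℝ) (n m : ℝ × ℝ) : ℝ :=
  2 * a * n.1 * m.1 - 2 * b * n.2 * m.2

/-- `(1 + sgn(n₁ + n₂) sgn(n₁ - n₂)) q ^ (a n₁² - b n₂²)`. -/
def falseTerm (a b : ℝ) (τ : ℂ) (n : ℝ × ℝ) : ℂ :=
  ((1 + Real.sign (n.1 + n.2) * Real.sign (n.1 - n.2) : ℝ) : ℂ) * nome τ (quadForm a b n)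

/-- The sum over `n ∈ S` of `(1 + sgn(n₁ + n₂) sgn(n₁ - n₂)) q ^ (a n₁² - b n₂²)`. -/
def falseSum (a b : ℝ) (τ : ℂ) (S : Set (ℝ × ℝ)) : ℂ :=
  ∑' n : S, falseTerm a b τ n

/-- The branch `{Q = -1, c₂ > 0}` is parametrised by `c(t) = (sinh t / √a, cosh t / √b)`. -/
def curve (a b t : ℝ) : ℝ × ℝ :=
  (Real.sinh t / √a, Real.cosh t / √b)

/-- The parameter `t` with `c(t) = c`, for `c` on the branch `{Q = -1, c₂ > 0}`. -/
def param (a : ℝ) (c : ℝ × ℝ) : ℝ :=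
  Real.arsinh (√a * c.1)

theorem curve_param {a b : ℝ} (ha : 0 < a) (hb : 0 < b) {c : ℝ × ℝ}
    (hc : quadForm a b c = -1) (hc2 : 0 < c.2) : curve a b (param a c) = c := by
  have hsa : √a ≠ 0 := (Real.sqrt_pos.2 ha).ne'
  have hsb : √b ≠ 0 := (Real.sqrt_pos.2 hb).ne'
  have h : 1 + (√a * c.1) ^ 2 = (√b * c.2) ^ 2 := by
    rw [mul_pow, mul_pow, Real.sq_sqrt ha.le, Real.sq_sqrt hb.le]
    unfold quadForm at hc
    linarith
  have h2 : √((√b * c.2) ^ 2) = √b * c.2 := Real.sqrt_sq (by positivity)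
  refine Prod.ext ?_ ?_
  · simp only [curve, param, Real.sinh_arsinh]
    field_simp
  · simp only [curve, param, Real.cosh_arsinh, h, h2]
    field_simp

/-- `(1 - sgn B(n, c₁) sgn B(n, c₂)) q ^ Q(n)`. -/
def varthetaTerm (a b : ℝ) (c₁ c₂ : ℝ × ℝ) (τ : ℂ) (n : ℝ × ℝ) : ℂ :=
  ((1 - Real.sign (bilinForm a b n c₁) * Real.sign (bilinForm a b n c₂) : ℝ) : ℂ) *
    nome τ (quadForm a b n)

open Classical in
/-- The theta function `ϑ_μ` of the form `Q` and the vectors `c₁ = c(t₁)`, `c₂ = c(t₂)`: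
`-(t₂ - t₁)/π δ_{μ ∈ ℤ²} + (sgn(t₂ - t₁)/2) ∑ (1 - sgn B(n, c₁) sgn B(n, c₂)) q ^ Q(n)`,
summed over the nonzero `n ∈ ℤ² + μ`. -/
def vartheta (a b : ℝ) (c₁ c₂ μ : ℝ × ℝ) (τ : ℂ) : ℂ :=
  -(((param a c₂ - param a c₁) / Real.pi : ℝ) : ℂ) *
      (if μ ∈ shiftedLattice (0, 0) then 1 else 0) +
    ((Real.sign (param a c₂ - param a c₁) / 2 : ℝ) : ℂ) *
      ∑' n : (shiftedLattice μ \ {(0, 0)} : Set (ℝ × ℝ)), varthetaTerm a b c₁ c₂ τ n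

/-! ### The three families -/

/-- The shift `λ = (1/2, 1/2)`. -/
def lam : ℝ × ℝ := (1 / 2, 1 / 2)

/-- The vectors `c₁`, `c₂` for `8 n₁² - 4 n₂²`. -/
def cF₁ : ℝ × ℝ := (1 / (2 * √2)) • ((-1, 2) : ℝ × ℝ)

def cF₂ : ℝ × ℝ := (1 / (2 * √2)) • ((1, 2) : ℝ × ℝ)

def fVec (j : Fin 4) (τ : ℂ) : ℂ :=
  vartheta 8 4 cF₁ cF₂ ((2 * (j : ℝ) + 1) / 16, 1 / 8) τ +
    vartheta 8 4 cF₁ cF₂ (((2 * (j : ℝ) + 1) / 16, 1 / 8) + lam) τ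

/-- The vectors `c₁`, `c₂` for `6 n₁² - 2 n₂²`. -/
def cG₁ : ℝ × ℝ := (1 / (2 * √3)) • ((-1, 3) : ℝ × ℝ)

def cG₂ : ℝ × ℝ := (1 / (2 * √3)) • ((1, 3) : ℝ × ℝ)

def gVec (j : Fin 4) (τ : ℂ) : ℂ :=
  vartheta 6 2 cG₁ cG₂ ((j : ℝ) / 6, 0) τ +
    vartheta 6 2 cG₁ cG₂ (((j : ℝ) / 6, 0) + lam) τ

/-- The vectors `c₁`, `c₂` for `6 n₁² - 4 n₂²`. -/
def cH₁ : ℝ × ℝ := (1 / (2 * √3)) • ((-2, 3) : ℝ × ℝ)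

def cH₂ : ℝ × ℝ := (1 / (2 * √3)) • ((2, 3) : ℝ × ℝ)

def hVec (j : Fin 4) (τ : ℂ) : ℂ :=
  vartheta 6 4 cH₁ cH₂ ((j : ℝ) / 6, 1 / 8) τ +
    vartheta 6 4 cH₁ cH₂ (((j : ℝ) / 6, 1 / 8) + lam) τ

/-! ### Convergence of all the series involved -/

/-- At `q`, the twelve hypergeometric series converge. -/
def HypergeometricConverge (q : ℂ) : Prop :=
  DoubleSummable 1 (term1 q) ∧ DoubleSummable 0 (term2 q) ∧
  DoubleSummable 1 (term3 q) ∧ DoubleSummable 0 (term4 q) ∧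
  DoubleSummable 1 (term5 q) ∧ DoubleSummable 1 (term6 q) ∧
  StarSummable (term7 q) ∧ StarSummable (term8 q) ∧
  DoubleSummable 1 (term9 q) ∧ DoubleSummable 1 (term10 q) ∧
  StarSummable (term11 q) ∧ StarSummable (term12 q)

/-- The theta series of `a n₁² - b n₂²` converge absolutely at `τ`, for all shifts `μ`, both in
the explicit form and in the form attached to the vectors `c₁`, `c₂`. -/
def ThetaConverge (a b : ℝ) (c₁ c₂ : ℝ × ℝ) (τ : ℂ) : Prop :=
  ∀ μ : ℝ × ℝ,
    Summable (fun n : shiftedLattice μ => falseTerm a b τ n) ∧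
    Summable (fun n : (shiftedLattice μ \ {(0, 0)} : Set (ℝ × ℝ)) =>
      varthetaTerm a b c₁ c₂ τ n)

end FalseIndefiniteTheta

end

open FalseIndefiniteTheta

noncomputable section

namespace FalseIndefiniteTheta

open Filter Topology

/-! ### Finite identities: Bailey pairs for sums with simple poles. -/

/-! ### Reciprocal `q`-factorials -/

/-! Put p = q^(1/2). Every series has the form ∑_n W_n ∑_k y_k / ((q)_{n-k} (1 - q^(2k+1))). Since
1/(1 - p q^k) = (1 + p q^k)/(1 - q^(2k+1)), the inner sum is, up to a pole-free remainder, the even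
or the odd part under p ↦ -p of a sum with the factors 1/(1 - p q^k) (`poleSum_eq_add`). Two
coefficient sequences, `coeffA` and `coeffB`, account for all twelve series.

Such a pole sum is the β-side of a Bailey pair relative to a = q: by `poleSum_eq_heckeSum` it equals
∑_r α_r / ((q)_{n-r} (q)_{n+r+1}), with α_r = (-1)^r p^(3r²+2r) (1 + p^(2r+1)) times the truncated
theta sum of p^(-(β i² + γ i)) over |i| ≤ r. Both sides obey one first-order recurrence in n, and
the inhomogeneous terms agree because of two Bailey pairs relative to a = 1: the unit pair
(`sum_evenKernel_A`) and the pair with β_n = 1/(q²;q²)_n (`sum_evenKernel_B`).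

The sum over n is then carried out by conjugate Bailey pairs ∑_m w_m / ((q)_{m-r} (q)_{m+r+1}) =
κ_r, which come from telescoping in m (`conjugateWeight₁`, `conjugateWeight₂`). The weight (-1)^m
(q²;q²)_m does not decay, so its sum exists only as a limit of averages of consecutive partial sums;
this is where the starred sums come from. Weights with an extra factor q^(m+1) are brought back to
the same pairs by a summation by parts (`sum_shifted_weight_mul_eq`).

This leaves Hecke-type double series in p. On the lattice of points (M/2 + x, i/2 + y), the rows M =
r and M = -r-1 of the cone |n₁| > |n₂|, or the rows M = r and M = -r, reproduce the two outer powers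
of p and the range of i. Hence each Hecke-type series is a theta sum over that lattice, up to a
factor and, for (x, y) = (0, 0), the row through the origin. The exponent of p has the parity of M +
i (`ThetaData.exponent_even`), so the even and the odd part in p each select two of the four cosets
of ℤ², which differ by (1/2, 1/2).

Finally, the vectors c₁, c₂ are such that B(n, c₁) and B(n, c₂) are positive multiples of -(n₁ + n₂)
and n₁ - n₂, so ϑ_μ is the false theta sum for the same cone. Only μ ∈ ℤ², in the family 6n₁² -
2n₂², requires a correction: the origin has weight 1/2, and the δ-term gives the arctanh. -/

theorem one_sub_pow_ne_zero {q : ℂ} (hq : ‖q‖ < 1) {n : ℕ} (hn : n ≠ 0) : 1 - q ^ n ≠ 0 := by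
  intro h
  have h1 : ‖q ^ n‖ < 1 := by
    rw [norm_pow]
    exact pow_lt_one₀ (norm_nonneg _) hq hn
  rw [← sub_eq_zero.1 h] at h1
  simp at h1

theorem qPoch_zero (a q : ℂ) : qPoch a q 0 = 1 := by simp [qPoch]

theorem qPoch_succ (a q : ℂ) (n : ℕ) : qPoch a q (n + 1) = qPoch a q n * (1 - a * q ^ n) :=
  Finset.prod_range_succ _ _

theorem qPoch_self_succ (q : ℂ) (n : ℕ) : qPoch q q (n + 1) = qPoch q q n * (1 - q ^ (n + 1)) := by
  rw [qPoch_succ, pow_succ']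

theorem qPoch_self_ne_zero {q : ℂ} (hq : ‖q‖ < 1) (n : ℕ) : qPoch q q n ≠ 0 := by
  refine Finset.prod_ne_zero_iff.2 fun j _ => ?_
  rw [← pow_succ']
  exact one_sub_pow_ne_zero hq j.succ_ne_zero

/-- The reciprocal `1 / (q; q)_n`, extended by zero to negative `n`. -/
def invPoch (q : ℂ) (n : ℤ) : ℂ := if n < 0 then 0 else (qPoch q q n.toNat)⁻¹

theorem invPoch_natCast (q : ℂ) (n : ℕ) : invPoch q n = (qPoch q q n)⁻¹ := by
  simp [invPoch]

theorem invPoch_zero (q : ℂ) : invPoch q 0 = 1 := by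
  simp [invPoch, qPoch_zero]

theorem invPoch_of_neg (q : ℂ) {n : ℤ} (hn : n < 0) : invPoch q n = 0 := by
  simp [invPoch, hn]

/-- The extension by zero is made for this: the relation survives at n = 0, where both sides vanish.
All recurrences below therefore hold without boundary cases. -/
theorem invPoch_eq_mul {q : ℂ} (hq : ‖q‖ < 1) (n : ℤ) :
    invPoch q (n - 1) = (1 - q ^ n) * invPoch q n := by
  rcases lt_trichotomy n 0 with h | h | h
  · rw [invPoch_of_neg q h, invPoch_of_neg q (by omega), mul_zero]
  · subst h
    rw [invPoch_of_neg q (by omega)]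
    simp
  · obtain ⟨m, rfl⟩ : ∃ m : ℕ, n = (m + 1 : ℕ) := ⟨(n - 1).toNat, by omega⟩
    have : ((m + 1 : ℕ) : ℤ) - 1 = m := by push_cast; ring
    rw [this, invPoch_natCast, invPoch_natCast, qPoch_self_succ, zpow_natCast]
    have h1 := one_sub_pow_ne_zero hq m.succ_ne_zero
    have h2 := qPoch_self_ne_zero hq m
    field_simp

/-- The kernel `1 / ((q)_{n-r} (q)_{n+r})`. -/
def evenKernel (q : ℂ) (r n : ℤ) : ℂ := invPoch q (n - r) * invPoch q (n + r)

/-- The kernel `1 / ((q)_{n-r} (q)_{n+r+1})`. -/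
def oddKernel (q : ℂ) (r n : ℤ) : ℂ := invPoch q (n - r) * invPoch q (n + r + 1)

theorem oddKernel_of_lt (q : ℂ) {r n : ℤ} (h : n < r) : oddKernel q r n = 0 := by
  rw [oddKernel, invPoch_of_neg q (by omega), zero_mul]

theorem evenKernel_of_lt (q : ℂ) {r n : ℤ} (h : n < r) : evenKernel q r n = 0 := by
  rw [evenKernel, invPoch_of_neg q (by omega), zero_mul]

/-- This relation and the next five apply `invPoch_eq_mul` to one or both factors. They allow all
kernels in a telescoping step to be written as multiples of a single one, after which the step is a
polynomial identity. -/
theorem oddKernel_eq_evenKernel_succ {q : ℂ} (hq : ‖q‖ < 1) (r n : ℤ) :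
    oddKernel q r n = (1 - q ^ (n + 1 - r)) * evenKernel q r (n + 1) := by
  have h := invPoch_eq_mul hq (n + 1 - r)
  rw [show n + 1 - r - 1 = n - r by ring] at h
  rw [oddKernel, evenKernel, h, show n + 1 + r = n + r + 1 by ring]
  ring

theorem oddKernel_pred_eq_evenKernel_succ {q : ℂ} (hq : ‖q‖ < 1) (r n : ℤ) :
    oddKernel q (r - 1) n = (1 - q ^ (n + 1 + r)) * evenKernel q r (n + 1) := by
  have h := invPoch_eq_mul hq (n + 1 + r)
  rw [oddKernel, evenKernel, show n - (r - 1) = n + 1 - r by ring,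
    show n + (r - 1) + 1 = n + 1 + r - 1 by ring, h]
  ring

theorem evenKernel_eq_evenKernel_succ {q : ℂ} (hq : ‖q‖ < 1) (r n : ℤ) : evenKernel q r n =
    (1 - q ^ (n + 1 - r)) * (1 - q ^ (n + 1 + r)) * evenKernel q r (n + 1) := by
  have h := invPoch_eq_mul hq (n + 1 + r)
  have h' := invPoch_eq_mul hq (n + 1 - r)
  rw [show n + 1 - r - 1 = n - r by ring] at h'
  rw [show n + 1 + r - 1 = n + r by ring] at h
  rw [evenKernel, evenKernel, h, h']
  ring

theorem oddKernel_pred {q : ℂ} (hq : ‖q‖ < 1) (r n : ℤ) : oddKernel q r (n - 1) =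
    (1 - q ^ (n - r)) * (1 - q ^ (n + r + 1)) * oddKernel q r n := by
  have h := invPoch_eq_mul hq (n - r)
  have h' := invPoch_eq_mul hq (n + r + 1)
  rw [oddKernel, oddKernel, show n - 1 - r = n - r - 1 by ring,
    show n - 1 + r + 1 = n + r + 1 - 1 by ring, h, h']
  ring

theorem evenKernel_eq_oddKernel {q : ℂ} (hq : ‖q‖ < 1) (r n : ℤ) :
    evenKernel q r n = (1 - q ^ (n + r + 1)) * oddKernel q r n := by
  have h := invPoch_eq_mul hq (n + r + 1)
  rw [show n + r + 1 - 1 = n + r by ring] at h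
  rw [evenKernel, oddKernel, h]
  ring

theorem evenKernel_succ_eq_oddKernel {q : ℂ} (hq : ‖q‖ < 1) (r n : ℤ) :
    evenKernel q (r + 1) n = (1 - q ^ (n - r)) * oddKernel q r n := by
  have h := invPoch_eq_mul hq (n - r)
  rw [evenKernel, oddKernel, show n - (r + 1) = n - r - 1 by ring, h,
    show n + (r + 1) = n + r + 1 by ring]
  ring

/-! ### Summation by parts -/

theorem sum_range_mul_sub (S T : ℕ → ℂ) (R : ℕ) :
    ∑ r ∈ Finset.range (R + 1), S r * (T r - T (r + 1)) =
      S 0 * T 0 + ∑ r ∈ Finset.range R, T (r + 1) * (S (r + 1) - S r) - S R * T (R + 1) := by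
  induction R with
  | zero => simp; ring
  | succ R ih =>
    rw [Finset.sum_range_succ, ih, Finset.sum_range_succ]
    ring

/-! ### The finite pairs -/

/-- `∑_{k ≤ n} c_k q ^ k / ((q)_{n-k} (1 - z q ^ k))`. -/
def poleSum (q : ℂ) (c : ℕ → ℂ) (z : ℂ) (n : ℕ) : ℂ :=
  ∑ k ∈ Finset.range (n + 1), c k * q ^ k * invPoch q (n - k) / (1 - z * q ^ k)

/-- `(-1) ^ r p ^ (3 r² + 2 r) (1 + p ^ (2 r + 1)) S_r`. -/
def heckeCoeff (p : ℂ) (S : ℕ → ℂ) (r : ℕ) : ℂ :=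
  (-1) ^ r * p ^ (3 * r ^ 2 + 2 * r) * (1 + p ^ (2 * r + 1)) * S r

/-- With y = q^(n+1-k) one has 1 - z q^(n+1) = (1 - y) + y (1 - z q^k). The first part lowers
1/(q)_{n+1-k} to 1/(q)_{n-k}; the second cancels the pole. -/
theorem poleSum_succ {q : ℂ} (hq : ‖q‖ < 1) (hq0 : q ≠ 0) (c : ℕ → ℂ) {z : ℂ}
    (hz : ∀ k : ℕ, 1 - z * q ^ k ≠ 0) (n : ℕ) :
    (1 - z * q ^ (n + 1)) * poleSum q c z (n + 1) = poleSum q c z n +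
      q ^ (n + 1) * ∑ k ∈ Finset.range (n + 2), c k * invPoch q ((n + 1 : ℕ) - k) := by
  have h1 : poleSum q c z n =
      ∑ k ∈ Finset.range (n + 2), c k * q ^ k * invPoch q (n - k) / (1 - z * q ^ k) := by
    rw [Finset.sum_range_succ, invPoch_of_neg q (n := (n : ℤ) - (n + 1 : ℕ)) (by push_cast; omega)]
    simp [poleSum]
  rw [h1, poleSum, Finset.mul_sum, Finset.mul_sum, ← Finset.sum_add_distrib]
  refine Finset.sum_congr rfl fun k hk => ?_
  have h := invPoch_eq_mul hq ((n + 1 : ℕ) - k)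
  rw [show ((n + 1 : ℕ) : ℤ) - k - 1 = n - k by push_cast; ring] at h
  rw [h]
  have h2 : q ^ (n + 1) = q ^ (((n + 1 : ℕ) : ℤ) - k) * q ^ k := by
    rw [← zpow_natCast q k, ← zpow_add₀ hq0, sub_add_cancel, zpow_natCast]
  have := hz k
  rw [h2]
  generalize q ^ (((n + 1 : ℕ) : ℤ) - k) = y
  field_simp
  ring

/-- The Hecke-side counterpart of `poleSum_succ`. The difference of the r-th terms is q^(n+1) S_r
(T_r - T_{r+1}) with T_r = (-1)^r p^(3r²) `evenKernel q r (n + 1)`; the factor 1 + p^(2r+1) enters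
through (1 + x)(1 - x + x²) = 1 + x³ at x = p^(2r+1). Summation by parts then moves the difference
onto S. -/
theorem heckeSum_succ {q p : ℂ} (hq : ‖q‖ < 1) (hq0 : q ≠ 0) (hp : p ^ 2 = q) (S : ℕ → ℂ) (n : ℕ) :
    (1 - p * q ^ (n + 1)) *
        ∑ r ∈ Finset.range (n + 2), heckeCoeff p S r * oddKernel q r (n + 1 : ℕ) =
      ∑ r ∈ Finset.range (n + 1), heckeCoeff p S r * oddKernel q r n +
      q ^ (n + 1) * (S 0 * evenKernel q 0 (n + 1 : ℕ) + ∑ r ∈ Finset.range (n + 1),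
        (-1) ^ (r + 1) * p ^ (3 * (r + 1) ^ 2) * evenKernel q (r + 1 : ℕ) (n + 1 : ℕ) *
          (S (r + 1) - S r)) := by
  have h1 : ∑ r ∈ Finset.range (n + 1), heckeCoeff p S r * oddKernel q r n =
      ∑ r ∈ Finset.range (n + 2), heckeCoeff p S r * oddKernel q r n := by
    rw [Finset.sum_range_succ _ (n + 1), oddKernel_of_lt q (by push_cast; omega)]
    simp
  have h2 := sum_range_mul_sub S
    (fun r => (-1) ^ r * p ^ (3 * r ^ 2) * evenKernel q r (n + 1 : ℕ)) (n + 1)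
  -- The boundary term of the summation by parts has r = n + 2 > n + 1, so its kernel vanishes.
  rw [evenKernel_of_lt q (r := (n + 1 + 1 : ℕ)) (by push_cast; omega)] at h2
  simp only [pow_zero, one_mul, mul_zero, sub_zero, ne_eq, OfNat.ofNat_ne_zero, not_false_eq_true,
    zero_pow, Nat.cast_zero] at h2
  rw [h1, ← h2, Finset.mul_sum, Finset.mul_sum, ← Finset.sum_add_distrib]
  refine Finset.sum_congr rfl fun r hr => ?_
  have h3 := oddKernel_pred hq r (n + 1 : ℕ)
  have h4 := evenKernel_eq_oddKernel hq r (n + 1 : ℕ)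
  have h5 := evenKernel_succ_eq_oddKernel hq r (n + 1 : ℕ)
  rw [show ((n + 1 : ℕ) : ℤ) - 1 = n by push_cast; ring] at h3
  have h6 : q ^ (n + 1) = q ^ (((n + 1 : ℕ) : ℤ) - r) * p ^ (2 * r) := by
    rw [pow_mul p, hp, ← zpow_natCast q r, ← zpow_add₀ hq0, sub_add_cancel, zpow_natCast]
  have h7 : q ^ (((n + 1 : ℕ) : ℤ) + r + 1) =
      q ^ (((n + 1 : ℕ) : ℤ) - r) * p ^ (4 * r + 2) := by
    rw [show 4 * r + 2 = 2 * (2 * r + 1) by ring, pow_mul p, hp, ← zpow_natCast q (2 * r + 1),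
      ← zpow_add₀ hq0]
    congr 1
    push_cast
    ring
  rw [show ((r + 1 : ℕ) : ℤ) = (r : ℤ) + 1 by push_cast; ring, h3, h4, h5, h7, h6, heckeCoeff]
  generalize q ^ (((n + 1 : ℕ) : ℤ) - r) = y
  generalize oddKernel q r (n + 1 : ℕ) = e
  generalize S r = s
  ring

/-- The Bailey-type pair: a pole sum is a Hecke-type sum as soon as the two sums without the
poles, relative to `a = 1`, agree. -/
theorem poleSum_eq_heckeSum {q p : ℂ} (hq : ‖q‖ < 1) (hq0 : q ≠ 0) (hp : p ^ 2 = q)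
    {c S : ℕ → ℂ} (hc : c 0 = 1) (hS : S 0 = 1)
    (h : ∀ n : ℕ, ∑ k ∈ Finset.range (n + 1), c k * invPoch q (n - k) =
      S 0 * evenKernel q 0 n + ∑ r ∈ Finset.range n,
        (-1) ^ (r + 1) * p ^ (3 * (r + 1) ^ 2) * evenKernel q (r + 1 : ℕ) n * (S (r + 1) - S r))
    (n : ℕ) : poleSum q c p n =
      ∑ r ∈ Finset.range (n + 1), heckeCoeff p S r * oddKernel q r n := by
  have hp1 : ‖p‖ < 1 := by
    rw [← hp, norm_pow] at hq
    exact (pow_lt_one_iff_of_nonneg (norm_nonneg _) two_ne_zero).1 hq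
  have hz : ∀ k : ℕ, 1 - p * q ^ k ≠ 0 := fun k => by
    rw [← hp, ← pow_mul, ← pow_succ']
    exact one_sub_pow_ne_zero hp1 (by omega)
  -- For n = 0 the claim is 1/(1 - p) = (1 + p)/(1 - p²). The step cancels the factor 1 - p q^(n+1),
  -- which is nonzero by `hz`.
  induction n with
  | zero =>
    have h1 := hz 0
    have h3 : 1 - q ≠ 0 := by simpa using one_sub_pow_ne_zero hq one_ne_zero
    have h2 : invPoch q 1 = (1 - q)⁻¹ := by
      have := invPoch_natCast q 1
      simpa [qPoch] using this
    simp [poleSum, heckeCoeff, oddKernel, invPoch_zero, h2, hc, hS] at h1 ⊢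
    rw [← hp] at h3 ⊢
    field_simp
    ring
  | succ n ih =>
    refine mul_left_cancel₀ (hz (n + 1)) ?_
    rw [poleSum_succ hq hq0 c hz, ih, h (n + 1), heckeSum_succ hq hq0 hp]

/-! ### The two families -/

/-- `(-1) ^ k q ^ (k (k - 1) / 2) / (q; q)_k`. -/
def coeffA (q : ℂ) (k : ℕ) : ℂ := (-1) ^ k * q ^ (k * (k - 1) / 2) / qPoch q q k

/-- `(-1) ^ k q ^ (k ^ 2) / (q ^ 2; q ^ 2)_k`. -/
def coeffB (q : ℂ) (k : ℕ) : ℂ := (-1) ^ k * q ^ (k ^ 2) / qPoch (q ^ 2) (q ^ 2) k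

theorem triangle_succ (k : ℕ) : (k + 1) * k / 2 = k * (k - 1) / 2 + k := by
  have h := Nat.triangle_succ k
  simpa using h

/-- The finite q-binomial theorem at z = 1: multiplied by (q)_n, the sum becomes (1; q)_n. -/
theorem sum_coeffA {q : ℂ} (hq : ‖q‖ < 1) (hq0 : q ≠ 0) (n : ℕ) :
    ∑ k ∈ Finset.range (n + 1), coeffA q k * invPoch q (n - k) = if n = 0 then 1 else 0 := by
  rcases eq_or_ne n 0 with rfl | hn
  · simp [coeffA, qPoch_zero, invPoch_zero]
  rw [if_neg hn]
  -- The truncated sums have a closed form, which at R = n contains the factor `invPoch q (-1)` and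
  -- hence vanishes.
  have key : ∀ R : ℕ, (1 - q ^ n) * ∑ k ∈ Finset.range (R + 1), coeffA q k * invPoch q (n - k) =
      (-1) ^ R * q ^ ((R + 1) * R / 2) / qPoch q q R * invPoch q (n - R - 1) := by
    intro R
    induction R with
    | zero =>
      have := invPoch_eq_mul hq n
      simp [coeffA, qPoch_zero, this]
    | succ R ih =>
      have h1 := invPoch_eq_mul hq (n - (R + 1 : ℕ))
      have h2 : q ^ n = q ^ ((n : ℤ) - (R + 1 : ℕ)) * q ^ (R + 1) := by
        rw [← zpow_natCast q (R + 1), ← zpow_add₀ hq0, sub_add_cancel, zpow_natCast]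
      have h3 := qPoch_self_ne_zero hq R
      have h4 := one_sub_pow_ne_zero hq R.succ_ne_zero
      rw [Finset.sum_range_succ, mul_add, ih, coeffA, triangle_succ (R + 1), qPoch_self_succ,
        h1, show (n : ℤ) - R - 1 = n - (R + 1 : ℕ) by push_cast; ring, h2, Nat.add_sub_cancel]
      rw [Nat.succ_eq_add_one] at h4
      generalize q ^ ((n : ℤ) - (R + 1 : ℕ)) = y
      field_simp
      ring
  have h := key n
  rw [invPoch_of_neg q (by omega), mul_zero] at h
  exact (mul_eq_zero.1 h).resolve_left (one_sub_pow_ne_zero hq hn)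

theorem sq_norm_lt_one {q : ℂ} (hq : ‖q‖ < 1) : ‖q ^ 2‖ < 1 := by
  rw [norm_pow]
  exact pow_lt_one₀ (norm_nonneg _) hq two_ne_zero

/-- The sum X_n satisfies (1 - q^(2n+2)) X_{n+1} = X_n. The two sides differ termwise, but the
difference truncated at R has a closed form that vanishes at R = n + 1. -/
theorem sum_coeffB {q : ℂ} (hq : ‖q‖ < 1) (hq0 : q ≠ 0) (n : ℕ) :
    ∑ k ∈ Finset.range (n + 1), coeffB q k * invPoch q (n - k) = (qPoch (q ^ 2) (q ^ 2) n)⁻¹ := by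
  have hq2 := sq_norm_lt_one hq
  induction n with
  | zero => simp [coeffB, qPoch_zero, invPoch_zero]
  | succ n ih =>
    have h0 := qPoch_self_ne_zero hq2 n
    have h1 := one_sub_pow_ne_zero hq2 n.succ_ne_zero
    have key : ∀ R : ℕ, ∑ k ∈ Finset.range (R + 1),
        ((1 - (q ^ 2) ^ (n + 1)) * (coeffB q k * invPoch q ((n + 1 : ℕ) - k)) -
          coeffB q k * invPoch q (n - k)) =
        q ^ (n + 1) * ((-1) ^ R * q ^ (R ^ 2 + R) / qPoch (q ^ 2) (q ^ 2) R) *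
          invPoch q (n - R) := by
      intro R
      induction R with
      | zero =>
        have := invPoch_eq_mul hq (n + 1 : ℕ)
        rw [show ((n + 1 : ℕ) : ℤ) - 1 = n by push_cast; ring, zpow_natCast] at this
        simp only [zero_add, Finset.range_one, Finset.sum_singleton, coeffB, pow_zero, qPoch_zero,
          Nat.cast_zero, sub_zero, this, ne_eq, OfNat.ofNat_ne_zero, not_false_eq_true, zero_pow]
        ring
      | succ R ihR =>
        have h2 := invPoch_eq_mul hq ((n + 1 : ℕ) - (R + 1 : ℕ))
        have h2' := invPoch_eq_mul hq ((n : ℤ) - (R : ℕ))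
        have h3 : q ^ (n + 1) = q ^ ((n : ℤ) - R) * q ^ (R + 1) := by
          rw [← zpow_natCast q (R + 1), ← zpow_natCast q (n + 1), ← zpow_add₀ hq0]
          congr 1
          push_cast
          ring
        have h4 := qPoch_self_ne_zero hq2 R
        have h5 := one_sub_pow_ne_zero hq2 R.succ_ne_zero
        rw [Nat.succ_eq_add_one] at h5
        rw [Finset.sum_range_succ, ihR,
          show ((n + 1 : ℕ) : ℤ) - (R + 1 : ℕ) = n - R by push_cast; ring,
          show (n : ℤ) - (R + 1 : ℕ) = n - R - 1 by push_cast; ring, h2', coeffB, qPoch_self_succ,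
          ← pow_mul q 2 (n + 1), mul_comm 2, pow_mul q, h3]
        generalize q ^ ((n : ℤ) - R) = y
        field_simp
        ring
    have h := key (n + 1)
    rw [invPoch_of_neg q (n := (n : ℤ) - (n + 1 : ℕ)) (by push_cast; omega), mul_zero,
      Finset.sum_sub_distrib, ← Finset.mul_sum,
      Finset.sum_range_succ (fun k : ℕ => coeffB q k * invPoch q ((n : ℤ) - k)),
      invPoch_of_neg q (n := (n : ℤ) - (n + 1 : ℕ)) (by push_cast; omega), mul_zero, add_zero, ih,
      sub_eq_zero] at h
    rw [qPoch_self_succ, mul_inv, ← h, mul_comm (1 - _), mul_assoc, mul_inv_cancel₀ h1, mul_one]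

/-- The unit Bailey pair relative to a = 1, again by a closed form for the truncated sums. Its value
is that of `sum_coeffA`, as `poleSum_eq_heckeSum` demands. -/
theorem sum_evenKernel_A {q : ℂ} (hq : ‖q‖ < 1) (hq0 : q ≠ 0) (n : ℕ) :
    evenKernel q 0 n + ∑ r ∈ Finset.range n, (-1) ^ (r + 1) * q ^ ((r + 1) * r / 2) *
      (1 + q ^ (r + 1)) * evenKernel q (r + 1 : ℕ) n = if n = 0 then 1 else 0 := by
  rcases eq_or_ne n 0 with rfl | hn
  · simp [evenKernel, invPoch_zero]
  rw [if_neg hn]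
  have key : ∀ R : ℕ, (1 - q ^ n) * (evenKernel q 0 n + ∑ r ∈ Finset.range R,
      (-1) ^ (r + 1) * q ^ ((r + 1) * r / 2) * (1 + q ^ (r + 1)) * evenKernel q (r + 1 : ℕ) n) =
      (-1) ^ R * q ^ ((R + 1) * R / 2) * (invPoch q (n - R - 1) * invPoch q (n + R)) := by
    intro R
    induction R with
    | zero =>
      have := invPoch_eq_mul hq n
      simp [evenKernel, this]
      ring
    | succ R ih =>
      have h1 := invPoch_eq_mul hq (n - (R + 1 : ℕ))
      have h1' := invPoch_eq_mul hq (n + (R + 1 : ℕ))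
      have h2 : q ^ n = q ^ ((n : ℤ) - (R + 1 : ℕ)) * q ^ (R + 1) := by
        rw [← zpow_natCast q (R + 1), ← zpow_add₀ hq0, sub_add_cancel, zpow_natCast]
      have h3 : q ^ ((n : ℤ) + (R + 1 : ℕ)) =
          q ^ ((n : ℤ) - (R + 1 : ℕ)) * q ^ (R + 1) * q ^ (R + 1) := by
        rw [← h2, zpow_add₀ hq0, zpow_natCast, zpow_natCast]
      rw [Finset.sum_range_succ, ← add_assoc, mul_add, ih, triangle_succ (R + 1),
        show (n : ℤ) - R - 1 = n - (R + 1 : ℕ) by push_cast; ring,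
        show (n : ℤ) + R = n + (R + 1 : ℕ) - 1 by push_cast; ring, h1', h1, h3, h2, evenKernel,
        Nat.add_sub_cancel]
      generalize q ^ ((n : ℤ) - (R + 1 : ℕ)) = y
      ring
  have h := key n
  rw [invPoch_of_neg q (by omega), zero_mul, mul_zero] at h
  exact (mul_eq_zero.1 h).resolve_left (one_sub_pow_ne_zero hq hn)

/-- The Bailey pair α_r = 2(-1)^r q^(r²), β_n = 1/(q²;q²)_n relative to a = 1. The recurrence in n
is the one used for `sum_coeffB`. -/
theorem sum_evenKernel_B {q : ℂ} (hq : ‖q‖ < 1) (hq0 : q ≠ 0) (n : ℕ) :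
    evenKernel q 0 n + ∑ r ∈ Finset.range n, (-1) ^ (r + 1) * q ^ ((r + 1) ^ 2) * 2 *
      evenKernel q (r + 1 : ℕ) n = (qPoch (q ^ 2) (q ^ 2) n)⁻¹ := by
  have hq2 := sq_norm_lt_one hq
  induction n with
  | zero => simp [evenKernel, qPoch_zero, invPoch_zero]
  | succ n ih =>
    have h1 := one_sub_pow_ne_zero hq2 n.succ_ne_zero
    have key : ∀ R : ℕ, (1 - (q ^ 2) ^ (n + 1)) * (evenKernel q 0 (n + 1 : ℕ) +
        ∑ r ∈ Finset.range R, (-1) ^ (r + 1) * q ^ ((r + 1) ^ 2) * 2 *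
          evenKernel q (r + 1 : ℕ) (n + 1 : ℕ)) - (evenKernel q 0 n +
        ∑ r ∈ Finset.range R, (-1) ^ (r + 1) * q ^ ((r + 1) ^ 2) * 2 *
          evenKernel q (r + 1 : ℕ) n) =
        2 * q ^ (n + 1) * ((-1) ^ R * q ^ ((R + 1) * R)) *
          (invPoch q (n - R) * invPoch q (n + 1 + R)) := by
      intro R
      induction R with
      | zero =>
        have h3 := invPoch_eq_mul hq ((n : ℤ) + 1)
        have h4 : q ^ ((n : ℤ) + 1) = q ^ (n + 1) := by exact_mod_cast zpow_natCast q (n + 1)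
        rw [add_sub_cancel_right] at h3
        simp only [h4] at h3
        simp only [Finset.range_zero, Finset.sum_empty, add_zero, Nat.cast_zero, sub_zero, h3,
          pow_zero, mul_zero, evenKernel, Nat.cast_add, Nat.cast_one]
        ring
      | succ R ihR =>
        have h2 := evenKernel_eq_evenKernel_succ hq (R + 1 : ℕ) n
        have h2' := invPoch_eq_mul hq ((n : ℤ) - R)
        have h2'' := invPoch_eq_mul hq ((n : ℤ) + 1 + (R + 1 : ℕ))
        have h3 : q ^ (n + 1) = q ^ ((n : ℤ) - R) * q ^ (R + 1) := by
          rw [← zpow_natCast q (R + 1), ← zpow_natCast q (n + 1), ← zpow_add₀ hq0]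
          congr 1
          push_cast
          ring
        have h4 : q ^ ((n : ℤ) + 1 + (R + 1 : ℕ)) =
            q ^ ((n : ℤ) - R) * q ^ (R + 1) * q ^ (R + 1) := by
          rw [← h3, ← pow_add, ← zpow_natCast q]
          congr 1
        rw [Finset.sum_range_succ, Finset.sum_range_succ, ← add_assoc, ← add_assoc, mul_add,
          add_sub_add_comm, ihR, h2, show (n : ℤ) - (R + 1 : ℕ) = n - R - 1 by push_cast; ring,
          show (n : ℤ) + 1 + R = n + 1 + (R + 1 : ℕ) - 1 by push_cast; ring, h2', h2'', h4,
          show (n : ℤ) + 1 - (R + 1 : ℕ) = n - R by push_cast; ring,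
          pow_right_comm q 2 (n + 1), h3, evenKernel,
          show ((n + 1 : ℕ) : ℤ) - (R + 1 : ℕ) = n - R by push_cast; ring,
          show ((n + 1 : ℕ) : ℤ) + (R + 1 : ℕ) = n + 1 + (R + 1 : ℕ) by push_cast; ring,
          evenKernel, show ((n : ℤ) + 1) - (R + 1 : ℕ) = n - R by push_cast; ring]
        generalize q ^ ((n : ℤ) - R) = y
        ring
    have h := key (n + 1)
    rw [invPoch_of_neg q (n := (n : ℤ) - (n + 1 : ℕ)) (by push_cast; omega), zero_mul, mul_zero,
      Finset.sum_range_succ (fun r : ℕ => (-1) ^ (r + 1) * q ^ ((r + 1) ^ 2) * 2 *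
          evenKernel q (r + 1 : ℕ) n),
      evenKernel_of_lt q (r := (n + 1 : ℕ)) (n := n) (by push_cast; omega), mul_zero, add_zero, ih,
      sub_eq_zero] at h
    rw [qPoch_self_succ, mul_inv, ← h, mul_comm (1 - _), mul_assoc, mul_inv_cancel₀ h1, mul_one]

/-! ### Inner theta sums -/

/-- `p ^ (-(β i² + γ i))`. -/
def innerTerm (p : ℂ) (β γ : ℤ) (i : ℤ) : ℂ := p ^ (-(β * i ^ 2 + γ * i))

/-- The sum of `p ^ (-(β i² + γ i))` over `-r ≤ i ≤ r`. -/
def innerSum (p : ℂ) (β γ : ℤ) (r : ℕ) : ℂ :=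
  ∑ i ∈ Finset.Icc (-r : ℤ) r, innerTerm p β γ i

/-- The sum of `p ^ (-(β i² + γ i))` over `-s ≤ i < s`. -/
def innerSum' (p : ℂ) (β γ : ℤ) (s : ℕ) : ℂ :=
  ∑ i ∈ Finset.Ico (-s : ℤ) s, innerTerm p β γ i

theorem innerSum_eq_add (p : ℂ) (β γ : ℤ) (r : ℕ) :
    innerSum p β γ r = innerSum' p β γ r + innerTerm p β γ r := by
  rw [innerSum, innerSum', ← Finset.sum_Ico_add_eq_sum_Icc (by omega)]

theorem innerSum'_succ (p : ℂ) (β γ : ℤ) (r : ℕ) :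
    innerSum' p β γ (r + 1) = innerSum p β γ r + innerTerm p β γ (-(r + 1 : ℕ)) := by
  rw [innerSum, innerSum']
  have : Finset.Ico (-(r + 1 : ℕ) : ℤ) (r + 1 : ℕ) =
      insert (-(r + 1 : ℕ) : ℤ) (Finset.Icc (-r : ℤ) r) := by
    ext i
    simp only [Finset.mem_Ico, Finset.mem_insert, Finset.mem_Icc]
    push_cast
    omega
  rw [this, Finset.sum_insert (by simp), add_comm]

theorem innerSum_succ_sub (p : ℂ) (β γ : ℤ) (r : ℕ) : innerSum p β γ (r + 1) - innerSum p β γ r =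
    innerTerm p β γ (r + 1 : ℕ) + innerTerm p β γ (-(r + 1 : ℕ)) := by
  rw [innerSum_eq_add, innerSum'_succ]
  ring

theorem innerSum_zero (p : ℂ) (β γ : ℤ) : innerSum p β γ 0 = 1 := by
  simp [innerSum, innerTerm]

theorem innerSum'_zero (p : ℂ) (β γ : ℤ) : innerSum' p β γ 0 = 0 := by
  simp [innerSum']

/-- The condition β = γ + 1 says exactly that the terms at i = -(r+1) and i = r differ by the factor
p^(2r+1). It is used to write the Hecke coefficients as differences in `heckeCoeff_eq_sub`. -/
theorem innerSum'_combination {p : ℂ} (hp0 : p ≠ 0) {β γ : ℤ} (h : β = γ + 1) (r : ℕ) :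
    p ^ (2 * r + 1) * innerSum' p β γ (r + 1) + innerSum' p β γ r =
      (1 + p ^ (2 * r + 1)) * innerSum p β γ r := by
  have h1 : p ^ (2 * r + 1) * innerTerm p β γ (-(r + 1 : ℕ)) = innerTerm p β γ r := by
    rw [innerTerm, innerTerm, ← zpow_natCast p, ← zpow_add₀ hp0]
    congr 1
    subst h
    push_cast
    ring
  rw [innerSum'_succ, mul_add, h1, innerSum_eq_add]
  ring

/-- With s = r + 1, p^(3s²) (p^(-(2s²+s)) + p^(-(2s²-s))) = q^(s(s-1)/2) (1 + q^s), which is the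
coefficient of the unit pair up to sign. In `poleSum_coeffB` both exponents are 2s², which gives
2q^(s²). -/
theorem poleSum_coeffA {q p : ℂ} (hq : ‖q‖ < 1) (hq0 : q ≠ 0) (hp : p ^ 2 = q) (n : ℕ) :
    poleSum q (coeffA q) p n =
      ∑ r ∈ Finset.range (n + 1), heckeCoeff p (innerSum p 2 1) r * oddKernel q r n := by
  have hp0 : p ≠ 0 := by rintro rfl; simp at hp; exact hq0 hp.symm
  refine poleSum_eq_heckeSum hq hq0 hp (by simp [coeffA, qPoch_zero]) (innerSum_zero _ _ _) ?_ n
  intro n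
  rw [sum_coeffA hq hq0, ← sum_evenKernel_A hq hq0, innerSum_zero, one_mul]
  congr 1
  refine Finset.sum_congr rfl fun r _ => ?_
  have h1 : p ^ (3 * (r + 1) ^ 2) * innerTerm p 2 1 (-(r + 1 : ℕ)) = q ^ ((r + 1) * r / 2) *
      q ^ (r + 1) := by
    rw [← pow_add, ← hp, ← pow_mul, innerTerm, ← zpow_natCast p, ← zpow_add₀ hp0,
      ← zpow_natCast p]
    congr 1
    have : 2 * ((r + 1) * r / 2) = (r + 1) * r :=
      Nat.mul_div_cancel' (by rw [mul_comm]; exact (Nat.even_mul_succ_self r).two_dvd)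
    rw [mul_add, this]
    push_cast
    ring
  have h2 : p ^ (3 * (r + 1) ^ 2) * innerTerm p 2 1 (r + 1 : ℕ) = q ^ ((r + 1) * r / 2) := by
    rw [← hp, ← pow_mul, innerTerm, ← zpow_natCast p, ← zpow_add₀ hp0,
      ← zpow_natCast p]
    congr 1
    have : 2 * ((r + 1) * r / 2) = (r + 1) * r :=
      Nat.mul_div_cancel' (by rw [mul_comm]; exact (Nat.even_mul_succ_self r).two_dvd)
    rw [this]
    push_cast
    ring
  rw [innerSum_succ_sub]
  linear_combination (-1) ^ r * evenKernel q (r + 1 : ℕ) n * (h1 + h2)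

theorem poleSum_coeffB {q p : ℂ} (hq : ‖q‖ < 1) (hq0 : q ≠ 0) (hp : p ^ 2 = q) (n : ℕ) :
    poleSum q (coeffB q) p n =
      ∑ r ∈ Finset.range (n + 1), heckeCoeff p (innerSum p 1 0) r * oddKernel q r n := by
  have hp0 : p ≠ 0 := by rintro rfl; simp at hp; exact hq0 hp.symm
  refine poleSum_eq_heckeSum hq hq0 hp (by simp [coeffB, qPoch_zero]) (innerSum_zero _ _ _) ?_ n
  intro n
  rw [sum_coeffB hq hq0, ← sum_evenKernel_B hq hq0, innerSum_zero, one_mul]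
  congr 1
  refine Finset.sum_congr rfl fun r _ => ?_
  have h1 : p ^ (3 * (r + 1) ^ 2) * innerTerm p 1 0 (-(r + 1 : ℕ)) = q ^ ((r + 1) ^ 2) := by
    rw [← hp, ← pow_mul, innerTerm, ← zpow_natCast p, ← zpow_add₀ hp0, ← zpow_natCast p]
    congr 1
    push_cast
    ring
  have h2 : p ^ (3 * (r + 1) ^ 2) * innerTerm p 1 0 (r + 1 : ℕ) = q ^ ((r + 1) ^ 2) := by
    rw [← hp, ← pow_mul, innerTerm, ← zpow_natCast p, ← zpow_add₀ hp0, ← zpow_natCast p]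
    congr 1
    push_cast
    ring
  rw [innerSum_succ_sub]
  linear_combination (-1) ^ r * evenKernel q (r + 1 : ℕ) n * (h1 + h2)

/-! ### Estimates and conjugate Bailey pairs. -/

/-! ### Bounds for `q`-factorials -/

theorem sum_pow_succ_le {r : ℝ} (h0 : 0 ≤ r) (h1 : r < 1) (n : ℕ) :
    ∑ j ∈ Finset.range n, r ^ (j + 1) ≤ 1 / (1 - r) := by
  calc ∑ j ∈ Finset.range n, r ^ (j + 1) ≤ ∑ j ∈ Finset.range n, r ^ j :=
        Finset.sum_le_sum fun j _ => pow_le_pow_of_le_one h0 h1.le j.le_succ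
    _ ≤ ∑' j, r ^ j := (summable_geometric_of_lt_one h0 h1).sum_le_tsum _ fun j _ => by positivity
    _ = 1 / (1 - r) := by rw [tsum_geometric_of_lt_one h0 h1, one_div]

/-- `q`-factorials and their reciprocals are bounded. -/
theorem exists_qPoch_bound {q : ℂ} (hq : ‖q‖ < 1) :
    ∃ C : ℝ, 1 ≤ C ∧ ∀ n, ‖qPoch q q n‖ ≤ C ∧ ‖(qPoch q q n)⁻¹‖ ≤ C := by
  set r := ‖q‖ with hr
  have h0 : 0 ≤ r := norm_nonneg q
  have h1 : 0 < 1 - r := by linarith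
  have h2 : 1 ≤ 1 / (1 - r) := by rw [le_div_iff₀ h1]; linarith
  have hle : ∀ n : ℕ, (∑ j ∈ Finset.range n, r ^ (j + 1)) * (1 / (1 - r)) ≤
      1 / (1 - r) * (1 / (1 - r)) := fun n =>
    mul_le_mul_of_nonneg_right (sum_pow_succ_le h0 hq n) (by positivity)
  -- One exponent serves both bounds: for x = r^(j+1), 1 + x ≤ exp x and 1/(1 - x) = 1 + x/(1 - x) ≤
  -- exp(x/(1 - x)), where 1/(1 - x) ≤ 1/(1 - r) and the x sum to at most 1/(1 - r).
  refine ⟨Real.exp (1 / (1 - r) * (1 / (1 - r))), Real.one_le_exp (by positivity),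
    fun n => ⟨?_, ?_⟩⟩
  · refine le_trans ?_ (Real.exp_le_exp.2 (hle n))
    rw [qPoch, norm_prod, Finset.sum_mul, Real.exp_sum]
    refine Finset.prod_le_prod (fun _ _ => norm_nonneg _) fun j _ => ?_
    rw [← pow_succ']
    have h3 : 0 ≤ r ^ (j + 1) := by positivity
    calc ‖1 - q ^ (j + 1)‖ ≤ 1 + r ^ (j + 1) := by
          refine (norm_sub_le _ _).trans ?_
          rw [norm_one, norm_pow]
      _ ≤ Real.exp (r ^ (j + 1)) := by linarith [Real.add_one_le_exp (r ^ (j + 1))]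
      _ ≤ _ := Real.exp_le_exp.2 (le_mul_of_one_le_right h3 h2)
  · refine le_trans ?_ (Real.exp_le_exp.2 (hle n))
    rw [norm_inv, qPoch, norm_prod, Finset.sum_mul, Real.exp_sum, ← Finset.prod_inv_distrib]
    refine Finset.prod_le_prod (fun _ _ => inv_nonneg.2 (norm_nonneg _)) fun j _ => ?_
    rw [← pow_succ']
    have h3 : 0 ≤ r ^ (j + 1) := by positivity
    have h4 : r ^ (j + 1) ≤ r := by
      simpa using pow_le_pow_of_le_one h0 hq.le (Nat.succ_le_succ (Nat.zero_le j))
    have h5 : 0 < 1 - r ^ (j + 1) := by linarith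
    have h6 : 1 - r ^ (j + 1) ≤ ‖1 - q ^ (j + 1)‖ := by
      have := norm_sub_norm_le (1 : ℂ) (q ^ (j + 1))
      rwa [norm_one, norm_pow] at this
    calc ‖1 - q ^ (j + 1)‖⁻¹ ≤ (1 - r ^ (j + 1))⁻¹ := inv_anti₀ h5 h6
      _ = r ^ (j + 1) * (1 / (1 - r ^ (j + 1))) + 1 := by field_simp; ring
      _ ≤ Real.exp (r ^ (j + 1) * (1 / (1 - r ^ (j + 1)))) := Real.add_one_le_exp _
      _ ≤ _ := by
        refine Real.exp_le_exp.2 (mul_le_mul_of_nonneg_left ?_ h3)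
        exact one_div_le_one_div_of_le h1 (by linarith)

theorem norm_invPoch_le {q : ℂ} {C : ℝ} (hC : 1 ≤ C)
    (h : ∀ n, ‖qPoch q q n‖ ≤ C ∧ ‖(qPoch q q n)⁻¹‖ ≤ C) (n : ℤ) : ‖invPoch q n‖ ≤ C := by
  unfold invPoch
  split_ifs
  · simp; linarith
  · exact (h _).2

theorem norm_oddKernel_le {q : ℂ} {C : ℝ} (hC : 1 ≤ C)
    (h : ∀ n, ‖qPoch q q n‖ ≤ C ∧ ‖(qPoch q q n)⁻¹‖ ≤ C) (r n : ℤ) :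
    ‖oddKernel q r n‖ ≤ C * C := by
  rw [oddKernel, norm_mul]
  exact mul_le_mul (norm_invPoch_le hC h _) (norm_invPoch_le hC h _) (norm_nonneg _) (by linarith)

theorem norm_evenKernel_le {q : ℂ} {C : ℝ} (hC : 1 ≤ C)
    (h : ∀ n, ‖qPoch q q n‖ ≤ C ∧ ‖(qPoch q q n)⁻¹‖ ≤ C) (r n : ℤ) :
    ‖evenKernel q r n‖ ≤ C * C := by
  rw [evenKernel, norm_mul]
  exact mul_le_mul (norm_invPoch_le hC h _) (norm_invPoch_le hC h _) (norm_nonneg _) (by linarith)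

/-! ### Weights with summable kernels -/

/-- The partial sums in `m` of `w_m / ((q)_{m-r} (q)_{m+r+1})`. -/
def kernelSum (q : ℂ) (w : ℕ → ℂ) (r M : ℕ) : ℂ :=
  ∑ m ∈ Finset.range M, w m * oddKernel q r m

theorem kernelSum_of_le (q : ℂ) (w : ℕ → ℂ) {r M : ℕ} (h : M ≤ r) : kernelSum q w r M = 0 := by
  refine Finset.sum_eq_zero fun m hm => ?_
  rw [oddKernel_of_lt q (by have := Finset.mem_range.1 hm; omega), mul_zero]

/-- The weights `w` form a conjugate pair with `κ`, for averages of consecutive partial sums. -/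
structure ConjugateWeight (q : ℂ) (w κ : ℕ → ℂ) : Prop where
  bound : ∃ C : ℝ, ∀ r M : ℕ, ‖kernelSum q w r M‖ ≤ C * (r + 1)
  tendsto : ∀ r : ℕ, Tendsto (fun M => (kernelSum q w r M + kernelSum q w r (M + 1)) / 2) atTop
    (𝓝 (κ r))

/-- For each r a combination of the r-th and (r+1)-st kernels telescopes in m, so `kernelSum` at r +
1 is -v_{r+1} times that at r, up to a boundary term. As |v| ≤ 1, each step in r adds at most C,
whence the linear bound. The boundary terms need not vanish in the limit; only the sums of two
consecutive ones must. -/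
theorem conjugateWeight_of_telescoping {q : ℂ} {w κ v : ℕ → ℂ} {G : ℕ → ℕ → ℂ} {C : ℝ}
    (hv : ∀ r, ‖v r‖ ≤ 1)
    (h0 : ∀ m : ℕ, 2 * (w m * oddKernel q 0 m) = G 0 m - G 0 (m + 1))
    (hs : ∀ r m : ℕ, w m * (oddKernel q (r + 1 : ℕ) m + v (r + 1) * oddKernel q r m) =
      G (r + 1) m - G (r + 1) (m + 1))
    (hG0 : G 0 0 = 2 * κ 0) (hG : ∀ r, G (r + 1) 0 = 0) (hκ : ∀ r, κ (r + 1) = -v (r + 1) * κ r)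
    (hC : ∀ r m, ‖G r m‖ ≤ C)
    (hlim : ∀ r, Tendsto (fun M => G r M + G r (M + 1)) atTop (𝓝 0)) : ConjugateWeight q w κ := by
  have e0 : ∀ M, kernelSum q w 0 M = κ 0 - G 0 M / 2 := by
    intro M
    have : 2 * kernelSum q w 0 M = G 0 0 - G 0 M := by
      rw [kernelSum, Finset.mul_sum, ← Finset.sum_range_sub' (G 0)]
      exact Finset.sum_congr rfl fun m _ => h0 m
    rw [hG0] at this
    linear_combination this / 2
  have es : ∀ r M, kernelSum q w (r + 1) M = -v (r + 1) * kernelSum q w r M - G (r + 1) M := by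
    intro r M
    have : kernelSum q w (r + 1) M + v (r + 1) * kernelSum q w r M = G (r + 1) 0 - G (r + 1) M := by
      rw [kernelSum, kernelSum, Finset.mul_sum, ← Finset.sum_range_sub' (G (r + 1)),
        ← Finset.sum_add_distrib]
      refine Finset.sum_congr rfl fun m _ => ?_
      rw [← hs]
      ring
    rw [hG] at this
    linear_combination this
  refine ⟨⟨‖κ 0‖ + C, fun r M => ?_⟩, fun r => ?_⟩
  · have hC0 : 0 ≤ C := (norm_nonneg _).trans (hC 0 0)
    induction r with
    | zero =>
      rw [e0]
      refine (norm_sub_le _ _).trans ?_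
      have : ‖G 0 M / 2‖ ≤ C := by
        rw [norm_div, Complex.norm_ofNat]
        linarith [hC 0 M]
      simpa using this
    | succ r ih =>
      rw [es]
      refine (norm_sub_le _ _).trans ?_
      have h1 : ‖-v (r + 1) * kernelSum q w r M‖ ≤ (‖κ 0‖ + C) * (r + 1) := by
        rw [norm_mul, norm_neg]
        exact (mul_le_of_le_one_left (norm_nonneg _) (hv _)).trans ih
      have h2 := hC (r + 1) M
      have h3 := norm_nonneg (κ 0)
      push_cast
      nlinarith
  · induction r with
    | zero =>
      have := ((hlim 0).div_const 4).const_sub (κ 0)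
      rw [zero_div, sub_zero] at this
      refine this.congr fun M => ?_
      rw [e0, e0]
      ring
    | succ r ih =>
      have := (ih.const_mul (-v (r + 1))).sub ((hlim (r + 1)).div_const 2)
      rw [zero_div, sub_zero, ← hκ] at this
      refine this.congr fun M => ?_
      rw [es, es]
      ring

/-- `(-1) ^ m (q; q)_m q ^ (m (m + 1) / 2)`. -/
def weight₁ (q : ℂ) (m : ℕ) : ℂ := (-1) ^ m * qPoch q q m * q ^ (m * (m + 1) / 2)

/-- `(-1) ^ m (q ^ 2; q ^ 2)_m`. -/
def weight₂ (q : ℂ) (m : ℕ) : ℂ := (-1) ^ m * qPoch (q ^ 2) (q ^ 2) m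

/-- `(-1) ^ r q ^ (r (r + 1) / 2)`. -/
def kappa₁ (q : ℂ) (r : ℕ) : ℂ := (-1) ^ r * q ^ (r * (r + 1) / 2)

/-- `(-1) ^ r / 2`. -/
def kappa₂ (r : ℕ) : ℂ := (-1) ^ r / 2

theorem triangle_succ' (k : ℕ) : (k + 1) * (k + 1 + 1) / 2 = k * (k + 1) / 2 + (k + 1) := by
  have h := Nat.triangle_succ (k + 1)
  rw [Nat.add_sub_cancel, Nat.add_sub_cancel, mul_comm (k + 1 + 1), mul_comm (k + 1) k] at h
  exact h

theorem norm_pow_le_one {q : ℂ} (hq : ‖q‖ < 1) (n : ℕ) : ‖q ^ n‖ ≤ 1 := by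
  rw [norm_pow]
  exact pow_le_one₀ (norm_nonneg _) hq.le

theorem le_triangle (m : ℕ) : m ≤ m * (m + 1) / 2 := by
  rw [Nat.le_div_iff_mul_le two_pos]
  nlinarith [Nat.zero_le m, Nat.le_mul_self m]

theorem tendsto_pow_zero {q : ℂ} (hq : ‖q‖ < 1) : Tendsto (fun n : ℕ => q ^ n) atTop (𝓝 0) :=
  tendsto_pow_atTop_nhds_zero_of_norm_lt_one hq

theorem zpow_succ_sub {q : ℂ} (hq0 : q ≠ 0) (m r : ℕ) :
    q ^ ((m : ℤ) + 1 - r) = q ^ (m + 1) / q ^ r := by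
  rw [zpow_sub₀ hq0, zpow_natCast]
  congr 1

theorem zpow_succ_add (q : ℂ) (m r : ℕ) : q ^ ((m : ℤ) + 1 + r) = q ^ (m + 1) * q ^ r := by
  rw [← pow_add]
  exact_mod_cast zpow_natCast q (m + 1 + r)

theorem conjugateWeight₁ {q : ℂ} (hq : ‖q‖ < 1) (hq0 : q ≠ 0) :
    ConjugateWeight q (weight₁ q) (kappa₁ q) := by
  obtain ⟨C, hC, hb⟩ := exists_qPoch_bound hq
  have hbound : ∀ r m : ℕ, ‖(1 + q ^ r) * weight₁ q m * evenKernel q r m‖ ≤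
      2 * (C * (C * C)) * ‖q‖ ^ m := by
    intro r m
    have h1 : ‖1 + q ^ r‖ ≤ 2 := by
      refine (norm_add_le _ _).trans ?_
      have := norm_pow_le_one hq r
      rw [norm_one]
      linarith
    have h2 : ‖weight₁ q m‖ ≤ C * ‖q‖ ^ m := by
      rw [weight₁, norm_mul, norm_mul, norm_pow, norm_neg, norm_one, one_pow, one_mul, norm_pow]
      exact mul_le_mul (hb m).1 (pow_le_pow_of_le_one (norm_nonneg _) hq.le (le_triangle m))
        (by positivity) (by linarith)
    rw [norm_mul, norm_mul]
    calc _ ≤ 2 * (C * ‖q‖ ^ m) * (C * C) := by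
          gcongr
          exact norm_evenKernel_le hC hb _ _
      _ = _ := by ring
  refine conjugateWeight_of_telescoping (v := fun r => q ^ r)
    (G := fun r m => (1 + q ^ r) * weight₁ q m * evenKernel q r m)
    (C := 2 * (C * (C * C))) (fun r => norm_pow_le_one hq r) ?_ ?_ ?_ ?_ ?_ ?_ ?_
  · intro m
    have h1 := evenKernel_eq_evenKernel_succ hq 0 m
    have h2 := oddKernel_eq_evenKernel_succ hq 0 m
    have h3 : q ^ ((m : ℤ) + 1) = q ^ (m + 1) := by exact_mod_cast zpow_natCast q (m + 1)
    simp only [sub_zero, add_zero, h3] at h1 h2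
    simp only [Nat.cast_zero, pow_zero, Nat.cast_add, Nat.cast_one]
    rw [h1, h2, weight₁, weight₁, qPoch_self_succ, triangle_succ']
    ring
  · intro r m
    have h1 := evenKernel_eq_evenKernel_succ hq (r + 1 : ℕ) m
    have h2 := oddKernel_eq_evenKernel_succ hq (r + 1 : ℕ) m
    have h3 := oddKernel_pred_eq_evenKernel_succ hq (r + 1 : ℕ) m
    rw [show ((r + 1 : ℕ) : ℤ) - 1 = r by push_cast; ring] at h3
    rw [zpow_succ_sub hq0] at h1 h2
    rw [zpow_succ_add] at h1 h3
    rw [h2, h3, h1, weight₁, weight₁, qPoch_self_succ, triangle_succ', Nat.cast_add m 1,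
      Nat.cast_one]
    have := pow_ne_zero (r + 1) hq0
    generalize evenKernel q (r + 1 : ℕ) (m + 1) = g
    field_simp
    ring
  · simp [kappa₁, weight₁, qPoch_zero, evenKernel, invPoch_zero]
    norm_num
  · intro r
    simp only [Nat.cast_zero]
    rw [evenKernel_of_lt q (by push_cast; omega), mul_zero]
  · intro r
    rw [kappa₁, kappa₁, triangle_succ']
    ring
  · intro r m
    refine (hbound r m).trans (mul_le_of_le_one_right (by positivity) ?_)
    exact pow_le_one₀ (norm_nonneg _) hq.le
  · intro r
    have h1 : Tendsto (fun m : ℕ => (1 + q ^ r) * weight₁ q m * evenKernel q r m) atTop (𝓝 0) := by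
      refine squeeze_zero_norm (hbound r) ?_
      rw [show (0 : ℝ) = 2 * (C * (C * C)) * 0 by ring]
      exact (tendsto_pow_atTop_nhds_zero_of_lt_one (norm_nonneg _) hq).const_mul _
    have := h1.add (h1.comp (tendsto_add_atTop_nat 1))
    rw [add_zero] at this
    exact this

/-- Unlike `weight₁`, this weight gives boundary terms G that only stay bounded. They alternate in
sign, and two consecutive ones add up to q^(M+1) times a bounded quantity, which suffices for
averages. -/
theorem conjugateWeight₂ {q : ℂ} (hq : ‖q‖ < 1) (hq0 : q ≠ 0) :
    ConjugateWeight q (weight₂ q) kappa₂ := by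
  obtain ⟨C, hC, hb⟩ := exists_qPoch_bound hq
  obtain ⟨C', hC', hb'⟩ := exists_qPoch_bound (sq_norm_lt_one hq)
  have hw : ∀ m, ‖weight₂ q m‖ ≤ C' := fun m => by
    rw [weight₂, norm_mul, norm_pow, norm_neg, norm_one, one_pow, one_mul]
    exact (hb' m).1
  refine conjugateWeight_of_telescoping (v := fun _ => 1)
    (G := fun r m => weight₂ q m * evenKernel q r m)
    (C := C' * (C * C)) (fun r => by simp) ?_ ?_ ?_ ?_ ?_ ?_ ?_
  · intro m
    have h1 := evenKernel_eq_evenKernel_succ hq 0 m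
    have h2 := oddKernel_eq_evenKernel_succ hq 0 m
    have h3 : q ^ ((m : ℤ) + 1) = q ^ (m + 1) := by exact_mod_cast zpow_natCast q (m + 1)
    simp only [sub_zero, add_zero, h3] at h1 h2
    simp only [Nat.cast_zero, Nat.cast_add, Nat.cast_one]
    rw [h1, h2, weight₂, weight₂, qPoch_self_succ]
    ring
  · intro r m
    have h1 := evenKernel_eq_evenKernel_succ hq (r + 1 : ℕ) m
    have h2 := oddKernel_eq_evenKernel_succ hq (r + 1 : ℕ) m
    have h3 := oddKernel_pred_eq_evenKernel_succ hq (r + 1 : ℕ) m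
    rw [show ((r + 1 : ℕ) : ℤ) - 1 = r by push_cast; ring] at h3
    rw [zpow_succ_sub hq0] at h1 h2
    rw [zpow_succ_add] at h1 h3
    rw [h2, h3, h1, weight₂, weight₂, qPoch_self_succ, Nat.cast_add m 1, Nat.cast_one]
    have := pow_ne_zero (r + 1) hq0
    generalize evenKernel q (r + 1 : ℕ) (m + 1) = g
    field_simp
    ring
  · simp [kappa₂, weight₂, qPoch_zero, evenKernel, invPoch_zero]
  · intro r
    simp only [Nat.cast_zero]
    rw [evenKernel_of_lt q (by push_cast; omega), mul_zero]
  · intro r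
    rw [kappa₂, kappa₂]
    ring
  · intro r m
    rw [norm_mul]
    exact mul_le_mul (hw m) (norm_evenKernel_le hC hb _ _) (norm_nonneg _) (by linarith)
  · intro r
    have h1 : ∀ M : ℕ, weight₂ q M * evenKernel q r M +
        weight₂ q (M + 1) * evenKernel q r (M + 1 : ℕ) =
        q ^ (M + 1) * (weight₂ q M * evenKernel q r (M + 1 : ℕ) *
          (2 * q ^ (M + 1) - 1 / q ^ r - q ^ r)) := by
      intro M
      have h1 := evenKernel_eq_evenKernel_succ hq r M
      rw [zpow_succ_sub hq0, zpow_succ_add] at h1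
      rw [h1, weight₂, weight₂, qPoch_self_succ, Nat.cast_add M 1, Nat.cast_one]
      have := pow_ne_zero r hq0
      generalize evenKernel q r (M + 1) = g
      field_simp
      ring
    simp only [h1]
    have h2 : Tendsto (fun M : ℕ => q ^ (M + 1)) atTop (𝓝 0) :=
      (tendsto_pow_zero hq).comp (tendsto_add_atTop_nat 1)
    refine NormedField.tendsto_zero_smul_of_tendsto_zero_of_bounded h2
      (isBoundedUnder_of ⟨C' * (C * C) * (2 + ‖1 / q ^ r‖ + 1), fun M => ?_⟩)
    simp only [Function.comp]
    rw [norm_mul, norm_mul]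
    have h3 : ‖2 * q ^ (M + 1) - 1 / q ^ r - q ^ r‖ ≤ 2 + ‖1 / q ^ r‖ + 1 := by
      refine (norm_sub_le _ _).trans (add_le_add ((norm_sub_le _ _).trans
        (add_le_add ?_ le_rfl)) (norm_pow_le_one hq r))
      rw [norm_mul, Complex.norm_ofNat]
      linarith [norm_pow_le_one hq (M + 1)]
    have h4 := norm_evenKernel_le hC hb r (M + 1 : ℕ)
    have h5 := hw M
    gcongr

/-! ### Limits of averaged partial sums -/

/-- Dominated convergence, with dominating sequence C |A_r| (r + 1). The finite ranges agree with
the full sums over r because K r M = 0 for r ≥ M. -/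
theorem tendsto_average_tsum {K : ℕ → ℕ → ℂ} {κ : ℕ → ℂ} {A : ℕ → ℂ} {C : ℝ}
    (hC : ∀ r M : ℕ, ‖K r M‖ ≤ C * (r + 1)) (h0 : ∀ r M, M ≤ r → K r M = 0)
    (hlim : ∀ r, Tendsto (fun M => (K r M + K r (M + 1)) / 2) atTop (𝓝 (κ r)))
    (hA : Summable fun r : ℕ => ‖A r‖ * (r + 1)) :
    Tendsto (fun M => (∑ r ∈ Finset.range M, A r * K r M +
      ∑ r ∈ Finset.range (M + 1), A r * K r (M + 1)) / 2) atTop (𝓝 (∑' r, A r * κ r)) := by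
  have h1 := tendsto_tsum_of_dominated_convergence (𝓕 := atTop) (hA.mul_left C)
    (f := fun M r => A r * ((K r M + K r (M + 1)) / 2)) (g := fun r => A r * κ r)
    (fun r => (hlim r).const_mul (A r)) (Eventually.of_forall fun M r => by
      have h2 : ‖(K r M + K r (M + 1)) / 2‖ ≤ C * (r + 1) := by
        rw [norm_div, Complex.norm_ofNat, div_le_iff₀ two_pos]
        linarith [norm_add_le (K r M) (K r (M + 1)), hC r M, hC r (M + 1)]
      rw [norm_mul]
      nlinarith [norm_nonneg (A r)])
  refine h1.congr fun M => ?_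
  rw [tsum_eq_sum (s := Finset.range (M + 1))]
  · have : ∑ r ∈ Finset.range M, A r * K r M = ∑ r ∈ Finset.range (M + 1), A r * K r M := by
      rw [Finset.sum_range_succ, h0 M M le_rfl, mul_zero, add_zero]
    rw [this, ← Finset.sum_add_distrib, Finset.sum_div]
    exact Finset.sum_congr rfl fun r _ => by ring
  · intro r hr
    have : M + 1 ≤ r := by simpa using hr
    rw [h0 r M (by omega), h0 r (M + 1) this]
    simp

theorem sum_weight_mul_eq {q : ℂ} (w : ℕ → ℂ) {A b : ℕ → ℂ}
    (hb : ∀ n : ℕ, b n = ∑ r ∈ Finset.range (n + 1), A r * oddKernel q r n) (M : ℕ) :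
    ∑ m ∈ Finset.range M, w m * b m = ∑ r ∈ Finset.range M, A r * kernelSum q w r M := by
  have : ∀ m ∈ Finset.range M, w m * b m =
      ∑ r ∈ Finset.range M, w m * (A r * oddKernel q r m) := by
    intro m hm
    rw [hb, Finset.mul_sum]
    refine Finset.sum_subset (Finset.range_subset_range.2 (Finset.mem_range.1 hm)) fun r _ hr => ?_
    rw [oddKernel_of_lt q (by have := Finset.mem_range.not.1 hr; omega), mul_zero, mul_zero]
  rw [Finset.sum_congr rfl this, Finset.sum_comm]
  refine Finset.sum_congr rfl fun r _ => ?_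
  rw [kernelSum, Finset.mul_sum]
  exact Finset.sum_congr rfl fun m _ => by ring

theorem ConjugateWeight.tendsto_average {q : ℂ} {w κ : ℕ → ℂ} (hw : ConjugateWeight q w κ)
    {A b : ℕ → ℂ} (hb : ∀ n : ℕ, b n = ∑ r ∈ Finset.range (n + 1), A r * oddKernel q r n)
    (hA : Summable fun r : ℕ => ‖A r‖ * (r + 1)) :
    Tendsto (fun M => (∑ m ∈ Finset.range M, w m * b m +
      ∑ m ∈ Finset.range (M + 1), w m * b m) / 2) atTop (𝓝 (∑' r, A r * κ r)) := by
  obtain ⟨C, hC⟩ := hw.bound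
  simp only [sum_weight_mul_eq w hb]
  exact tendsto_average_tsum hC (fun r M h => kernelSum_of_le q w h) hw.tendsto hA

/-- This combination trades the factor q^(m+1), which depends on the summation variable, for
q^(t+1). With X = q^(m+1) and s = q^(t+1), both sides are X (1 - s²) times `evenKernel q (t + 1) (m
+ 1)`. -/
theorem pow_mul_evenKernel_sub {q : ℂ} (hq : ‖q‖ < 1) (hq0 : q ≠ 0) (t m : ℕ) :
    q ^ (m + 1) * (oddKernel q t m - q ^ (2 * (t + 1)) * oddKernel q (t + 1 : ℕ) m) =
      q ^ (t + 1) * (oddKernel q t m - oddKernel q (t + 1 : ℕ) m) := by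
  have h2 := oddKernel_eq_evenKernel_succ hq (t + 1 : ℕ) m
  have h3 := oddKernel_pred_eq_evenKernel_succ hq (t + 1 : ℕ) m
  rw [show ((t + 1 : ℕ) : ℤ) - 1 = t by push_cast; ring, zpow_succ_add] at h3
  rw [zpow_succ_sub hq0] at h2
  rw [h2, h3]
  have := pow_ne_zero (t + 1) hq0
  generalize evenKernel q (t + 1 : ℕ) (m + 1) = g
  field_simp
  ring

/-- The sequence P is a primitive of A that makes the combinations of `pow_mul_evenKernel_sub`
appear after summation by parts. The shifted weights then need no conjugate pair of their own: κ_t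
is replaced by κ_t - κ_{t+1}. -/
theorem sum_shifted_weight_mul_eq {q : ℂ} (hq : ‖q‖ < 1) (hq0 : q ≠ 0) (w : ℕ → ℂ) {A P b : ℕ → ℂ}
    (hb : ∀ n : ℕ, b n = ∑ r ∈ Finset.range (n + 1), A r * oddKernel q r n)
    (hP0 : P 0 = 0) (hP : ∀ r, A r = P (r + 1) - q ^ (2 * r) * P r) (M : ℕ) :
    ∑ m ∈ Finset.range M, w m * q ^ (m + 1) * b m = ∑ t ∈ Finset.range M,
      P (t + 1) * q ^ (t + 1) * (kernelSum q w t M - kernelSum q w (t + 1) M) := by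
  have h1 : ∀ m : ℕ, b m = ∑ t ∈ Finset.range (m + 1),
      P (t + 1) * (oddKernel q t m - q ^ (2 * (t + 1)) * oddKernel q (t + 1 : ℕ) m) := by
    intro m
    have key : ∀ R : ℕ, ∑ r ∈ Finset.range R, A r * oddKernel q r m = ∑ t ∈ Finset.range R,
        P (t + 1) * (oddKernel q t m - q ^ (2 * (t + 1)) * oddKernel q (t + 1 : ℕ) m) +
        P R * q ^ (2 * R) * oddKernel q R m := by
      intro R
      induction R with
      | zero => simp [hP0]
      | succ R ih =>
        rw [Finset.sum_range_succ, Finset.sum_range_succ, ih, hP]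
        ring
    rw [hb, key, oddKernel_of_lt q (by push_cast; omega), mul_zero, add_zero]
  have h2 : ∀ m ∈ Finset.range M, w m * q ^ (m + 1) * b m = ∑ t ∈ Finset.range M,
      P (t + 1) * q ^ (t + 1) * (w m * oddKernel q t m - w m * oddKernel q (t + 1 : ℕ) m) := by
    intro m hm
    rw [h1, Finset.mul_sum]
    have h3 : ∀ t : ℕ, w m * q ^ (m + 1) * (P (t + 1) * (oddKernel q t m -
        q ^ (2 * (t + 1)) * oddKernel q (t + 1 : ℕ) m)) = P (t + 1) * q ^ (t + 1) *
          (w m * oddKernel q t m - w m * oddKernel q (t + 1 : ℕ) m) := by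
      intro t
      linear_combination w m * P (t + 1) * pow_mul_evenKernel_sub hq hq0 t m
    rw [Finset.sum_congr rfl fun t _ => h3 t]
    refine Finset.sum_subset (Finset.range_subset_range.2 (Finset.mem_range.1 hm)) fun r _ hr => ?_
    have := Finset.mem_range.not.1 hr
    rw [oddKernel_of_lt q (by omega), oddKernel_of_lt q (by push_cast; omega)]
    ring
  rw [Finset.sum_congr rfl h2, Finset.sum_comm]
  refine Finset.sum_congr rfl fun r _ => ?_
  rw [kernelSum, kernelSum, ← Finset.sum_sub_distrib, Finset.mul_sum]

theorem ConjugateWeight.tendsto_average_shifted {q : ℂ} (hq : ‖q‖ < 1) (hq0 : q ≠ 0)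
    {w κ : ℕ → ℂ} (hw : ConjugateWeight q w κ) {A P b : ℕ → ℂ}
    (hb : ∀ n : ℕ, b n = ∑ r ∈ Finset.range (n + 1), A r * oddKernel q r n)
    (hP0 : P 0 = 0) (hP : ∀ r, A r = P (r + 1) - q ^ (2 * r) * P r)
    (hS : Summable fun r : ℕ => ‖P (r + 1) * q ^ (r + 1)‖ * (r + 1)) :
    Tendsto (fun M => (∑ m ∈ Finset.range M, w m * q ^ (m + 1) * b m +
      ∑ m ∈ Finset.range (M + 1), w m * q ^ (m + 1) * b m) / 2) atTop
      (𝓝 (∑' t, P (t + 1) * q ^ (t + 1) * (κ t - κ (t + 1)))) := by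
  obtain ⟨C, hC⟩ := hw.bound
  simp only [sum_shifted_weight_mul_eq hq hq0 w hb hP0 hP]
  refine tendsto_average_tsum (C := 3 * C)
    (K := fun t M => kernelSum q w t M - kernelSum q w (t + 1) M) (fun r M => ?_) (fun r M h => ?_)
    (fun r => ?_) hS
  · have hC0 : 0 ≤ C := by simpa using (norm_nonneg _).trans (hC 0 0)
    have h1 := hC r M
    have h2 := hC (r + 1) M
    have h3 := norm_sub_le (kernelSum q w r M) (kernelSum q w (r + 1) M)
    have h4 : 0 ≤ C * r := by positivity
    push_cast at h2
    linarith
  · simp only [kernelSum_of_le q w h, kernelSum_of_le q w (h.trans r.le_succ), sub_zero]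
  · refine ((hw.tendsto r).sub (hw.tendsto (r + 1))).congr fun M => ?_
    ring

/-! ### Bounds for the coefficients -/

/-- `(-1) ^ (s - 1) p ^ (3 s² - 2 s) S'_s`. -/
def heckeCoeff' (p : ℂ) (S' : ℕ → ℂ) (s : ℕ) : ℂ :=
  -(-1) ^ s * p ^ (3 * s ^ 2 - 2 * s) * S' s

/-- The sums over -s ≤ i < s, with the outer factor below, supply the primitive P of
`sum_shifted_weight_mul_eq`. The exponent 3s² - 2s at s = r + 1 is (3r² + 2r) + (2r + 1), matching
the two parts of `innerSum'_combination`. -/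
theorem heckeCoeff_eq_sub {p q : ℂ} (hp : p ^ 2 = q) {S S' : ℕ → ℂ}
    (h : ∀ r, p ^ (2 * r + 1) * S' (r + 1) + S' r = (1 + p ^ (2 * r + 1)) * S r) (r : ℕ) :
    heckeCoeff p S r = heckeCoeff' p S' (r + 1) - q ^ (2 * r) * heckeCoeff' p S' r := by
  have hr : r ≤ r ^ 2 := Nat.le_self_pow two_ne_zero r
  have h1 : p ^ (3 * (r + 1) ^ 2 - 2 * (r + 1)) = p ^ (3 * r ^ 2 + 2 * r) * p ^ (2 * r + 1) := by
    rw [← pow_add]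
    congr 1
    zify [show 2 * (r + 1) ≤ 3 * (r + 1) ^ 2 by nlinarith]
    ring
  have h2 : q ^ (2 * r) * p ^ (3 * r ^ 2 - 2 * r) = p ^ (3 * r ^ 2 + 2 * r) := by
    rw [← hp, ← pow_mul, ← pow_add]
    congr 1
    omega
  rw [heckeCoeff, heckeCoeff', heckeCoeff', h1]
  linear_combination (-(-1) ^ r * p ^ (3 * r ^ 2 + 2 * r)) * h r - (-1) ^ r * S' r * h2

theorem norm_innerTerm_le {p : ℂ} (hp : ‖p‖ < 1) (hp0 : p ≠ 0) {β γ : ℤ}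
    (hβ2 : β ≤ 2) (hγ : 0 ≤ γ) (hγ1 : γ ≤ 1) {i : ℤ} {r : ℕ} (hi : -r ≤ i) (hi' : i ≤ r) :
    ‖innerTerm p β γ i‖ ≤ ‖p‖ ^ (-(2 * r ^ 2 + r : ℤ)) := by
  rw [innerTerm, norm_zpow]
  refine zpow_le_zpow_right_of_le_one₀ (norm_pos_iff.2 hp0) hp.le ?_
  have h1 : i ^ 2 ≤ (r : ℤ) ^ 2 := sq_le_sq' hi hi'
  have h2 : γ * i ≤ r := by nlinarith
  nlinarith [sq_nonneg i]

theorem norm_innerSum_le {p : ℂ} (hp : ‖p‖ < 1) (hp0 : p ≠ 0) {β γ : ℤ}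
    (hβ2 : β ≤ 2) (hγ : 0 ≤ γ) (hγ1 : γ ≤ 1) (r : ℕ) :
    ‖innerSum p β γ r‖ ≤ (2 * r + 1) * ‖p‖ ^ (-(2 * r ^ 2 + r : ℤ)) := by
  refine (norm_sum_le_of_le _ fun i hi => norm_innerTerm_le hp hp0 hβ2 hγ hγ1
    (Finset.mem_Icc.1 hi).1 (Finset.mem_Icc.1 hi).2).trans (le_of_eq ?_)
  rw [Finset.sum_const, Int.card_Icc, nsmul_eq_mul]
  congr 1
  rw [show ((r : ℤ) + 1 - -r).toNat = 2 * r + 1 by omega]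
  push_cast
  ring

theorem norm_innerSum'_le {p : ℂ} (hp : ‖p‖ < 1) (hp0 : p ≠ 0) {β γ : ℤ}
    (hβ2 : β ≤ 2) (hγ : 0 ≤ γ) (hγ1 : γ ≤ 1) (r : ℕ) :
    ‖innerSum' p β γ r‖ ≤ (2 * r) * ‖p‖ ^ (-(2 * r ^ 2 + r : ℤ)) := by
  refine (norm_sum_le_of_le _ fun i hi => norm_innerTerm_le hp hp0 hβ2 hγ hγ1
    (Finset.mem_Ico.1 hi).1 (Finset.mem_Ico.1 hi).2.le).trans (le_of_eq ?_)
  rw [Finset.sum_const, Int.card_Ico, nsmul_eq_mul]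
  congr 1
  rw [show ((r : ℤ) - -r).toNat = 2 * r by omega]
  push_cast
  ring

theorem summable_sq_mul_geometric {r : ℝ} (h0 : 0 ≤ r) (h1 : r < 1) :
    Summable fun n : ℕ => 4 * ((n : ℝ) + 1) ^ 2 * r ^ n := by
  have h : ‖r‖ < 1 := by rwa [Real.norm_of_nonneg h0]
  have := (((summable_pow_mul_geometric_of_norm_lt_one 2 h).add
    ((summable_pow_mul_geometric_of_norm_lt_one 1 h).mul_left 2)).add
      (summable_pow_mul_geometric_of_norm_lt_one 0 h)).mul_left 4
  refine this.congr fun n => ?_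
  ring

/-- The outer exponent 3r² + 2r exceeds the worst inner one, 2r² + r, by r² + r ≥ r, so a geometric
series with quadratic factor dominates. -/
theorem summable_heckeCoeff {p : ℂ} (hp : ‖p‖ < 1) (hp0 : p ≠ 0) {β γ : ℤ}
    (hβ2 : β ≤ 2) (hγ : 0 ≤ γ) (hγ1 : γ ≤ 1) :
    Summable fun r : ℕ => ‖heckeCoeff p (innerSum p β γ) r‖ * (r + 1) := by
  refine Summable.of_nonneg_of_le (fun r => by positivity) (fun r => ?_)
    (summable_sq_mul_geometric (norm_nonneg p) hp)
  have h0 : 0 < ‖p‖ := norm_pos_iff.2 hp0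
  have h1 := norm_innerSum_le hp hp0 hβ2 hγ hγ1 r
  have h2 : ‖1 + p ^ (2 * r + 1)‖ ≤ 2 := by
    refine (norm_add_le _ _).trans ?_
    have := norm_pow_le_one hp (2 * r + 1)
    rw [norm_one]
    linarith
  have h3 : ‖p‖ ^ (3 * r ^ 2 + 2 * r) * ‖p‖ ^ (-(2 * r ^ 2 + r : ℤ)) ≤ ‖p‖ ^ r := by
    rw [← zpow_natCast, ← zpow_add₀ h0.ne', ← zpow_natCast]
    refine zpow_le_zpow_right_of_le_one₀ h0 hp.le ?_
    push_cast
    nlinarith [sq_nonneg (r : ℤ)]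
  rw [heckeCoeff, norm_mul, norm_mul, norm_mul, norm_pow, norm_neg, norm_one, one_pow, one_mul,
    norm_pow]
  calc ‖p‖ ^ (3 * r ^ 2 + 2 * r) * ‖1 + p ^ (2 * r + 1)‖ * ‖innerSum p β γ r‖ * (r + 1)
      ≤ ‖p‖ ^ (3 * r ^ 2 + 2 * r) * 2 *
        ((2 * r + 1) * ‖p‖ ^ (-(2 * r ^ 2 + r : ℤ))) * (r + 1) := by gcongr
    _ = (‖p‖ ^ (3 * r ^ 2 + 2 * r) * ‖p‖ ^ (-(2 * r ^ 2 + r : ℤ))) *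
        (2 * (2 * r + 1) * (r + 1)) := by ring
    _ ≤ ‖p‖ ^ r * (4 * ((r : ℝ) + 1) ^ 2) := by
        refine mul_le_mul h3 ?_ (by positivity) (by positivity)
        nlinarith [(Nat.cast_nonneg r : (0 : ℝ) ≤ r)]
    _ = _ := by ring

theorem summable_heckeCoeff' {p q : ℂ} (hp : ‖p‖ < 1) (hp0 : p ≠ 0) (hpq : p ^ 2 = q) {β γ : ℤ}
    (hβ2 : β ≤ 2) (hγ : 0 ≤ γ) (hγ1 : γ ≤ 1) :
    Summable fun r : ℕ => ‖heckeCoeff' p (innerSum' p β γ) (r + 1) * q ^ (r + 1)‖ * (r + 1) := by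
  refine Summable.of_nonneg_of_le (fun r => by positivity) (fun r => ?_)
    (summable_sq_mul_geometric (norm_nonneg p) hp)
  have h0 : 0 < ‖p‖ := norm_pos_iff.2 hp0
  have h1 := norm_innerSum'_le hp hp0 hβ2 hγ hγ1 (r + 1)
  have h3 : ‖p‖ ^ (3 * (r + 1) ^ 2 - 2 * (r + 1)) * ‖q‖ ^ (r + 1) *
      ‖p‖ ^ (-(2 * (r + 1 : ℕ) ^ 2 + (r + 1 : ℕ) : ℤ)) ≤ ‖p‖ ^ r := by
    rw [← hpq, norm_pow, ← pow_mul, ← pow_add, ← zpow_natCast, ← zpow_add₀ h0.ne', ← zpow_natCast]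
    refine zpow_le_zpow_right_of_le_one₀ h0 hp.le ?_
    push_cast [show 2 * (r + 1) ≤ 3 * (r + 1) ^ 2 by nlinarith]
    nlinarith [sq_nonneg (r : ℤ)]
  rw [heckeCoeff', norm_mul, norm_mul, norm_mul, norm_neg, norm_pow, norm_neg, norm_one, one_pow,
    one_mul, norm_pow, norm_pow]
  push_cast at h1 h3
  calc ‖p‖ ^ (3 * (r + 1) ^ 2 - 2 * (r + 1)) * ‖innerSum' p β γ (r + 1)‖ * ‖q‖ ^ (r + 1) * (r + 1)
      ≤ ‖p‖ ^ (3 * (r + 1) ^ 2 - 2 * (r + 1)) *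
        (2 * (r + 1) * ‖p‖ ^ (-(2 * ((r : ℤ) + 1) ^ 2 + (r + 1)))) * ‖q‖ ^ (r + 1) * (r + 1) := by
          gcongr
    _ = (‖p‖ ^ (3 * (r + 1) ^ 2 - 2 * (r + 1)) * ‖q‖ ^ (r + 1) *
        ‖p‖ ^ (-(2 * ((r : ℤ) + 1) ^ 2 + (r + 1)))) * (2 * ((r : ℝ) + 1) * (r + 1)) := by ring
    _ ≤ ‖p‖ ^ r * (4 * ((r : ℝ) + 1) ^ 2) := by
        refine mul_le_mul h3 ?_ (by positivity) (by positivity)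
        nlinarith [(Nat.cast_nonneg r : (0 : ℝ) ≤ r)]
    _ = _ := by ring

/-! ### From the twelve double series to Hecke-type series. -/

/-! ### Averaged and starred sums of sequences -/

/-- The averages of consecutive partial sums of `u` converge to `L`. -/
def HasAverage (u : ℕ → ℂ) (L : ℂ) : Prop :=
  Tendsto (fun M => (∑ m ∈ Finset.range M, u m + ∑ m ∈ Finset.range (M + 1), u m) / 2) atTop (𝓝 L)

/-- The even and the odd partial sums of `u` converge, and the average of the limits is `L`. -/
def StarHasSum (u : ℕ → ℂ) (L : ℂ) : Prop :=
  ∃ l₁ l₂ : ℂ, Tendsto (fun N => ∑ n ∈ Finset.range (2 * N + 1), u n) atTop (𝓝 l₁) ∧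
    Tendsto (fun N => ∑ n ∈ Finset.range (2 * N + 1 + 1), u n) atTop (𝓝 l₂) ∧ (l₁ + l₂) / 2 = L

theorem HasAverage.linear {u v : ℕ → ℂ} {K L : ℂ} (hu : HasAverage u K) (hv : HasAverage v L)
    (a b : ℂ) : HasAverage (fun n => a * u n + b * v n) (a * K + b * L) := by
  refine ((hu.const_mul a).add (hv.const_mul b)).congr fun M => ?_
  simp only [Finset.sum_add_distrib, ← Finset.mul_sum]
  ring

theorem HasAverage.const_mul' {u : ℕ → ℂ} {K : ℂ} (hu : HasAverage u K) (a : ℂ) :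
    HasAverage (fun n => a * u n) (a * K) := by
  simpa using hu.linear hu a 0

theorem hasAverage_of_hasSum {u : ℕ → ℂ} {K : ℂ} (hu : HasSum u K) : HasAverage u K := by
  have h := hu.tendsto_sum_nat
  have := (h.add (h.comp (tendsto_add_atTop_nat 1))).div_const 2
  rwa [add_self_div_two] at this

theorem StarHasSum.linear {u v : ℕ → ℂ} {K L : ℂ} (hu : StarHasSum u K) (hv : StarHasSum v L)
    (a b : ℂ) : StarHasSum (fun n => a * u n + b * v n) (a * K + b * L) := by
  obtain ⟨l₁, l₂, h1, h2, h3⟩ := hu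
  obtain ⟨m₁, m₂, h1', h2', h3'⟩ := hv
  refine ⟨a * l₁ + b * m₁, a * l₂ + b * m₂, ((h1.const_mul a).add (h1'.const_mul b)).congr ?_,
    ((h2.const_mul a).add (h2'.const_mul b)).congr ?_, ?_⟩
  · intro N
    simp only [Finset.sum_add_distrib, ← Finset.mul_sum]
  · intro N
    simp only [Finset.sum_add_distrib, ← Finset.mul_sum]
  · rw [← h3, ← h3']
    ring

/-- The average alone does not separate the even and odd limits. If b_n → t, the term by which two
consecutive partial sums differ tends to ±t, so these limits are L + t/2 and L - t/2. -/
theorem HasAverage.starHasSum {b : ℕ → ℂ} {L t : ℂ} (h : HasAverage (fun n => (-1) ^ n * b n) L)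
    (hb : Tendsto b atTop (𝓝 t)) : StarHasSum (fun n => (-1) ^ n * b n) L := by
  have hN : Tendsto (fun N : ℕ => 2 * N + 1) atTop atTop :=
    tendsto_atTop_mono (fun N => show N ≤ 2 * N + 1 by omega) tendsto_id
  have h1 := h.comp hN
  have h2 := (hb.comp hN).div_const 2
  have h3 : ∀ N : ℕ, ((-1 : ℂ)) ^ (2 * N + 1) = -1 := fun N => by rw [pow_succ, pow_mul]; simp
  refine ⟨L + t / 2, L - t / 2, (h1.add h2).congr fun N => ?_, (h1.sub h2).congr fun N => ?_,
    by ring⟩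
  · simp only [Function.comp, Finset.sum_range_succ _ (2 * N + 1), h3]
    ring
  · simp only [Function.comp, Finset.sum_range_succ _ (2 * N + 1), h3]
    ring

theorem starHasSum_neg_one_pow : StarHasSum (fun n => (-1) ^ n) (1 / 2) := by
  have h : ∀ N : ℕ, ∑ n ∈ Finset.range (2 * N + 1), ((-1) ^ n : ℂ) = 1 ∧
      ∑ n ∈ Finset.range (2 * N + 1 + 1), ((-1) ^ n : ℂ) = 0 := by
    intro N
    simp [neg_one_geom_sum, parity_simps]
  refine ⟨1, 0, tendsto_const_nhds.congr fun N => (h N).1.symm,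
    tendsto_const_nhds.congr fun N => (h N).2.symm, by ring⟩

theorem starHasSum_of_hasSum {u : ℕ → ℂ} {K : ℂ} (hu : HasSum u K) : StarHasSum u K := by
  have hN : Tendsto (fun N : ℕ => 2 * N + 1) atTop atTop :=
    tendsto_atTop_mono (fun N => show N ≤ 2 * N + 1 by omega) tendsto_id
  exact ⟨K, K, hu.tendsto_sum_nat.comp hN,
    hu.tendsto_sum_nat.comp ((tendsto_add_atTop_nat 1).comp hN), by ring⟩

theorem StarHasSum.starSummable {a : ℕ → ℕ → ℂ} {L : ℂ}
    (h : StarHasSum (fun n => ∑ k ∈ Finset.range (n + 1), a k n) L) : StarSummable a := by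
  obtain ⟨l₁, l₂, h1, h2, -⟩ := h
  exact ⟨⟨l₁, h1⟩, ⟨l₂, h2⟩⟩

theorem StarHasSum.starSum_eq {a : ℕ → ℕ → ℂ} {L : ℂ}
    (h : StarHasSum (fun n => ∑ k ∈ Finset.range (n + 1), a k n) L) : starSum a = L := by
  obtain ⟨l₁, l₂, h1, h2, h3⟩ := h
  rw [starSum, ← h3]
  congr 2
  · exact h1.limUnder_eq
  · exact h2.limUnder_eq

/-! ### Double sums -/

/-- The shift `(k, n) ↦ (k + 1, n + 1)`. -/
def indexShift : indexPairs 0 ≃ indexPairs 1 where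
  toFun p := ⟨(p.1.1 + 1, p.1.2 + 1), by
    obtain ⟨⟨k, n⟩, h⟩ := p
    simp only [indexPairs, Set.mem_ofPred_eq] at h ⊢
    omega⟩
  invFun p := ⟨(p.1.1 - 1, p.1.2 - 1), by
    obtain ⟨⟨k, n⟩, h⟩ := p
    simp only [indexPairs, Set.mem_ofPred_eq] at h ⊢
    omega⟩
  left_inv p := by simp
  right_inv p := by
    obtain ⟨⟨k, n⟩, h⟩ := p
    simp only [indexPairs, Set.mem_ofPred_eq] at h
    refine Subtype.ext (Prod.ext ?_ ?_) <;> dsimp only <;> omega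

theorem doubleSum_one (a : ℕ → ℕ → ℂ) :
    doubleSum 1 a = doubleSum 0 (fun k n => a (k + 1) (n + 1)) :=
  (indexShift.tsum_eq (fun p : indexPairs 1 => a p.1.1 p.1.2)).symm

theorem doubleSummable_one (a : ℕ → ℕ → ℂ) :
    DoubleSummable 1 a ↔ DoubleSummable 0 (fun k n => a (k + 1) (n + 1)) :=
  (indexShift.summable_iff (f := fun p : indexPairs 1 => a p.1.1 p.1.2)).symm

/-- The pairs `(n, k)` with `k ≤ n`. -/
def indexSigma : (Σ n : ℕ, Fin (n + 1)) ≃ indexPairs 0 where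
  toFun p := ⟨(p.2, p.1), by
    simp only [indexPairs, Set.mem_ofPred_eq]
    omega⟩
  invFun p := ⟨p.1.2, p.1.1, Nat.lt_succ_of_le p.2.2⟩
  left_inv p := by simp
  right_inv p := by simp

theorem doubleSummable_of_bound {a : ℕ → ℕ → ℂ} {C r : ℝ} (h0 : 0 ≤ r) (h1 : r < 1)
    (h : ∀ k n, k ≤ n → ‖a k n‖ ≤ C * r ^ n) : DoubleSummable 0 a := by
  refine indexSigma.summable_iff.1 (Summable.of_norm ?_)
  refine (summable_sigma_of_nonneg fun _ => norm_nonneg _).2 ⟨fun n => Summable.of_finite, ?_⟩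
  have hr : ‖r‖ < 1 := by rwa [Real.norm_of_nonneg h0]
  have hs : Summable fun n : ℕ => C * ((n : ℝ) ^ 1 * r ^ n + (n : ℝ) ^ 0 * r ^ n) :=
    ((summable_pow_mul_geometric_of_norm_lt_one 1 hr).add
      (summable_pow_mul_geometric_of_norm_lt_one 0 hr)).mul_left C
  refine Summable.of_nonneg_of_le (fun n => tsum_nonneg fun _ => norm_nonneg _) (fun n => ?_) hs
  rw [tsum_fintype]
  calc _ ≤ ∑ _k : Fin (n + 1), C * r ^ n :=
        Finset.sum_le_sum fun k _ => h k n (Nat.lt_succ_iff.1 k.2)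
    _ = _ := by
      rw [Finset.sum_const, Finset.card_univ, Fintype.card_fin, nsmul_eq_mul]
      push_cast
      ring

theorem DoubleSummable.hasSum {a : ℕ → ℕ → ℂ} (h : DoubleSummable 0 a) :
    HasSum (fun n => ∑ k ∈ Finset.range (n + 1), a k n) (doubleSum 0 a) := by
  have h1 : HasSum (fun p : Σ n : ℕ, Fin (n + 1) => a p.2 p.1) (doubleSum 0 a) :=
    indexSigma.hasSum_iff.2 (Summable.hasSum h)
  simpa only [Finset.sum_range] using h1.sigma fun n => hasSum_fintype _

theorem DoubleSummable.doubleSum_eq {a : ℕ → ℕ → ℂ} (h : DoubleSummable 0 a) {L : ℂ}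
    (hL : HasAverage (fun n => ∑ k ∈ Finset.range (n + 1), a k n) L) : doubleSum 0 a = L :=
  tendsto_nhds_unique (hasAverage_of_hasSum h.hasSum) hL

/-! ### Theta families -/

/-- The coefficients `c` have the pole expansions attached to the inner exponents `β i² + γ i`. -/
structure ThetaFamily (q : ℂ) (c : ℕ → ℂ) (β γ : ℤ) : Prop where
  eq_add_one : β = γ + 1
  le_two : β ≤ 2
  nonneg : 0 ≤ γ
  bound : ∃ C : ℝ, ∀ n, ‖c n‖ ≤ C
  bound_sum : ∃ C : ℝ, ∀ n : ℕ, ‖∑ k ∈ Finset.range (n + 1), c k * invPoch q (n - k)‖ ≤ C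
  pair : ∀ p : ℂ, p ^ 2 = q → ∀ n : ℕ, poleSum q c p n =
    ∑ r ∈ Finset.range (n + 1), heckeCoeff p (innerSum p β γ) r * oddKernel q r n

theorem norm_neg_one_pow_mul_pow_div_le {q : ℂ} (hq : ‖q‖ < 1) {C : ℝ} {x : ℂ} (hx : ‖x⁻¹‖ ≤ C)
    (k m : ℕ) : ‖(-1) ^ k * q ^ m / x‖ ≤ C := by
  rw [div_eq_mul_inv, norm_mul, norm_mul, norm_pow, norm_neg, norm_one, one_pow, one_mul]
  exact (mul_le_of_le_one_left (norm_nonneg _) (norm_pow_le_one hq m)).trans hx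

theorem thetaFamilyA {q : ℂ} (hq : ‖q‖ < 1) (hq0 : q ≠ 0) : ThetaFamily q (coeffA q) 2 1 where
  eq_add_one := rfl
  le_two := le_rfl
  nonneg := by norm_num
  bound := by
    obtain ⟨C, -, hb⟩ := exists_qPoch_bound hq
    exact ⟨C, fun n => norm_neg_one_pow_mul_pow_div_le hq (hb n).2 _ _⟩
  bound_sum := ⟨1, fun n => by rw [sum_coeffA hq hq0]; split_ifs <;> simp⟩
  pair _ hp := poleSum_coeffA hq hq0 hp

theorem thetaFamilyB {q : ℂ} (hq : ‖q‖ < 1) (hq0 : q ≠ 0) : ThetaFamily q (coeffB q) 1 0 where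
  eq_add_one := rfl
  le_two := by norm_num
  nonneg := le_rfl
  bound := by
    obtain ⟨C, -, hb⟩ := exists_qPoch_bound (sq_norm_lt_one hq)
    exact ⟨C, fun n => norm_neg_one_pow_mul_pow_div_le hq (hb n).2 _ _⟩
  bound_sum := by
    obtain ⟨C, -, hb⟩ := exists_qPoch_bound (sq_norm_lt_one hq)
    exact ⟨C, fun n => by rw [sum_coeffB hq hq0]; exact (hb n).2⟩
  pair _ hp := poleSum_coeffB hq hq0 hp

/-- `∑_{k ≤ n} y_k / ((q)_{n-k} (1 - q ^ (2 k + 1)))`. -/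
def oddPoleSum (q : ℂ) (y : ℕ → ℂ) (n : ℕ) : ℂ :=
  ∑ k ∈ Finset.range (n + 1), y k * invPoch q (n - k) / (1 - q ^ (2 * k + 1))

/-- From 1/(1 - p q^k) = (1 + p q^k)/(1 - q^(2k+1)). Comparing p with -p recovers the sums with
numerators c_k q^k and c_k q^(2k). -/
theorem poleSum_eq_add {q p : ℂ} (hq : ‖q‖ < 1) (hp : p ^ 2 = q) (c : ℕ → ℂ) (n : ℕ) :
    poleSum q c p n = oddPoleSum q (fun k => c k * q ^ k) n +
      p * oddPoleSum q (fun k => c k * q ^ (2 * k)) n := by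
  rw [poleSum, oddPoleSum, oddPoleSum, Finset.mul_sum, ← Finset.sum_add_distrib]
  refine Finset.sum_congr rfl fun k _ => ?_
  have h : 1 - q ^ (2 * k + 1) = (1 - p * q ^ k) * (1 + p * q ^ k) := by
    rw [pow_succ, ← hp]
    ring
  have h1 := one_sub_pow_ne_zero hq (n := 2 * k + 1) (by omega)
  rw [h] at h1 ⊢
  have h2 := left_ne_zero_of_mul h1
  rw [mul_div_assoc', ← add_div, div_eq_div_iff h2 h1]
  ring

/-- From 1 = (1 - q^(2k+1)) + q · q^(2k). It handles `L4`, `L8` and `L12`, whose numerators are c_k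
itself; the pole-free remainder is what their additive constants cancel. -/
theorem oddPoleSum_eq_add {q : ℂ} (hq : ‖q‖ < 1) (c : ℕ → ℂ) (n : ℕ) :
    oddPoleSum q c n = ∑ k ∈ Finset.range (n + 1), c k * invPoch q (n - k) +
      q * oddPoleSum q (fun k => c k * q ^ (2 * k)) n := by
  rw [oddPoleSum, oddPoleSum, Finset.mul_sum, ← Finset.sum_add_distrib]
  refine Finset.sum_congr rfl fun k _ => ?_
  have h1 := one_sub_pow_ne_zero hq (n := 2 * k + 1) (by omega)
  field_simp
  ring

theorem ThetaFamily.norm_poleSum_le {q : ℂ} {c : ℕ → ℂ} {β γ : ℤ} (hc : ThetaFamily q c β γ)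
    (hq : ‖q‖ < 1) {p : ℂ} (hp : ‖p‖ < 1) (hp0 : p ≠ 0) (hpq : p ^ 2 = q) :
    ∃ C : ℝ, ∀ n, ‖poleSum q c p n‖ ≤ C := by
  obtain ⟨C, hC, hb⟩ := exists_qPoch_bound hq
  have hs := summable_heckeCoeff hp hp0 hc.le_two hc.nonneg (by linarith [hc.eq_add_one, hc.le_two])
  refine ⟨(∑' r : ℕ, ‖heckeCoeff p (innerSum p β γ) r‖ * (r + 1)) * (C * C), fun n => ?_⟩
  rw [hc.pair p hpq]
  refine (norm_sum_le _ _).trans ?_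
  calc _ ≤ ∑ r ∈ Finset.range (n + 1),
        ‖heckeCoeff p (innerSum p β γ) r‖ * (r + 1) * (C * C) := by
        refine Finset.sum_le_sum fun r _ => ?_
        rw [norm_mul]
        refine mul_le_mul ?_ (norm_oddKernel_le hC hb _ _) (norm_nonneg _) (by positivity)
        exact le_mul_of_one_le_right (norm_nonneg _) (by linarith [(Nat.cast_nonneg r : (0:ℝ) ≤ r)])
    _ ≤ _ := by
        rw [← Finset.sum_mul]
        exact mul_le_mul_of_nonneg_right (hs.sum_le_tsum _ fun _ _ => by positivity) (by positivity)

/-- By `poleSum_succ`, consecutive terms differ by q^(n+1) times a bounded quantity, so the sequence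
is Cauchy. This supplies the limit t in `HasAverage.starHasSum`. -/
theorem ThetaFamily.tendsto_poleSum {q : ℂ} {c : ℕ → ℂ} {β γ : ℤ} (hc : ThetaFamily q c β γ)
    (hq : ‖q‖ < 1) {p : ℂ} (hp : ‖p‖ < 1) (hp0 : p ≠ 0) (hpq : p ^ 2 = q) :
    ∃ t : ℂ, Tendsto (fun n => qPoch (q ^ 2) (q ^ 2) n * poleSum q c p n) atTop (𝓝 t) := by
  have hq0 : q ≠ 0 := hpq ▸ pow_ne_zero 2 hp0
  obtain ⟨C, hC, hb⟩ := exists_qPoch_bound (sq_norm_lt_one hq)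
  obtain ⟨B, hB⟩ := hc.norm_poleSum_le hq hp hp0 hpq
  obtain ⟨D, hD⟩ := hc.bound_sum
  have hz : ∀ k : ℕ, 1 - p * q ^ k ≠ 0 := fun k => by
    rw [← hpq, ← pow_mul, ← pow_succ']
    exact one_sub_pow_ne_zero hp (by omega)
  refine cauchySeq_tendsto_of_complete
    (cauchySeq_of_le_geometric ‖q‖ (C * (2 * B + D)) hq fun n => ?_)
  have h1 := poleSum_succ hq hq0 c hz n
  have h2 : qPoch (q ^ 2) (q ^ 2) n * poleSum q c p n -
      qPoch (q ^ 2) (q ^ 2) (n + 1) * poleSum q c p (n + 1) =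
      q ^ (n + 1) * (qPoch (q ^ 2) (q ^ 2) n * ((q ^ (n + 1) - p) * poleSum q c p (n + 1) -
        ∑ k ∈ Finset.range (n + 2), c k * invPoch q ((n + 1 : ℕ) - k))) := by
    rw [qPoch_self_succ]
    linear_combination -qPoch (q ^ 2) (q ^ 2) n * h1
  have h3 : ‖q ^ (n + 1) - p‖ ≤ 2 := by
    refine (norm_sub_le _ _).trans ?_
    linarith [norm_pow_le_one hq (n + 1)]
  have h4 := hD (n + 1)
  have h5 : 0 ≤ B := (norm_nonneg _).trans (hB 0)
  have h6 : 0 ≤ D := (norm_nonneg _).trans (hD 0)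
  have h7 : ‖(q ^ (n + 1) - p) * poleSum q c p (n + 1) -
      ∑ k ∈ Finset.range (n + 2), c k * invPoch q ((n + 1 : ℕ) - k)‖ ≤ 2 * B + D := by
    refine (norm_sub_le _ _).trans (add_le_add ?_ h4)
    rw [norm_mul]
    exact mul_le_mul h3 (hB _) (norm_nonneg _) (by norm_num)
  rw [dist_eq_norm, h2, norm_mul, norm_mul, norm_pow, mul_comm]
  refine mul_le_mul (mul_le_mul (hb n).1 h7 (norm_nonneg _) (by linarith)) ?_ (by positivity)
    (by positivity)
  exact pow_le_pow_of_le_one (norm_nonneg _) hq.le n.le_succ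

/-- The Hecke-type series `∑_r (-1) ^ r p ^ (3 r² + 2 r) (1 + p ^ (2 r + 1)) S_r κ_r`. -/
def heckeSeries (p : ℂ) (β γ : ℤ) (κ : ℕ → ℂ) : ℂ :=
  ∑' r, heckeCoeff p (innerSum p β γ) r * κ r

/-- The companion of `heckeSeries` for the shifted weights. -/
def heckeSeries' (p q : ℂ) (β γ : ℤ) (κ : ℕ → ℂ) : ℂ :=
  ∑' t, heckeCoeff' p (innerSum' p β γ) (t + 1) * q ^ (t + 1) * (κ t - κ (t + 1))

section Averages

variable {q : ℂ} {c w κ : ℕ → ℂ} {β γ : ℤ} {p : ℂ}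

theorem ThetaFamily.hasAverage (hc : ThetaFamily q c β γ)
    (hw : ConjugateWeight q w κ) (hp : ‖p‖ < 1) (hp0 : p ≠ 0) (hpq : p ^ 2 = q) :
    HasAverage (fun m => w m * poleSum q c p m) (heckeSeries p β γ κ) :=
  hw.tendsto_average (hc.pair p hpq) (summable_heckeCoeff hp hp0 hc.le_two hc.nonneg
    (by linarith [hc.eq_add_one, hc.le_two]))

theorem ThetaFamily.hasAverage_shifted (hc : ThetaFamily q c β γ) (hq : ‖q‖ < 1)
    (hw : ConjugateWeight q w κ) (hp : ‖p‖ < 1) (hp0 : p ≠ 0) (hpq : p ^ 2 = q) :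
    HasAverage (fun m => w m * q ^ (m + 1) * poleSum q c p m) (heckeSeries' p q β γ κ) :=
  hw.tendsto_average_shifted hq (hpq ▸ pow_ne_zero 2 hp0) (hc.pair p hpq)
    (by simp [heckeCoeff', innerSum'_zero])
    (heckeCoeff_eq_sub hpq (innerSum'_combination hp0 hc.eq_add_one))
    (summable_heckeCoeff' hp hp0 hpq hc.le_two hc.nonneg
      (by linarith [hc.eq_add_one, hc.le_two]))

theorem oddPoleSum_even {q p : ℂ} (hq : ‖q‖ < 1) (hpq : p ^ 2 = q) (c : ℕ → ℂ) (n : ℕ) :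
    oddPoleSum q (fun k => c k * q ^ k) n =
      1 / 2 * poleSum q c p n + 1 / 2 * poleSum q c (-p) n := by
  rw [poleSum_eq_add hq hpq, poleSum_eq_add hq (p := -p) (by rw [neg_sq, hpq])]
  ring

theorem oddPoleSum_odd {q p : ℂ} (hq : ‖q‖ < 1) (hp0 : p ≠ 0) (hpq : p ^ 2 = q) (c : ℕ → ℂ)
    (n : ℕ) : oddPoleSum q (fun k => c k * q ^ (2 * k)) n =
      1 / (2 * p) * poleSum q c p n + -1 / (2 * p) * poleSum q c (-p) n := by
  rw [poleSum_eq_add hq hpq, poleSum_eq_add hq (p := -p) (by rw [neg_sq, hpq])]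
  field_simp
  ring

theorem HasAverage.even {p : ℂ} {W : ℕ → ℂ} {K K' : ℂ} (hq : ‖q‖ < 1) (hpq : p ^ 2 = q)
    (h : HasAverage (fun m => W m * poleSum q c p m) K)
    (h' : HasAverage (fun m => W m * poleSum q c (-p) m) K') :
    HasAverage (fun m => W m * oddPoleSum q (fun k => c k * q ^ k) m) ((K + K') / 2) := by
  convert h.linear h' (1 / 2) (1 / 2) using 1
  · funext m
    rw [oddPoleSum_even hq hpq]
    ring
  · ring

theorem HasAverage.odd {p : ℂ} {W : ℕ → ℂ} {K K' : ℂ} (hq : ‖q‖ < 1) (hp0 : p ≠ 0)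
    (hpq : p ^ 2 = q) (h : HasAverage (fun m => W m * poleSum q c p m) K)
    (h' : HasAverage (fun m => W m * poleSum q c (-p) m) K') :
    HasAverage (fun m => W m * oddPoleSum q (fun k => c k * q ^ (2 * k)) m)
      ((K - K') / (2 * p)) := by
  convert h.linear h' (1 / (2 * p)) (-1 / (2 * p)) using 1
  · funext m
    rw [oddPoleSum_odd hq hp0 hpq]
    ring
  · ring

theorem ThetaFamily.starHasSum_even (hc : ThetaFamily q c β γ) (hq : ‖q‖ < 1) (hp : ‖p‖ < 1)
    (hp0 : p ≠ 0) (hpq : p ^ 2 = q) {K : ℂ}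
    (h : HasAverage (fun m => weight₂ q m * oddPoleSum q (fun k => c k * q ^ k) m) K) :
    StarHasSum (fun m => weight₂ q m * oddPoleSum q (fun k => c k * q ^ k) m) K := by
  obtain ⟨t, ht⟩ := hc.tendsto_poleSum hq hp hp0 hpq
  obtain ⟨t', ht'⟩ := hc.tendsto_poleSum hq (p := -p) (by rwa [norm_neg]) (neg_ne_zero.2 hp0)
    (by rw [neg_sq, hpq])
  simp only [weight₂, mul_assoc] at h ⊢
  refine h.starHasSum (((ht.add ht').div_const 2).congr fun n => ?_)
  rw [oddPoleSum_even hq hpq]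
  ring

theorem ThetaFamily.starHasSum_odd (hc : ThetaFamily q c β γ) (hq : ‖q‖ < 1) (hp : ‖p‖ < 1)
    (hp0 : p ≠ 0) (hpq : p ^ 2 = q) {K : ℂ}
    (h : HasAverage (fun m => weight₂ q m * oddPoleSum q (fun k => c k * q ^ (2 * k)) m) K) :
    StarHasSum (fun m => weight₂ q m * oddPoleSum q (fun k => c k * q ^ (2 * k)) m) K := by
  obtain ⟨t, ht⟩ := hc.tendsto_poleSum hq hp hp0 hpq
  obtain ⟨t', ht'⟩ := hc.tendsto_poleSum hq (p := -p) (by rwa [norm_neg]) (neg_ne_zero.2 hp0)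
    (by rw [neg_sq, hpq])
  simp only [weight₂, mul_assoc] at h ⊢
  refine h.starHasSum (((ht.sub ht').div_const (2 * p)).congr fun n => ?_)
  rw [oddPoleSum_odd hq hp0 hpq]
  ring

end Averages

/-! ### The twelve series in terms of Hecke-type series -/

/-- The summand `W_n y_k / ((q)_{n-k} (1 - q ^ (2 k + 1)))`. -/
def kernelTerm (q : ℂ) (W y : ℕ → ℂ) (k n : ℕ) : ℂ :=
  W n * (y k * invPoch q (n - k) / (1 - q ^ (2 * k + 1)))

theorem sum_kernelTerm {q : ℂ} {W y : ℕ → ℂ} {a : ℕ → ℕ → ℂ}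
    (ha : ∀ k n, k ≤ n → a k n = kernelTerm q W y k n) (n : ℕ) :
    ∑ k ∈ Finset.range (n + 1), a k n = W n * oddPoleSum q y n := by
  rw [oddPoleSum, Finset.mul_sum]
  exact Finset.sum_congr rfl fun k hk => ha k n (Nat.lt_succ_iff.1 (Finset.mem_range.1 hk))

theorem doubleSummable_kernelTerm {q : ℂ} (hq : ‖q‖ < 1) {W y : ℕ → ℂ} {a : ℕ → ℕ → ℂ}
    (ha : ∀ k n, k ≤ n → a k n = kernelTerm q W y k n)
    (hW : ∃ C, ∀ n, ‖W n‖ ≤ C * ‖q‖ ^ n) (hy : ∃ D, ∀ k, ‖y k‖ ≤ D) : DoubleSummable 0 a := by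
  obtain ⟨C, hC⟩ := hW
  obtain ⟨D, hD⟩ := hy
  obtain ⟨B, hB, hb⟩ := exists_qPoch_bound hq
  refine doubleSummable_of_bound (C := C * (D * B * (1 - ‖q‖)⁻¹)) (norm_nonneg q) hq
    fun k n hk => ?_
  have h1 : 0 < 1 - ‖q‖ := by linarith
  have h2 : ‖(1 - q ^ (2 * k + 1))⁻¹‖ ≤ (1 - ‖q‖)⁻¹ := by
    rw [norm_inv]
    refine inv_anti₀ h1 ?_
    have h3 := norm_sub_norm_le (1 : ℂ) (q ^ (2 * k + 1))
    rw [norm_one, norm_pow] at h3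
    have h4 : ‖q‖ ^ (2 * k + 1) ≤ ‖q‖ := by
      simpa using pow_le_pow_of_le_one (norm_nonneg q) hq.le (show 1 ≤ 2 * k + 1 by omega)
    linarith
  have h5 : 0 ≤ D := (norm_nonneg _).trans (hD 0)
  rw [ha k n hk, kernelTerm, div_eq_mul_inv, norm_mul, norm_mul, norm_mul]
  calc _ ≤ C * ‖q‖ ^ n * (D * B * (1 - ‖q‖)⁻¹) := by
        refine mul_le_mul (hC n) ?_ (by positivity) ((norm_nonneg _).trans (hC n))
        exact mul_le_mul (mul_le_mul (hD k) (norm_invPoch_le hB hb _) (norm_nonneg _) h5) h2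
          (norm_nonneg _) (by positivity)
    _ = _ := by ring

theorem doubleSum_eq_of_kernelTerm {q : ℂ} {W y : ℕ → ℂ} {a : ℕ → ℕ → ℂ} {L : ℂ}
    (ha : ∀ k n, k ≤ n → a k n = kernelTerm q W y k n) (hs : DoubleSummable 0 a)
    (hL : HasAverage (fun n => W n * oddPoleSum q y n) L) : doubleSum 0 a = L :=
  hs.doubleSum_eq (by simpa only [sum_kernelTerm ha] using hL)

theorem starHasSum_kernelTerm {q : ℂ} {W y : ℕ → ℂ} {a : ℕ → ℕ → ℂ} {L : ℂ}
    (ha : ∀ k n, k ≤ n → a k n = kernelTerm q W y k n)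
    (hL : StarHasSum (fun n => W n * oddPoleSum q y n) L) :
    StarHasSum (fun n => ∑ k ∈ Finset.range (n + 1), a k n) L := by
  simpa only [sum_kernelTerm ha] using hL

theorem invPoch_sub {q : ℂ} {k n : ℕ} (h : k ≤ n) :
    invPoch q ((n : ℤ) - k) = (qPoch q q (n - k))⁻¹ := by
  rw [← Nat.cast_sub h, invPoch_natCast]

/-- Because (-1; q)_{m+1} = 2 (-q; q)_m and (-q; q)_m (q; q)_m = (q²; q²)_m. It turns the factors
(-1)_n (q)_{n-1} into twice the shifted `weight₂`. -/
theorem qPoch_neg_one_succ_mul (q : ℂ) (m : ℕ) :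
    qPoch (-1) q (m + 1) * qPoch q q m = 2 * qPoch (q ^ 2) (q ^ 2) m := by
  induction m with
  | zero => simp [qPoch]; norm_num
  | succ m ih =>
    rw [qPoch_succ, qPoch_self_succ q, qPoch_self_succ (q ^ 2)]
    linear_combination (1 + q ^ (m + 1)) * (1 - q ^ (m + 1)) * ih

section Terms

variable {q : ℂ} {k n : ℕ}

theorem triangle_pred (k : ℕ) : k * (k + 1) / 2 = k * (k - 1) / 2 + k := by
  rw [mul_comm, triangle_succ]

theorem term1_eq (h : k ≤ n) : term1 q (k + 1) (n + 1) = kernelTerm q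
    (fun m => weight₁ q m * q ^ (m + 1)) (fun k => q * (coeffA q k * q ^ (2 * k))) k n := by
  rw [term1, kernelTerm, invPoch_sub h, weight₁, coeffA, Nat.add_sub_cancel, Nat.add_sub_cancel,
    Nat.add_sub_add_right, triangle_succ', triangle_succ', triangle_pred k,
    show 2 * (k + 1) - 1 = 2 * k + 1 by omega, pow_add (-1 : ℂ), pow_succ (-1 : ℂ),
    pow_succ (-1 : ℂ)]
  simp only [div_eq_mul_inv, mul_inv]
  ring

theorem term2_eq (h : k ≤ n) : term2 q k n = kernelTerm q
    (weight₁ q) (fun k => coeffA q k * q ^ k) k n := by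
  rw [term2, kernelTerm, invPoch_sub h, weight₁, coeffA, triangle_pred k]
  simp only [div_eq_mul_inv, mul_inv]
  ring

theorem term3_eq (h : k ≤ n) : term3 q (k + 1) (n + 1) = kernelTerm q
    (fun m => weight₁ q m * q ^ (m + 1)) (fun k => coeffA q k * q ^ k) k n := by
  rw [term3, kernelTerm, invPoch_sub h, weight₁, coeffA, Nat.add_sub_cancel, Nat.add_sub_cancel,
    Nat.add_sub_add_right, triangle_succ', triangle_succ,
    show 2 * (k + 1) - 1 = 2 * k + 1 by omega, pow_add (-1 : ℂ), pow_succ (-1 : ℂ),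
    pow_succ (-1 : ℂ)]
  simp only [div_eq_mul_inv, mul_inv]
  ring

theorem term4_eq (h : k ≤ n) : term4 q k n = kernelTerm q (weight₁ q) (coeffA q) k n := by
  rw [term4, kernelTerm, invPoch_sub h, weight₁, coeffA]
  simp only [div_eq_mul_inv, mul_inv]
  ring

theorem term5_eq (h : k ≤ n) : term5 q (k + 1) (n + 1) = kernelTerm q
    (fun m => 2 * (weight₂ q m * q ^ (m + 1))) (fun k => coeffB q k * q ^ k) k n := by
  have h1 : (k + 1) ^ 2 - (k + 1) = k ^ 2 + k := by
    rw [show (k + 1) ^ 2 = k ^ 2 + k + (k + 1) by ring, Nat.add_sub_cancel]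
  rw [term5, kernelTerm, invPoch_sub h, weight₂, coeffB, Nat.add_sub_cancel, Nat.add_sub_cancel,
    Nat.add_sub_add_right, mul_assoc (_ ^ _) (qPoch _ _ _), qPoch_neg_one_succ_mul, h1,
    show 2 * (k + 1) - 1 = 2 * k + 1 by omega, pow_add (-1 : ℂ), pow_succ (-1 : ℂ),
    pow_succ (-1 : ℂ)]
  simp only [div_eq_mul_inv, mul_inv]
  ring

theorem term6_eq (h : k ≤ n) : term6 q (k + 1) (n + 1) = kernelTerm q
    (fun m => 2 * (weight₂ q m * q ^ (m + 1))) (fun k => q * (coeffB q k * q ^ (2 * k))) k n := by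
  rw [term6, kernelTerm, invPoch_sub h, weight₂, coeffB, Nat.add_sub_cancel, Nat.add_sub_cancel,
    Nat.add_sub_add_right, mul_assoc (_ ^ _) (qPoch _ _ _), qPoch_neg_one_succ_mul,
    show 2 * (k + 1) - 1 = 2 * k + 1 by omega, pow_add (-1 : ℂ), pow_succ (-1 : ℂ),
    pow_succ (-1 : ℂ)]
  simp only [div_eq_mul_inv, mul_inv]
  ring

theorem term7_eq (h : k ≤ n) : term7 q k n = kernelTerm q
    (weight₂ q) (fun k => coeffB q k * q ^ k) k n := by
  rw [term7, kernelTerm, invPoch_sub h, weight₂, coeffB]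
  simp only [div_eq_mul_inv, mul_inv]
  ring

theorem term8_eq (h : k ≤ n) : term8 q k n = kernelTerm q (weight₂ q) (coeffB q) k n := by
  rw [term8, kernelTerm, invPoch_sub h, weight₂, coeffB]
  simp only [div_eq_mul_inv, mul_inv]
  ring

theorem term9_eq (h : k ≤ n) : term9 q (k + 1) (n + 1) = kernelTerm q
    (fun m => 2 * (weight₂ q m * q ^ (m + 1))) (fun k => q * (coeffA q k * q ^ (2 * k))) k n := by
  rw [term9, kernelTerm, invPoch_sub h, weight₂, coeffA, Nat.add_sub_cancel, Nat.add_sub_cancel,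
    Nat.add_sub_add_right, mul_assoc (_ ^ _) (qPoch _ _ _), qPoch_neg_one_succ_mul,
    triangle_succ', triangle_pred k,
    show 2 * (k + 1) - 1 = 2 * k + 1 by omega, pow_add (-1 : ℂ), pow_succ (-1 : ℂ),
    pow_succ (-1 : ℂ)]
  simp only [div_eq_mul_inv, mul_inv]
  ring

theorem term10_eq (h : k ≤ n) : term10 q (k + 1) (n + 1) = kernelTerm q
    (fun m => 2 * (weight₂ q m * q ^ (m + 1))) (fun k => coeffA q k * q ^ k) k n := by
  rw [term10, kernelTerm, invPoch_sub h, weight₂, coeffA, Nat.add_sub_cancel, Nat.add_sub_cancel,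
    Nat.add_sub_add_right, mul_assoc (_ ^ _) (qPoch _ _ _), qPoch_neg_one_succ_mul,
    triangle_succ, show 2 * (k + 1) - 1 = 2 * k + 1 by omega, pow_add (-1 : ℂ), pow_succ (-1 : ℂ),
    pow_succ (-1 : ℂ)]
  simp only [div_eq_mul_inv, mul_inv]
  ring

theorem term11_eq (h : k ≤ n) : term11 q k n = kernelTerm q
    (weight₂ q) (fun k => coeffA q k * q ^ k) k n := by
  rw [term11, kernelTerm, invPoch_sub h, weight₂, coeffA, triangle_pred k]
  simp only [div_eq_mul_inv, mul_inv]
  ring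

theorem term12_eq (h : k ≤ n) : term12 q k n = kernelTerm q (weight₂ q) (coeffA q) k n := by
  rw [term12, kernelTerm, invPoch_sub h, weight₂, coeffA]
  simp only [div_eq_mul_inv, mul_inv]
  ring

end Terms

theorem exists_weight₁_bound {q : ℂ} (hq : ‖q‖ < 1) : ∃ C, ∀ n, ‖weight₁ q n‖ ≤ C * ‖q‖ ^ n := by
  obtain ⟨C, hC, hb⟩ := exists_qPoch_bound hq
  refine ⟨C, fun m => ?_⟩
  rw [weight₁, norm_mul, norm_mul, norm_pow, norm_neg, norm_one, one_pow, one_mul, norm_pow]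
  exact mul_le_mul (hb m).1 (pow_le_pow_of_le_one (norm_nonneg _) hq.le (le_triangle m))
    (by positivity) (by linarith)

theorem exists_shifted_weight₁_bound {q : ℂ} (hq : ‖q‖ < 1) :
    ∃ C, ∀ n, ‖weight₁ q n * q ^ (n + 1)‖ ≤ C * ‖q‖ ^ n := by
  obtain ⟨C, hC⟩ := exists_weight₁_bound hq
  refine ⟨C, fun n => ?_⟩
  rw [norm_mul]
  exact (mul_le_of_le_one_right (norm_nonneg _) (norm_pow_le_one hq _)).trans (hC n)

theorem exists_shifted_weight₂_bound {q : ℂ} (hq : ‖q‖ < 1) :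
    ∃ C, ∀ n, ‖2 * (weight₂ q n * q ^ (n + 1))‖ ≤ C * ‖q‖ ^ n := by
  obtain ⟨C, hC, hb⟩ := exists_qPoch_bound (sq_norm_lt_one hq)
  refine ⟨2 * C, fun n => ?_⟩
  rw [weight₂, norm_mul, norm_mul, norm_mul, norm_pow, norm_neg, norm_one, one_pow, one_mul,
    norm_pow, Complex.norm_ofNat, mul_assoc]
  refine mul_le_mul_of_nonneg_left (mul_le_mul (hb n).1 ?_ (by positivity) (by linarith)) two_pos.le
  exact pow_le_pow_of_le_one (norm_nonneg _) hq.le n.le_succ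

theorem ThetaFamily.bound_mul_pow {q : ℂ} (hq : ‖q‖ < 1) {c : ℕ → ℂ} {β γ : ℤ}
    (hc : ThetaFamily q c β γ) (j : ℕ → ℕ) : ∃ D, ∀ k, ‖c k * q ^ j k‖ ≤ D := by
  obtain ⟨D, hD⟩ := hc.bound
  refine ⟨D, fun k => ?_⟩
  rw [norm_mul]
  exact (mul_le_of_le_one_right (norm_nonneg _) (norm_pow_le_one hq _)).trans (hD k)

theorem ThetaFamily.bound_mul_mul_pow {q : ℂ} (hq : ‖q‖ < 1) {c : ℕ → ℂ} {β γ : ℤ}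
    (hc : ThetaFamily q c β γ) (j : ℕ → ℕ) : ∃ D, ∀ k, ‖q * (c k * q ^ j k)‖ ≤ D := by
  obtain ⟨D, hD⟩ := hc.bound_mul_pow hq j
  refine ⟨D, fun k => ?_⟩
  rw [norm_mul]
  exact (mul_le_of_le_one_left (norm_nonneg _) hq.le).trans (hD k)

theorem oddPoleSum_const_mul (q a : ℂ) (y : ℕ → ℂ) (n : ℕ) :
    oddPoleSum q (fun k => a * y k) n = a * oddPoleSum q y n := by
  rw [oddPoleSum, oddPoleSum, Finset.mul_sum]
  exact Finset.sum_congr rfl fun k _ => by ring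

section Evaluations

variable {q p : ℂ}

theorem doubleSummable_term1 (hq : ‖q‖ < 1) (hq0 : q ≠ 0) : DoubleSummable 1 (term1 q) :=
  (doubleSummable_one _).2 <| doubleSummable_kernelTerm hq (fun _ _ h => term1_eq h)
    (exists_shifted_weight₁_bound hq) ((thetaFamilyA hq hq0).bound_mul_mul_pow hq _)

theorem doubleSummable_term2 (hq : ‖q‖ < 1) (hq0 : q ≠ 0) : DoubleSummable 0 (term2 q) :=
  doubleSummable_kernelTerm hq (fun _ _ h => term2_eq h)
    (exists_weight₁_bound hq) ((thetaFamilyA hq hq0).bound_mul_pow hq _)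

theorem doubleSummable_term3 (hq : ‖q‖ < 1) (hq0 : q ≠ 0) : DoubleSummable 1 (term3 q) :=
  (doubleSummable_one _).2 <| doubleSummable_kernelTerm hq (fun _ _ h => term3_eq h)
    (exists_shifted_weight₁_bound hq) ((thetaFamilyA hq hq0).bound_mul_pow hq _)

theorem doubleSummable_term4 (hq : ‖q‖ < 1) (hq0 : q ≠ 0) : DoubleSummable 0 (term4 q) :=
  doubleSummable_kernelTerm hq (fun _ _ h => term4_eq h)
    (exists_weight₁_bound hq) (thetaFamilyA hq hq0).bound

theorem doubleSummable_term5 (hq : ‖q‖ < 1) (hq0 : q ≠ 0) : DoubleSummable 1 (term5 q) :=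
  (doubleSummable_one _).2 <| doubleSummable_kernelTerm hq (fun _ _ h => term5_eq h)
    (exists_shifted_weight₂_bound hq) ((thetaFamilyB hq hq0).bound_mul_pow hq _)

theorem doubleSummable_term6 (hq : ‖q‖ < 1) (hq0 : q ≠ 0) : DoubleSummable 1 (term6 q) :=
  (doubleSummable_one _).2 <| doubleSummable_kernelTerm hq (fun _ _ h => term6_eq h)
    (exists_shifted_weight₂_bound hq) ((thetaFamilyB hq hq0).bound_mul_mul_pow hq _)

theorem doubleSummable_term9 (hq : ‖q‖ < 1) (hq0 : q ≠ 0) : DoubleSummable 1 (term9 q) :=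
  (doubleSummable_one _).2 <| doubleSummable_kernelTerm hq (fun _ _ h => term9_eq h)
    (exists_shifted_weight₂_bound hq) ((thetaFamilyA hq hq0).bound_mul_mul_pow hq _)

theorem doubleSummable_term10 (hq : ‖q‖ < 1) (hq0 : q ≠ 0) : DoubleSummable 1 (term10 q) :=
  (doubleSummable_one _).2 <| doubleSummable_kernelTerm hq (fun _ _ h => term10_eq h)
    (exists_shifted_weight₂_bound hq) ((thetaFamilyA hq hq0).bound_mul_pow hq _)

theorem ThetaFamily.hasAverage_even {c w κ : ℕ → ℂ} {β γ : ℤ} (hc : ThetaFamily q c β γ)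
    (hq : ‖q‖ < 1) (hw : ConjugateWeight q w κ) (hp : ‖p‖ < 1) (hp0 : p ≠ 0) (hpq : p ^ 2 = q) :
    HasAverage (fun m => w m * oddPoleSum q (fun k => c k * q ^ k) m)
      ((heckeSeries p β γ κ + heckeSeries (-p) β γ κ) / 2) :=
  (hc.hasAverage hw hp hp0 hpq).even hq hpq
    (hc.hasAverage hw (by rwa [norm_neg]) (neg_ne_zero.2 hp0) (by rw [neg_sq, hpq]))

theorem ThetaFamily.hasAverage_odd {c w κ : ℕ → ℂ} {β γ : ℤ} (hc : ThetaFamily q c β γ)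
    (hq : ‖q‖ < 1) (hw : ConjugateWeight q w κ) (hp : ‖p‖ < 1) (hp0 : p ≠ 0) (hpq : p ^ 2 = q) :
    HasAverage (fun m => w m * oddPoleSum q (fun k => c k * q ^ (2 * k)) m)
      ((heckeSeries p β γ κ - heckeSeries (-p) β γ κ) / (2 * p)) :=
  (hc.hasAverage hw hp hp0 hpq).odd hq hp0 hpq
    (hc.hasAverage hw (by rwa [norm_neg]) (neg_ne_zero.2 hp0) (by rw [neg_sq, hpq]))

theorem ThetaFamily.hasAverage_shifted_even {c w κ : ℕ → ℂ} {β γ : ℤ} (hc : ThetaFamily q c β γ)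
    (hq : ‖q‖ < 1) (hw : ConjugateWeight q w κ) (hp : ‖p‖ < 1) (hp0 : p ≠ 0) (hpq : p ^ 2 = q) :
    HasAverage (fun m => w m * q ^ (m + 1) * oddPoleSum q (fun k => c k * q ^ k) m)
      ((heckeSeries' p q β γ κ + heckeSeries' (-p) q β γ κ) / 2) :=
  (hc.hasAverage_shifted hq hw hp hp0 hpq).even hq hpq
    (hc.hasAverage_shifted hq hw (by rwa [norm_neg]) (neg_ne_zero.2 hp0) (by rw [neg_sq, hpq]))

theorem ThetaFamily.hasAverage_shifted_odd {c w κ : ℕ → ℂ} {β γ : ℤ} (hc : ThetaFamily q c β γ)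
    (hq : ‖q‖ < 1) (hw : ConjugateWeight q w κ) (hp : ‖p‖ < 1) (hp0 : p ≠ 0) (hpq : p ^ 2 = q) :
    HasAverage (fun m => w m * q ^ (m + 1) * oddPoleSum q (fun k => c k * q ^ (2 * k)) m)
      ((heckeSeries' p q β γ κ - heckeSeries' (-p) q β γ κ) / (2 * p)) :=
  (hc.hasAverage_shifted hq hw hp hp0 hpq).odd hq hp0 hpq
    (hc.hasAverage_shifted hq hw (by rwa [norm_neg]) (neg_ne_zero.2 hp0) (by rw [neg_sq, hpq]))

theorem q_eq_mul (hp0 : p ≠ 0) (hpq : p ^ 2 = q) (x : ℂ) : q * (x / (2 * p)) = p * x / 2 := by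
  rw [← hpq]
  field_simp

theorem L1_eq (hq : ‖q‖ < 1) (hq0 : q ≠ 0) (hp : ‖p‖ < 1) (hp0 : p ≠ 0)
    (hpq : p ^ 2 = q) :
    L1 q = p * (heckeSeries' p q 2 1 (kappa₁ q) -
    heckeSeries' (-p) q 2 1 (kappa₁ q)) / 2 := by
  have h := ((thetaFamilyA hq hq0).hasAverage_shifted_odd hq (conjugateWeight₁ hq hq0)
    hp hp0 hpq).const_mul' q
  rw [q_eq_mul hp0 hpq] at h
  rw [L1, doubleSum_one]
  refine doubleSum_eq_of_kernelTerm (fun _ _ h => term1_eq h)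
    ((doubleSummable_one _).1 (doubleSummable_term1 hq hq0)) ?_
  simpa only [oddPoleSum_const_mul, mul_left_comm] using h

theorem L2_eq (hq : ‖q‖ < 1) (hq0 : q ≠ 0) (hp : ‖p‖ < 1) (hp0 : p ≠ 0)
    (hpq : p ^ 2 = q) :
    L2 q = (heckeSeries p 2 1 (kappa₁ q) + heckeSeries (-p) 2 1 (kappa₁ q)) / 2 :=
  doubleSum_eq_of_kernelTerm (fun _ _ h => term2_eq h) (doubleSummable_term2 hq hq0)
    ((thetaFamilyA hq hq0).hasAverage_even hq (conjugateWeight₁ hq hq0) hp hp0 hpq)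

theorem L3_eq (hq : ‖q‖ < 1) (hq0 : q ≠ 0) (hp : ‖p‖ < 1) (hp0 : p ≠ 0)
    (hpq : p ^ 2 = q) :
    L3 q = q * ((heckeSeries' p q 2 1 (kappa₁ q) +
    heckeSeries' (-p) q 2 1 (kappa₁ q)) / 2) := by
  rw [L3, doubleSum_one]
  congr 1
  exact doubleSum_eq_of_kernelTerm (fun _ _ h => term3_eq h)
    ((doubleSummable_one _).1 (doubleSummable_term3 hq hq0))
    ((thetaFamilyA hq hq0).hasAverage_shifted_even hq (conjugateWeight₁ hq hq0) hp hp0 hpq)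

theorem L4_eq (hq : ‖q‖ < 1) (hq0 : q ≠ 0) (hp : ‖p‖ < 1) (hp0 : p ≠ 0)
    (hpq : p ^ 2 = q) :
    L4 q = p * (heckeSeries p 2 1 (kappa₁ q) -
    heckeSeries (-p) 2 1 (kappa₁ q)) / 2 := by
  have h := (thetaFamilyA hq hq0).hasAverage_odd hq (conjugateWeight₁ hq hq0) hp hp0 hpq
  have h0 : HasAverage (fun n => weight₁ q n * if n = 0 then 1 else 0) 1 := by
    refine hasAverage_of_hasSum ?_
    convert hasSum_single 0 (f := fun n => weight₁ q n * if n = 0 then 1 else 0) ?_ using 1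
    · simp [weight₁, qPoch_zero]
    · intro n hn
      simp [hn]
  have h1 := h0.linear h 1 q
  rw [q_eq_mul hp0 hpq] at h1
  rw [L4, doubleSum_eq_of_kernelTerm (fun _ _ h => term4_eq h) (doubleSummable_term4 hq hq0)
    (L := 1 * 1 + p * (heckeSeries p 2 1 (kappa₁ q) - heckeSeries (-p) 2 1 (kappa₁ q)) / 2)]
  · ring
  · convert h1 using 2 with n
    -- The pole-free part is 1 for n = 0 and 0 otherwise; its contribution 1 cancels the -1 in `L4`.
    rw [oddPoleSum_eq_add hq, sum_coeffA hq hq0]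
    ring

theorem L5_eq (hq : ‖q‖ < 1) (hq0 : q ≠ 0) (hp : ‖p‖ < 1) (hp0 : p ≠ 0)
    (hpq : p ^ 2 = q) :
    L5 q = q * (heckeSeries' p q 1 0 kappa₂ + heckeSeries' (-p) q 1 0 kappa₂) := by
  have h := ((thetaFamilyB hq hq0).hasAverage_shifted_even hq (conjugateWeight₂ hq hq0)
    hp hp0 hpq).const_mul' 2
  rw [mul_div_cancel₀ _ two_ne_zero] at h
  rw [L5, doubleSum_one]
  congr 1
  refine doubleSum_eq_of_kernelTerm (fun _ _ h => term5_eq h)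
    ((doubleSummable_one _).1 (doubleSummable_term5 hq hq0)) ?_
  simpa only [← mul_assoc] using h

theorem L10_eq (hq : ‖q‖ < 1) (hq0 : q ≠ 0) (hp : ‖p‖ < 1) (hp0 : p ≠ 0)
    (hpq : p ^ 2 = q) :
    L10 q = q * (heckeSeries' p q 2 1 kappa₂ + heckeSeries' (-p) q 2 1 kappa₂) := by
  have h := ((thetaFamilyA hq hq0).hasAverage_shifted_even hq (conjugateWeight₂ hq hq0)
    hp hp0 hpq).const_mul' 2
  rw [mul_div_cancel₀ _ two_ne_zero] at h
  rw [L10, doubleSum_one]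
  congr 1
  refine doubleSum_eq_of_kernelTerm (fun _ _ h => term10_eq h)
    ((doubleSummable_one _).1 (doubleSummable_term10 hq hq0)) ?_
  simpa only [← mul_assoc] using h

theorem L6_eq (hq : ‖q‖ < 1) (hq0 : q ≠ 0) (hp : ‖p‖ < 1) (hp0 : p ≠ 0)
    (hpq : p ^ 2 = q) :
    L6 q = p * (heckeSeries' p q 1 0 kappa₂ - heckeSeries' (-p) q 1 0 kappa₂) := by
  have h := ((thetaFamilyB hq hq0).hasAverage_shifted_odd hq (conjugateWeight₂ hq hq0)
    hp hp0 hpq).const_mul' (2 * q)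
  rw [mul_assoc 2 q (_ / _), q_eq_mul hp0 hpq, mul_div_cancel₀ _ two_ne_zero] at h
  rw [L6, doubleSum_one]
  refine doubleSum_eq_of_kernelTerm (fun _ _ h => term6_eq h)
    ((doubleSummable_one _).1 (doubleSummable_term6 hq hq0)) ?_
  convert h using 2 with n
  rw [oddPoleSum_const_mul]
  ring

theorem L9_eq (hq : ‖q‖ < 1) (hq0 : q ≠ 0) (hp : ‖p‖ < 1) (hp0 : p ≠ 0)
    (hpq : p ^ 2 = q) :
    L9 q = p * (heckeSeries' p q 2 1 kappa₂ - heckeSeries' (-p) q 2 1 kappa₂) := by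
  have h := ((thetaFamilyA hq hq0).hasAverage_shifted_odd hq (conjugateWeight₂ hq hq0)
    hp hp0 hpq).const_mul' (2 * q)
  rw [mul_assoc 2 q (_ / _), q_eq_mul hp0 hpq, mul_div_cancel₀ _ two_ne_zero] at h
  rw [L9, doubleSum_one]
  refine doubleSum_eq_of_kernelTerm (fun _ _ h => term9_eq h)
    ((doubleSummable_one _).1 (doubleSummable_term9 hq hq0)) ?_
  convert h using 2 with n
  rw [oddPoleSum_const_mul]
  ring

theorem starHasSum_term7 (hq : ‖q‖ < 1) (hq0 : q ≠ 0) (hp : ‖p‖ < 1) (hp0 : p ≠ 0)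
    (hpq : p ^ 2 = q) :
    StarHasSum (fun n => ∑ k ∈ Finset.range (n + 1), term7 q k n)
    ((heckeSeries p 1 0 kappa₂ + heckeSeries (-p) 1 0 kappa₂) / 2) :=
  starHasSum_kernelTerm (fun _ _ h => term7_eq h) <|
    (thetaFamilyB hq hq0).starHasSum_even hq hp hp0 hpq
      ((thetaFamilyB hq hq0).hasAverage_even hq (conjugateWeight₂ hq hq0) hp hp0 hpq)

theorem starHasSum_term11 (hq : ‖q‖ < 1) (hq0 : q ≠ 0) (hp : ‖p‖ < 1) (hp0 : p ≠ 0)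
    (hpq : p ^ 2 = q) :
    StarHasSum (fun n => ∑ k ∈ Finset.range (n + 1), term11 q k n)
    ((heckeSeries p 2 1 kappa₂ + heckeSeries (-p) 2 1 kappa₂) / 2) :=
  starHasSum_kernelTerm (fun _ _ h => term11_eq h) <|
    (thetaFamilyA hq hq0).starHasSum_even hq hp hp0 hpq
      ((thetaFamilyA hq hq0).hasAverage_even hq (conjugateWeight₂ hq hq0) hp hp0 hpq)

theorem starHasSum_term8 (hq : ‖q‖ < 1) (hq0 : q ≠ 0) (hp : ‖p‖ < 1) (hp0 : p ≠ 0)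
    (hpq : p ^ 2 = q) :
    StarHasSum (fun n => ∑ k ∈ Finset.range (n + 1), term8 q k n)
    (1 / 2 + p * (heckeSeries p 1 0 kappa₂ - heckeSeries (-p) 1 0 kappa₂) / 2) := by
  have h := starHasSum_neg_one_pow.linear ((thetaFamilyB hq hq0).starHasSum_odd hq hp hp0 hpq
      ((thetaFamilyB hq hq0).hasAverage_odd hq (conjugateWeight₂ hq hq0) hp hp0 hpq)) 1 q
  rw [q_eq_mul hp0 hpq, one_mul] at h
  refine starHasSum_kernelTerm (fun _ _ h => term8_eq h) ?_
  convert h using 2 with n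
  have h1 := qPoch_self_ne_zero (sq_norm_lt_one hq) n
  -- The pole-free part 1/(q²;q²)_n cancels the weight down to (-1)^n, whose starred sum 1/2,
  -- doubled, offsets the -1 in `L8`.
  rw [oddPoleSum_eq_add hq, sum_coeffB hq hq0, mul_add, weight₂, mul_inv_cancel_right₀ h1]
  ring

theorem starHasSum_term12 (hq : ‖q‖ < 1) (hq0 : q ≠ 0) (hp : ‖p‖ < 1) (hp0 : p ≠ 0)
    (hpq : p ^ 2 = q) :
    StarHasSum (fun n => ∑ k ∈ Finset.range (n + 1), term12 q k n)
    (1 + p * (heckeSeries p 2 1 kappa₂ - heckeSeries (-p) 2 1 kappa₂) / 2) := by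
  have h0 : StarHasSum (fun n => weight₂ q n * if n = 0 then 1 else 0) 1 := by
    refine starHasSum_of_hasSum ?_
    convert hasSum_single 0 (f := fun n => weight₂ q n * if n = 0 then 1 else 0) ?_ using 1
    · simp [weight₂, qPoch_zero]
    · intro n hn
      simp [hn]
  have h := h0.linear ((thetaFamilyA hq hq0).starHasSum_odd hq hp hp0 hpq
      ((thetaFamilyA hq hq0).hasAverage_odd hq (conjugateWeight₂ hq hq0) hp hp0 hpq)) 1 q
  rw [q_eq_mul hp0 hpq, one_mul] at h
  refine starHasSum_kernelTerm (fun _ _ h => term12_eq h) ?_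
  convert h using 2 with n
  rw [oddPoleSum_eq_add hq, sum_coeffA hq hq0]
  ring

theorem L7_eq (hq : ‖q‖ < 1) (hq0 : q ≠ 0) (hp : ‖p‖ < 1) (hp0 : p ≠ 0)
    (hpq : p ^ 2 = q) :
    L7 q = heckeSeries p 1 0 kappa₂ + heckeSeries (-p) 1 0 kappa₂ := by
  rw [L7, (starHasSum_term7 hq hq0 hp hp0 hpq).starSum_eq]
  ring

theorem L8_eq (hq : ‖q‖ < 1) (hq0 : q ≠ 0) (hp : ‖p‖ < 1) (hp0 : p ≠ 0)
    (hpq : p ^ 2 = q) :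
    L8 q = p * (heckeSeries p 1 0 kappa₂ - heckeSeries (-p) 1 0 kappa₂) := by
  rw [L8, (starHasSum_term8 hq hq0 hp hp0 hpq).starSum_eq]
  ring

theorem L11_eq (hq : ‖q‖ < 1) (hq0 : q ≠ 0) (hp : ‖p‖ < 1) (hp0 : p ≠ 0)
    (hpq : p ^ 2 = q) :
    L11 q = heckeSeries p 2 1 kappa₂ + heckeSeries (-p) 2 1 kappa₂ := by
  rw [L11, (starHasSum_term11 hq hq0 hp hp0 hpq).starSum_eq]
  ring

theorem L12_eq (hq : ‖q‖ < 1) (hq0 : q ≠ 0) (hp : ‖p‖ < 1) (hp0 : p ≠ 0)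
    (hpq : p ^ 2 = q) :
    L12 q = p * (heckeSeries p 2 1 kappa₂ - heckeSeries (-p) 2 1 kappa₂) := by
  rw [L12, (starHasSum_term12 hq hq0 hp hp0 hpq).starSum_eq]
  ring

theorem hypergeometricConverge (hq : ‖q‖ < 1) (hq0 : q ≠ 0) (hp : ‖p‖ < 1) (hp0 : p ≠ 0)
    (hpq : p ^ 2 = q) : HypergeometricConverge q :=
  ⟨doubleSummable_term1 hq hq0, doubleSummable_term2 hq hq0, doubleSummable_term3 hq hq0,
    doubleSummable_term4 hq hq0, doubleSummable_term5 hq hq0, doubleSummable_term6 hq hq0,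
    (starHasSum_term7 hq hq0 hp hp0 hpq).starSummable,
    (starHasSum_term8 hq hq0 hp hp0 hpq).starSummable, doubleSummable_term9 hq hq0,
    doubleSummable_term10 hq hq0, (starHasSum_term11 hq hq0 hp hp0 hpq).starSummable,
    (starHasSum_term12 hq hq0 hp hp0 hpq).starSummable⟩

end Evaluations

/-! ### Lattice sums over the cone |n₁| > |n₂| and their convergence. -/

/-! ### The weight of false-indefinite theta series -/

theorem real_sign_mul (u v : ℝ) : Real.sign u * Real.sign v = Real.sign (u * v) := by
  rcases lt_trichotomy u 0 with hu | rfl | hu <;> rcases lt_trichotomy v 0 with hv | rfl | hv <;>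
    simp [Real.sign_of_neg, Real.sign_of_pos, *, mul_pos_of_neg_of_neg, mul_neg_of_neg_of_pos,
      mul_neg_of_pos_of_neg]

/-- `(1 + sgn(u + v) sgn(u - v)) / 2`. -/
def halfWeight (u v : ℝ) : ℝ := (1 + Real.sign (u + v) * Real.sign (u - v)) / 2

/-- In this form the weight visibly depends on u² and v² only, so each coordinate may change sign
independently. -/
theorem halfWeight_eq (u v : ℝ) : halfWeight u v = (1 + Real.sign (u ^ 2 - v ^ 2)) / 2 := by
  rw [halfWeight, real_sign_mul]
  ring_nf

theorem halfWeight_of_lt {u v : ℝ} (h : v ^ 2 < u ^ 2) : halfWeight u v = 1 := by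
  rw [halfWeight_eq, Real.sign_of_pos (by linarith)]
  norm_num

theorem halfWeight_of_gt {u v : ℝ} (h : u ^ 2 < v ^ 2) : halfWeight u v = 0 := by
  rw [halfWeight_eq, Real.sign_of_neg (by linarith)]
  norm_num

theorem halfWeight_of_eq {u v : ℝ} (h : u ^ 2 = v ^ 2) : halfWeight u v = 1 / 2 := by
  rw [halfWeight_eq, h, sub_self, Real.sign_zero]
  norm_num

theorem abs_halfWeight_le (u v : ℝ) : |halfWeight u v| ≤ 1 := by
  rcases lt_trichotomy (u ^ 2) (v ^ 2) with h | h | h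
  · simp [halfWeight_of_gt h]
  · rw [halfWeight_of_eq h]; norm_num
  · simp [halfWeight_of_lt h]

theorem falseTerm_eq (a b : ℝ) (τ : ℂ) (n : ℝ × ℝ) :
    1 / 2 * falseTerm a b τ n = (halfWeight n.1 n.2 : ℂ) * nome τ (quadForm a b n) := by
  rw [falseTerm, halfWeight]
  push_cast
  ring

/-! ### The nome -/

theorem nome_add (τ : ℂ) (r s : ℝ) : nome τ (r + s) = nome τ r * nome τ s := by
  rw [nome, nome, nome, ← Complex.exp_add]
  push_cast
  ring_nf

theorem nome_ne_zero (τ : ℂ) (r : ℝ) : nome τ r ≠ 0 := Complex.exp_ne_zero _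

theorem nome_zpow (τ : ℂ) (r : ℝ) (n : ℤ) : nome τ r ^ n = nome τ (n * r) := by
  rw [nome, nome, ← Complex.exp_int_mul]
  push_cast
  ring_nf

theorem norm_nome (τ : ℂ) (r : ℝ) : ‖nome τ r‖ = Real.exp (-(2 * Real.pi * τ.im * r)) := by
  rw [nome, Complex.norm_exp]
  congr 1
  simp
  ring

/-! ### Absolute convergence -/

theorem summable_exp_neg_mul_sq {c δ : ℝ} (hc : 0 < c) (hδ : δ ≠ 0) (x : ℝ) :
    Summable fun m : ℤ => Real.exp (-(c * (δ * m + x) ^ 2)) := by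
  have h := ((summable_jacobiTheta₂_term_iff (Complex.I * (c * δ * x / Real.pi : ℝ))
    (Complex.I * (c * δ ^ 2 / Real.pi : ℝ))).2 (by
      rw [Complex.I_mul_im, Complex.ofReal_re]
      have := Real.pi_pos
      positivity)).norm.mul_left (Real.exp (-(c * x ^ 2)))
  refine h.congr fun m => ?_
  rw [norm_jacobiTheta₂_term, ← Real.exp_add, Complex.I_mul_im, Complex.I_mul_im,
    Complex.ofReal_re, Complex.ofReal_re]
  congr 1
  have := Real.pi_ne_zero
  field_simp
  ring

/-- The weight vanishes unless n₂² ≤ n₁², and there 2Q(n) - (a - b)(n₁² + n₂²) = (a + b)(n₁² - n₂²)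
≥ 0. The indefinite series is thus dominated by a product of two Gaussian series. -/
theorem norm_falseTerm_le {a b : ℝ} (hb : 0 < b) (hab : b < a) {τ : ℂ} (hτ : 0 < τ.im)
    (n : ℝ × ℝ) : ‖1 / 2 * falseTerm a b τ n‖ ≤
      Real.exp (-(Real.pi * τ.im * (a - b) * n.1 ^ 2)) *
        Real.exp (-(Real.pi * τ.im * (a - b) * n.2 ^ 2)) := by
  rw [falseTerm_eq, norm_mul, Complex.norm_real, Real.norm_eq_abs, norm_nome, ← Real.exp_add]
  rcases lt_or_ge (n.1 ^ 2) (n.2 ^ 2) with h | h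
  · rw [halfWeight_of_gt h, abs_zero, zero_mul]
    positivity
  · refine (mul_le_of_le_one_left (Real.exp_pos _).le (abs_halfWeight_le _ _)).trans
      (Real.exp_le_exp.2 ?_)
    have h1 : (a - b) * (n.1 ^ 2 + n.2 ^ 2) ≤ 2 * quadForm a b n := by
      rw [quadForm]
      nlinarith
    have h2 := mul_le_mul_of_nonneg_left h1 (mul_pos Real.pi_pos hτ).le
    linarith

theorem summable_falseTerm {a b : ℝ} (hb : 0 < b) (hab : b < a) {τ : ℂ} (hτ : 0 < τ.im)
    {δ : ℝ} (hδ : δ ≠ 0) (x y : ℝ) : Summable fun m : ℤ × ℤ =>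
      1 / 2 * falseTerm a b τ (δ * m.1 + x, δ * m.2 + y) := by
  have hc : 0 < Real.pi * τ.im * (a - b) := mul_pos (mul_pos Real.pi_pos hτ) (by linarith)
  exact Summable.of_norm_bounded ((summable_exp_neg_mul_sq hc hδ x).mul_of_nonneg
    (summable_exp_neg_mul_sq hc hδ y) (fun _ => (Real.exp_pos _).le) fun _ => (Real.exp_pos _).le)
    fun m => norm_falseTerm_le hb hab hτ _

/-- `ℤ² ≃ ℤ² + μ`. -/
def latticeEquiv (μ : ℝ × ℝ) : ℤ × ℤ ≃ shiftedLattice μ :=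
  Equiv.ofBijective (fun m => ⟨((m.1 : ℝ) + μ.1, (m.2 : ℝ) + μ.2), m, rfl⟩) <| by
    constructor
    · rintro ⟨m, n⟩ ⟨m', n'⟩ h
      have h' := congrArg Subtype.val h
      simpa using h'
    · rintro ⟨_, m, rfl⟩
      exact ⟨m, rfl⟩

theorem latticeEquiv_apply (μ : ℝ × ℝ) (m : ℤ × ℤ) :
    (latticeEquiv μ m : ℝ × ℝ) = ((m.1 : ℝ) + μ.1, (m.2 : ℝ) + μ.2) := rfl

theorem summable_falseTerm_shiftedLattice {a b : ℝ} (hb : 0 < b) (hab : b < a) {τ : ℂ}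
    (hτ : 0 < τ.im) (μ : ℝ × ℝ) : Summable fun n : shiftedLattice μ => falseTerm a b τ n := by
  refine (latticeEquiv μ).summable_iff.1 (((summable_falseTerm hb hab hτ one_ne_zero μ.1
    μ.2).mul_left 2).congr fun m => ?_)
  simp only [one_mul, Function.comp, latticeEquiv_apply]
  ring

/-- The vectors `c₁`, `c₂` cut out the cone `|n₁| > |n₂|`. -/
def IsStandardCone (a b : ℝ) (c₁ c₂ : ℝ × ℝ) : Prop :=
  ∃ s : ℝ, 0 < s ∧ ∀ n, bilinForm a b n c₁ = -(s * (n.1 + n.2)) ∧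
    bilinForm a b n c₂ = s * (n.1 - n.2)

theorem IsStandardCone.varthetaTerm_eq {a b : ℝ} {c₁ c₂ : ℝ × ℝ} (h : IsStandardCone a b c₁ c₂)
    (τ : ℂ) (n : ℝ × ℝ) : varthetaTerm a b c₁ c₂ τ n = falseTerm a b τ n := by
  obtain ⟨s, hs, h⟩ := h
  rw [varthetaTerm, falseTerm, (h n).1, (h n).2, Real.sign_neg, ← real_sign_mul, ← real_sign_mul,
    Real.sign_of_pos hs]
  congr 2
  ring

theorem thetaConverge {a b : ℝ} {c₁ c₂ : ℝ × ℝ} (h : IsStandardCone a b c₁ c₂) (hb : 0 < b)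
    (hab : b < a) {τ : ℂ} (hτ : 0 < τ.im) : ThetaConverge a b c₁ c₂ τ := by
  intro μ
  have h1 := summable_falseTerm_shiftedLattice hb hab hτ μ
  refine ⟨h1, ?_⟩
  simp only [h.varthetaTerm_eq]
  have h2 : Set.Subset (shiftedLattice μ \ {(0, 0)}) (shiftedLattice μ) := Set.sdiff_subset
  have h3 := h1.comp_injective (Set.inclusion_injective h2)
  exact h3

/-! ### Lattice sums -/

/-- Half the false sum over `ℤ² + (x, y)`. -/
def latticeSum (a b : ℝ) (τ : ℂ) (x y : ℝ) : ℂ :=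
  ∑' m : ℤ × ℤ, 1 / 2 * falseTerm a b τ (m.1 + x, m.2 + y)

theorem half_falseSum (a b : ℝ) (τ : ℂ) (μ : ℝ × ℝ) :
    1 / 2 * falseSum a b τ (shiftedLattice μ) = latticeSum a b τ μ.1 μ.2 := by
  rw [falseSum, ← tsum_mul_left, latticeSum, ← (latticeEquiv μ).tsum_eq]
  simp only [latticeEquiv_apply]

theorem falseTerm_congr {a b : ℝ} {τ : ℂ} {n n' : ℝ × ℝ} (h1 : n.1 ^ 2 = n'.1 ^ 2)
    (h2 : n.2 ^ 2 = n'.2 ^ 2) : 1 / 2 * falseTerm a b τ n = 1 / 2 * falseTerm a b τ n' := by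
  rw [falseTerm_eq, falseTerm_eq, halfWeight_eq, halfWeight_eq, quadForm, quadForm, h1, h2]

/-- `x` and `x'` agree up to sign modulo `1`. -/
def ShiftEquiv (x x' : ℝ) : Prop := ∃ k : ℤ, x' = x + k ∨ x' = -x + k

theorem ShiftEquiv.exists_equiv {x x' : ℝ} (h : ShiftEquiv x x') :
    ∃ e : ℤ ≃ ℤ, ∀ m : ℤ, (m + x') ^ 2 = ((e m : ℤ) + x) ^ 2 := by
  obtain ⟨k, rfl | rfl⟩ := h
  · refine ⟨Equiv.addRight k, fun m => ?_⟩
    simp only [Equiv.coe_addRight]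
    push_cast
    ring
  · refine ⟨(Equiv.addRight k).trans (Equiv.neg ℤ), fun m => ?_⟩
    simp only [Equiv.trans_apply, Equiv.coe_addRight, Equiv.neg_apply]
    push_cast
    ring

/-- Weight and form see only the squares of the coordinates, so each shift matters only up to sign
and modulo 1. This identifies the shifts produced by the parity splitting with those in the theorem.
-/
theorem latticeSum_congr (a b : ℝ) (τ : ℂ) {x x' y y' : ℝ} (hx : ShiftEquiv x x')
    (hy : ShiftEquiv y y') : latticeSum a b τ x' y' = latticeSum a b τ x y := by
  obtain ⟨e, he⟩ := hx.exists_equiv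
  obtain ⟨f, hf⟩ := hy.exists_equiv
  rw [latticeSum, latticeSum, ← (e.prodCongr f).tsum_eq fun m : ℤ × ℤ =>
    1 / 2 * falseTerm a b τ (m.1 + x, m.2 + y)]
  exact tsum_congr fun m => falseTerm_congr (he m.1) (hf m.2)

/-! ### Splitting by parity -/

theorem tsum_int_eq_even_add_odd {f : ℤ → ℂ} (hf : Summable f) :
    ∑' n, f n = ∑' n, f (2 * n) + ∑' n, f (2 * n + 1) := by
  have h2 : Function.Injective fun n : ℤ => 2 * n := fun m n h => by simpa using h
  have h3 : Function.Injective fun n : ℤ => 2 * n + 1 := fun m n h => by simpa using h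
  have he := (hf.comp_injective h2).hasSum
  have ho := (hf.comp_injective h3).hasSum
  refine (HasSum.add_isCompl (s := Set.range fun n : ℤ => 2 * n)
    (t := Set.range fun n : ℤ => 2 * n + 1) ?_ (h2.hasSum_range_iff.2 he)
    (h3.hasSum_range_iff.2 ho)).tsum_eq
  simpa using Int.isCompl_even_odd

theorem tsum_prod_eq_snd {f : ℤ × ℤ → ℂ} (hf : Summable f) :
    ∑' m, f m = ∑' m : ℤ × ℤ, f (m.1, 2 * m.2) + ∑' m : ℤ × ℤ, f (m.1, 2 * m.2 + 1) := by
  have h2 : Function.Injective fun m : ℤ × ℤ => (m.1, 2 * m.2) := by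
    rintro ⟨a, b⟩ ⟨c, d⟩ h
    simpa using h
  have h3 : Function.Injective fun m : ℤ × ℤ => (m.1, 2 * m.2 + 1) := by
    rintro ⟨a, b⟩ ⟨c, d⟩ h
    simpa using h
  have he : Summable fun m : ℤ × ℤ => f (m.1, 2 * m.2) := hf.comp_injective h2
  have ho : Summable fun m : ℤ × ℤ => f (m.1, 2 * m.2 + 1) := hf.comp_injective h3
  rw [hf.tsum_prod, he.tsum_prod, ho.tsum_prod, ← he.prod.tsum_add ho.prod]
  exact tsum_congr fun m => tsum_int_eq_even_add_odd (hf.prod_factor m)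

theorem tsum_prod_eq_four {f : ℤ × ℤ → ℂ} (hf : Summable f) :
    ∑' m, f m = ∑' m : ℤ × ℤ, f (2 * m.1, 2 * m.2) + ∑' m : ℤ × ℤ, f (2 * m.1, 2 * m.2 + 1) +
      ∑' m : ℤ × ℤ, f (2 * m.1 + 1, 2 * m.2) + ∑' m : ℤ × ℤ, f (2 * m.1 + 1, 2 * m.2 + 1) := by
  have key : ∀ {g : ℤ × ℤ → ℂ}, Summable g → ∑' m, g m = ∑' m : ℤ × ℤ, g (2 * m.1, m.2) +
      ∑' m : ℤ × ℤ, g (2 * m.1 + 1, m.2) := by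
    intro g hg
    have h := tsum_prod_eq_snd ((Equiv.prodComm ℤ ℤ).summable_iff.2 hg)
    have h' := (Equiv.prodComm ℤ ℤ).tsum_eq g
    simp only [Function.comp_def] at h
    rw [← h', h, ← (Equiv.prodComm ℤ ℤ).tsum_eq fun m : ℤ × ℤ => g (2 * m.1, m.2),
      ← (Equiv.prodComm ℤ ℤ).tsum_eq fun m : ℤ × ℤ => g (2 * m.1 + 1, m.2)]
    rfl
  have h2 : Function.Injective fun m : ℤ × ℤ => (m.1, 2 * m.2) := by
    rintro ⟨a, b⟩ ⟨c, d⟩ h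
    simpa using h
  have h3 : Function.Injective fun m : ℤ × ℤ => (m.1, 2 * m.2 + 1) := by
    rintro ⟨a, b⟩ ⟨c, d⟩ h
    simpa using h
  have he : Summable fun m : ℤ × ℤ => f (m.1, 2 * m.2) := hf.comp_injective h2
  have ho : Summable fun m : ℤ × ℤ => f (m.1, 2 * m.2 + 1) := hf.comp_injective h3
  rw [tsum_prod_eq_snd hf, key he, key ho]
  ring

/-! ### Hecke-type series as theta sums over shifts of (1/2)ℤ². -/

/-! ### The double theta series in both variables -/

/-- The summand `w(M / 2 + x, i / 2 + y) P ^ (A M² + ξ M - (β i² + γ i))`. -/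
def thetaTerm (A ξ β γ : ℤ) (x y : ℝ) (P : ℂ) (m : ℤ × ℤ) : ℂ :=
  (halfWeight (1 / 2 * m.1 + x) (1 / 2 * m.2 + y) : ℂ) *
    (P ^ (A * m.1 ^ 2 + ξ * m.1) * innerTerm P β γ m.2)

/-- The sum of all `thetaTerm`s. -/
def thetaSum (A ξ β γ : ℤ) (x y : ℝ) (P : ℂ) : ℂ := ∑' m, thetaTerm A ξ β γ x y P m

/-- The integer exponents `(A, ξ, β, γ)` describe `a n₁² - b n₂²` on `(M / 2 + x, i / 2 + y)`. -/
structure ThetaData (a b x y : ℝ) (A ξ β γ : ℤ) : Prop where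
  b_pos : 0 < b
  b_lt : b < a
  a_eq : a = 2 * A
  xi_eq : 2 * a * x = ξ
  b_eq : b = 2 * β
  gamma_eq : 2 * b * y = γ
  odd_outer : Odd (A + ξ)
  odd_inner : Odd (β + γ)

section Data

variable {a b x y : ℝ} {A ξ β γ : ℤ} {τ : ℂ}

/-- Modulo 2 the exponent is (A + ξ) M + (β + γ) i, that is M + i. Replacing P by -P thus multiplies
the term at (M, i) by (-1)^(M+i). -/
theorem ThetaData.exponent_even (h : ThetaData a b x y A ξ β γ) (m : ℤ × ℤ) :
    Even (A * m.1 ^ 2 + ξ * m.1 + -(β * m.2 ^ 2 + γ * m.2) - (m.1 + m.2)) := by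
  obtain ⟨k, hk⟩ := h.odd_outer
  obtain ⟨l, hl⟩ := h.odd_inner
  have hξ : ξ = 2 * k + 1 - A := by linarith
  have hγ : γ = 2 * l + 1 - β := by linarith
  have h1 : A * m.1 ^ 2 + ξ * m.1 + -(β * m.2 ^ 2 + γ * m.2) - (m.1 + m.2) =
      A * (m.1 * (m.1 - 1)) - β * (m.2 * (m.2 - 1)) + 2 * (k * m.1 - l * m.2 - m.2) := by
    rw [hξ, hγ]
    ring
  rw [h1]
  exact (((Int.even_mul_pred_self _).mul_left _).sub ((Int.even_mul_pred_self _).mul_left _)).add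
    (even_two_mul _)

/-- Completing the square: with P = q^(1/2), the prefactor q^(a x² - b y²) turns the power of P into
q^Q at (M/2 + x, i/2 + y). The sign σ treats both square roots of q together. -/
theorem ThetaData.mul_thetaTerm (h : ThetaData a b x y A ξ β γ) {σ : ℂ} (hσ : σ = 1 ∨ σ = -1)
    (m : ℤ × ℤ) : nome τ (a * x ^ 2 - b * y ^ 2) *
      thetaTerm A ξ β γ x y (σ * nome τ (1 / 2)) m =
    σ ^ (m.1 + m.2) * (1 / 2 * falseTerm a b τ (1 / 2 * m.1 + x, 1 / 2 * m.2 + y)) := by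
  have hσ0 : σ ≠ 0 := by rcases hσ with rfl | rfl <;> norm_num
  set E : ℤ := A * m.1 ^ 2 + ξ * m.1 + -(β * m.2 ^ 2 + γ * m.2) with hE
  have h1 : σ ^ E = σ ^ (m.1 + m.2) := by
    have h2 : σ ^ (E - (m.1 + m.2)) = 1 := by
      rcases hσ with rfl | rfl
      · exact one_zpow _
      · exact (h.exponent_even m).neg_one_zpow
    rw [← sub_add_cancel E (m.1 + m.2), zpow_add₀ hσ0, h2, one_mul]
  have h3 : nome τ (a * x ^ 2 - b * y ^ 2) * nome τ (1 / 2) ^ E =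
      nome τ (quadForm a b (1 / 2 * m.1 + x, 1 / 2 * m.2 + y)) := by
    rw [nome_zpow, ← nome_add]
    congr 1
    have e1 := h.a_eq
    have e2 := h.xi_eq
    have e3 := h.b_eq
    have e4 := h.gamma_eq
    rw [hE, quadForm]
    push_cast
    rw [← e2, ← e4, show (A : ℝ) = a / 2 by linarith, show (β : ℝ) = b / 2 by linarith]
    ring
  rw [falseTerm_eq, ← h3, thetaTerm, innerTerm,
    ← zpow_add₀ (mul_ne_zero hσ0 (nome_ne_zero _ _)), mul_zpow, h1]
  ring

theorem norm_sign_zpow {σ : ℂ} (hσ : σ = 1 ∨ σ = -1) (n : ℤ) : ‖σ ^ n‖ = 1 := by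
  rcases hσ with rfl | rfl <;> simp

theorem ThetaData.summable_signed (h : ThetaData a b x y A ξ β γ) (hτ : 0 < τ.im) {σ : ℂ}
    (hσ : σ = 1 ∨ σ = -1) : Summable fun m : ℤ × ℤ => σ ^ (m.1 + m.2) *
      (1 / 2 * falseTerm a b τ (1 / 2 * m.1 + x, 1 / 2 * m.2 + y)) := by
  refine Summable.of_norm_bounded (summable_falseTerm h.b_pos h.b_lt hτ
    (δ := 1 / 2) (by norm_num) x y).norm fun m => ?_
  rw [norm_mul, norm_sign_zpow hσ, one_mul]

theorem ThetaData.summable_thetaTerm (h : ThetaData a b x y A ξ β γ) (hτ : 0 < τ.im) {σ : ℂ}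
    (hσ : σ = 1 ∨ σ = -1) : Summable (thetaTerm A ξ β γ x y (σ * nome τ (1 / 2))) := by
  refine (summable_mul_left_iff (nome_ne_zero τ (a * x ^ 2 - b * y ^ 2))).1 ?_
  simp only [h.mul_thetaTerm hσ]
  exact h.summable_signed hτ hσ

theorem ThetaData.mul_thetaSum (h : ThetaData a b x y A ξ β γ) (hτ : 0 < τ.im) {σ : ℂ}
    (hσ : σ = 1 ∨ σ = -1) : nome τ (a * x ^ 2 - b * y ^ 2) *
      thetaSum A ξ β γ x y (σ * nome τ (1 / 2)) =
    latticeSum a b τ x y + latticeSum a b τ (x + 1 / 2) (y + 1 / 2) +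
      σ * (latticeSum a b τ (x + 1 / 2) y + latticeSum a b τ x (y + 1 / 2)) := by
  have hσ0 : σ ≠ 0 := by rcases hσ with rfl | rfl <;> norm_num
  have hσ2 : ∀ k : ℤ, σ ^ (2 * k) = 1 := by
    intro k
    rcases hσ with rfl | rfl
    · exact one_zpow _
    · exact (even_two_mul k).neg_one_zpow
  have hσ3 : ∀ k : ℤ, σ ^ (2 * k + 1) = σ := by
    intro k
    rw [zpow_add_one₀ hσ0, hσ2, one_mul]
  rw [thetaSum, ← tsum_mul_left]
  simp only [h.mul_thetaTerm hσ]
  rw [tsum_prod_eq_four (h.summable_signed hτ hσ), latticeSum, latticeSum, latticeSum, latticeSum]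
  have e1 : ∀ m : ℤ × ℤ, 2 * m.1 + 2 * m.2 = 2 * (m.1 + m.2) := fun m => by ring
  have e2 : ∀ m : ℤ × ℤ, 2 * m.1 + (2 * m.2 + 1) = 2 * (m.1 + m.2) + 1 := fun m => by ring
  have e3 : ∀ m : ℤ × ℤ, 2 * m.1 + 1 + 2 * m.2 = 2 * (m.1 + m.2) + 1 := fun m => by ring
  have e4 : ∀ m : ℤ × ℤ, 2 * m.1 + 1 + (2 * m.2 + 1) = 2 * (m.1 + m.2 + 1) := fun m => by ring
  have e5 : ∀ (k : ℤ) (z : ℝ), 1 / 2 * ((2 * k : ℤ) : ℝ) + z = k + z := fun k z => by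
    push_cast; ring
  have e6 : ∀ (k : ℤ) (z : ℝ), 1 / 2 * ((2 * k + 1 : ℤ) : ℝ) + z = k + (z + 1 / 2) := fun k z => by
    push_cast; ring
  simp only [e1, e2, e3, e4, hσ2, hσ3, e5, e6, one_mul, tsum_mul_left]
  ring

theorem ThetaData.even_part (h : ThetaData a b x y A ξ β γ) (hτ : 0 < τ.im) :
    nome τ (a * x ^ 2 - b * y ^ 2) * ((thetaSum A ξ β γ x y (nome τ (1 / 2)) +
      thetaSum A ξ β γ x y (-nome τ (1 / 2))) / 2) =
    latticeSum a b τ x y + latticeSum a b τ (x + 1 / 2) (y + 1 / 2) := by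
  have h1 := h.mul_thetaSum hτ (σ := 1) (Or.inl rfl)
  have h2 := h.mul_thetaSum hτ (σ := -1) (Or.inr rfl)
  rw [one_mul] at h1
  rw [neg_one_mul] at h2
  linear_combination (h1 + h2) / 2

theorem ThetaData.odd_part (h : ThetaData a b x y A ξ β γ) (hτ : 0 < τ.im) :
    nome τ (a * x ^ 2 - b * y ^ 2) * ((thetaSum A ξ β γ x y (nome τ (1 / 2)) -
      thetaSum A ξ β γ x y (-nome τ (1 / 2))) / 2) =
    latticeSum a b τ (x + 1 / 2) y + latticeSum a b τ x (y + 1 / 2) := by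
  have h1 := h.mul_thetaSum hτ (σ := 1) (Or.inl rfl)
  have h2 := h.mul_thetaSum hτ (σ := -1) (Or.inr rfl)
  rw [one_mul] at h1
  rw [neg_one_mul] at h2
  linear_combination (h1 - h2) / 2

end Data

/-! ### Rows -/

section Rows

variable {A ξ β γ : ℤ} {x y : ℝ} {P : ℂ}

theorem tsum_row_eq (M : ℤ) (s : Finset ℤ)
    (h1 : ∀ i ∈ s, halfWeight (1 / 2 * M + x) (1 / 2 * i + y) = 1)
    (h0 : ∀ i ∉ s, halfWeight (1 / 2 * M + x) (1 / 2 * i + y) = 0) :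
    ∑' i, thetaTerm A ξ β γ x y P (M, i) =
      P ^ (A * M ^ 2 + ξ * M) * ∑ i ∈ s, innerTerm P β γ i := by
  rw [tsum_eq_sum (s := s) fun i hi => by
    rw [thetaTerm, h0 i hi, Complex.ofReal_zero, zero_mul], Finset.mul_sum]
  exact Finset.sum_congr rfl fun i hi => by
    rw [thetaTerm, h1 i hi, Complex.ofReal_one, one_mul]

theorem halfWeight_of_abs_lt {u v w : ℝ} (hu : |u| = w) (h1 : -w < v) (h2 : v < w) :
    halfWeight u v = 1 := halfWeight_of_lt (sq_lt_sq.2 (hu ▸ abs_lt.2 ⟨h1, h2⟩))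

theorem halfWeight_of_abs_gt {u v w : ℝ} (hu : |u| = w) (h : v < -w ∨ w < v) :
    halfWeight u v = 0 := by
  refine halfWeight_of_gt (sq_lt_sq.2 (hu ▸ lt_abs.2 ?_))
  rcases h with h | h
  · exact Or.inr (by linarith)
  · exact Or.inl h

/-- The four inequalities place i = N and i = -N inside the cone and i = ±(N + 1) outside. In
`tsum_row_Ico` they do the same for the range from -s to s - 1. -/
theorem tsum_row_Icc {M : ℤ} {N : ℕ} {w : ℝ} (hw : |1 / 2 * (M : ℝ) + x| = w)
    (h1 : w < (N + 1) / 2 + y) (h2 : w < (N + 1) / 2 - y) (h3 : N / 2 + y < w)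
    (h4 : N / 2 - y < w) : ∑' i, thetaTerm A ξ β γ x y P (M, i) =
      P ^ (A * M ^ 2 + ξ * M) * innerSum P β γ N := by
  refine tsum_row_eq M _ (fun i hi => ?_) fun i hi => ?_
  · obtain ⟨hi, hi'⟩ := Finset.mem_Icc.1 hi
    have e1 : -(N : ℝ) ≤ i := by exact_mod_cast hi
    have e2 : (i : ℝ) ≤ N := by exact_mod_cast hi'
    exact halfWeight_of_abs_lt hw (by linarith) (by linarith)
  · rw [Finset.mem_Icc, not_and_or] at hi
    refine halfWeight_of_abs_gt hw (hi.imp (fun hi => ?_) fun hi => ?_)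
    · have e : (i : ℝ) + 1 ≤ -N := by exact_mod_cast (show i + 1 ≤ -(N : ℤ) by omega)
      linarith
    · have e : (N : ℝ) + 1 ≤ i := by exact_mod_cast (show (N : ℤ) + 1 ≤ i by omega)
      linarith

theorem tsum_row_Ico {M : ℤ} {s : ℕ} {w : ℝ} (hw : |1 / 2 * (M : ℝ) + x| = w)
    (h1 : w < s / 2 + y) (h2 : w < (s + 1) / 2 - y) (h3 : (s - 1) / 2 + y < w)
    (h4 : s / 2 - y < w) : ∑' i, thetaTerm A ξ β γ x y P (M, i) =
      P ^ (A * M ^ 2 + ξ * M) * innerSum' P β γ s := by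
  refine tsum_row_eq M _ (fun i hi => ?_) fun i hi => ?_
  · obtain ⟨hi, hi'⟩ := Finset.mem_Ico.1 hi
    have e1 : -(s : ℝ) ≤ i := by exact_mod_cast hi
    have e2 : (i : ℝ) + 1 ≤ s := by exact_mod_cast (show i + 1 ≤ (s : ℤ) by omega)
    exact halfWeight_of_abs_lt hw (by linarith) (by linarith)
  · rw [Finset.mem_Ico, not_and_or] at hi
    refine halfWeight_of_abs_gt hw (hi.imp (fun hi => ?_) fun hi => ?_)
    · have e : (i : ℝ) + 1 ≤ -s := by exact_mod_cast (show i + 1 ≤ -(s : ℤ) by omega)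
      linarith
    · have e : (s : ℝ) ≤ i := by exact_mod_cast (show (s : ℤ) ≤ i by omega)
      linarith

/-- On the boundary of the cone, the two half weights in a row add up to one. -/
theorem tsum_row_boundary {M : ℤ} {s : ℕ} (hs : s ≠ 0) (hM : (M : ℝ) ^ 2 = (s : ℝ) ^ 2) :
    ∑' i, thetaTerm A ξ β 0 0 0 P (M, i) = P ^ (A * M ^ 2 + ξ * M) * innerSum' P β 0 s := by
  have hs1 : (1 : ℝ) ≤ s := by exact_mod_cast Nat.one_le_iff_ne_zero.2 hs
  have hin : ∀ i ∈ Finset.Ioo (-s : ℤ) s,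
      halfWeight (1 / 2 * M + 0) (1 / 2 * i + 0) = 1 := by
    intro i hi
    obtain ⟨hi, hi'⟩ := Finset.mem_Ioo.1 hi
    have e : (i : ℝ) ^ 2 < (s : ℝ) ^ 2 := by exact_mod_cast sq_lt_sq' hi hi'
    exact halfWeight_of_lt (by linarith)
  have hbd : ∀ i : ℤ, i ^ 2 = (s : ℤ) ^ 2 →
      halfWeight (1 / 2 * M + 0) (1 / 2 * i + 0) = 1 / 2 := by
    intro i hi
    have e : (i : ℝ) ^ 2 = (s : ℝ) ^ 2 := by exact_mod_cast hi
    exact halfWeight_of_eq (by linarith)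
  have hout : ∀ i ∉ Finset.Icc (-s : ℤ) s,
      halfWeight (1 / 2 * M + 0) (1 / 2 * i + 0) = 0 := by
    intro i hi
    have e : (s : ℝ) ^ 2 < (i : ℝ) ^ 2 := by
      have : (s : ℤ) ^ 2 < i ^ 2 := by
        rw [Finset.mem_Icc, not_and_or] at hi
        refine sq_lt_sq.2 ?_
        rw [Nat.abs_cast]
        refine lt_abs.2 ?_
        omega
      exact_mod_cast this
    exact halfWeight_of_gt (by linarith)
  -- With γ = 0 the boundary terms i = ±s coincide; their two weights 1/2 make up the single full
  -- term at i = -s in `innerSum'`.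
  have hsymm : innerTerm P β 0 s = innerTerm P β 0 (-s : ℤ) := by
    simp [innerTerm]
  have hlt : (-s : ℤ) < s := by omega
  have hIco : innerSum' P β 0 s =
      innerTerm P β 0 (-s : ℤ) + ∑ i ∈ Finset.Ioo (-s : ℤ) s, innerTerm P β 0 i := by
    rw [innerSum', ← Finset.sum_Ioo_add_eq_sum_Ico hlt, add_comm]
  have hIcc : ∀ f : ℤ → ℂ, ∑ i ∈ Finset.Icc (-s : ℤ) s, f i =
      f (-s : ℤ) + ∑ i ∈ Finset.Ioo (-s : ℤ) s, f i + f s := by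
    intro f
    rw [← Finset.sum_Ico_add_eq_sum_Icc hlt.le, ← Finset.sum_Ioo_add_eq_sum_Ico hlt,
      add_comm (f (-s : ℤ))]
  have hmid : ∑ i ∈ Finset.Ioo (-s : ℤ) s, thetaTerm A ξ β 0 0 0 P (M, i) =
      P ^ (A * M ^ 2 + ξ * M) * ∑ i ∈ Finset.Ioo (-s : ℤ) s, innerTerm P β 0 i := by
    rw [Finset.mul_sum]
    refine Finset.sum_congr rfl fun i hi => ?_
    rw [thetaTerm, hin i hi, Complex.ofReal_one, one_mul]
  rw [tsum_eq_sum (s := Finset.Icc (-s : ℤ) s) fun i hi => by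
    rw [thetaTerm, hout i hi, Complex.ofReal_zero, zero_mul], hIcc, hIco, hmid]
  simp only [thetaTerm]
  rw [hbd _ (by ring), hbd _ rfl, hsymm]
  push_cast
  ring

/-- The row through the origin of the cone. -/
theorem tsum_row_origin : ∑' i, thetaTerm A ξ β γ 0 0 P (0, i) = 1 / 2 := by
  rw [tsum_eq_single 0]
  · simp [thetaTerm, halfWeight, innerTerm, Real.sign_zero]
  · intro i hi
    have e : (0 : ℝ) < (i : ℝ) ^ 2 := by positivity
    rw [thetaTerm, halfWeight_of_gt (by push_cast; linarith), Complex.ofReal_zero, zero_mul]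

/-- The rows M = N and M = -(N+1) lie at distance N/2 + x and (N+1)/2 - x from the axis. The
conditions on x and y are such that both rows meet the cone exactly in |i| ≤ N. -/
theorem thetaSum_eq_tsum_innerSum (h : Summable (thetaTerm A ξ β γ x y P)) (hy : 0 ≤ y)
    (hyx : y < x) (hxy : x + y < 1 / 2) : thetaSum A ξ β γ x y P =
      ∑' N : ℕ, (P ^ (A * N ^ 2 + ξ * N : ℤ) + P ^ (A * (N + 1) ^ 2 - ξ * (N + 1) : ℤ)) *
        innerSum P β γ N := by
  have h1 := h.prod.hasSum.nat_add_neg_add_one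
  rw [thetaSum, h.tsum_prod, ← h1.tsum_eq]
  refine tsum_congr fun N => ?_
  have hN : (0 : ℝ) ≤ N := N.cast_nonneg
  rw [tsum_row_Icc (M := N) (N := N) (w := N / 2 + x)
      (by push_cast; rw [abs_of_nonneg (by linarith)]; ring) (by linarith) (by linarith)
      (by linarith) (by linarith),
    tsum_row_Icc (M := -(N + 1)) (N := N) (w := (N + 1) / 2 - x)
      (by push_cast; rw [abs_of_nonpos (by linarith)]; ring) (by linarith) (by linarith)
      (by linarith) (by linarith),
    show A * (-((N : ℤ) + 1)) ^ 2 + ξ * -(N + 1) = A * (N + 1) ^ 2 - ξ * (N + 1) by ring]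
  ring

theorem thetaSum_eq_add_tsum (h : Summable (thetaTerm A ξ β γ x y P))
    (hrow : ∀ (s : ℕ) (M : ℤ), s ≠ 0 → M = s ∨ M = -s →
      ∑' i, thetaTerm A ξ β γ x y P (M, i) = P ^ (A * M ^ 2 + ξ * M) * innerSum' P β γ s) :
    thetaSum A ξ β γ x y P = ∑' i, thetaTerm A ξ β γ x y P (0, i) +
      ∑' t : ℕ, (P ^ (A * (t + 1) ^ 2 + ξ * (t + 1) : ℤ) +
        P ^ (A * (t + 1) ^ 2 - ξ * (t + 1) : ℤ)) * innerSum' P β γ (t + 1) := by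
  have h1 := h.prod.hasSum.nat_add_neg
  have h2 := (hasSum_nat_add_iff' 1).2 h1
  rw [thetaSum, h.tsum_prod]
  have h3 := h2.tsum_eq
  simp only [Finset.range_one, Finset.sum_singleton, Nat.cast_zero, neg_zero] at h3
  rw [add_sub_add_right_eq_sub] at h3
  rw [← sub_eq_iff_eq_add', ← h3]
  refine tsum_congr fun t => ?_
  rw [hrow (t + 1) (t + 1 : ℕ) t.succ_ne_zero (Or.inl rfl),
    hrow (t + 1) (-(t + 1 : ℕ)) t.succ_ne_zero (Or.inr rfl)]
  push_cast
  rw [show A * (-((t : ℤ) + 1)) ^ 2 + ξ * -(t + 1) = A * (t + 1) ^ 2 - ξ * (t + 1) by ring]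
  ring

/-- When x < y the cone cuts the rows M = ±s in the asymmetric range -s ≤ i < s, and the row M = 0
not at all. -/
theorem row_of_lt (hx : 0 ≤ x) (hxy : x < y) (hxy' : x + y < 1 / 2) (s : ℕ) (M : ℤ)
    (hM : M = s ∨ M = -s) : ∑' i, thetaTerm A ξ β γ x y P (M, i) =
      P ^ (A * M ^ 2 + ξ * M) * innerSum' P β γ s := by
  have hs : (0 : ℝ) ≤ s := s.cast_nonneg
  rcases eq_or_ne s 0 with rfl | hs0
  · obtain rfl : M = 0 := by simpa using hM
    exact tsum_row_Ico (w := x) (by simp [abs_of_nonneg hx]) (by simpa using hxy)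
      (by norm_num; linarith) (by norm_num; linarith) (by norm_num; linarith)
  have hs1 : (1 : ℝ) ≤ s := by exact_mod_cast Nat.one_le_iff_ne_zero.2 hs0
  rcases hM with rfl | rfl
  · exact tsum_row_Ico (w := s / 2 + x)
      (by push_cast; rw [abs_of_nonneg (by linarith)]; ring) (by linarith) (by linarith)
      (by linarith) (by linarith)
  · exact tsum_row_Ico (w := s / 2 - x)
      (by push_cast; rw [abs_of_nonpos (by linarith)]; ring) (by linarith) (by linarith)
      (by linarith) (by linarith)

end Rows

/-! ### The Hecke-type series as double theta series -/

section Hecke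

variable {x y : ℝ} {β γ : ℤ}

theorem neg_one_pow_mul_self (n : ℕ) : (-1 : ℂ) ^ n * (-1) ^ n = 1 := by
  rw [← mul_pow]
  norm_num

theorem kappa₁_eq {P q : ℂ} (hq : P ^ 2 = q) (r : ℕ) :
    kappa₁ q r = (-1) ^ r * P ^ (r * (r + 1)) := by
  rw [kappa₁, ← hq, ← pow_mul, Nat.two_mul_div_two_of_even (Nat.even_mul_succ_self r)]

theorem kappa₁_sub {P q : ℂ} (hq : P ^ 2 = q) (t : ℕ) : kappa₁ q t - kappa₁ q (t + 1) =
    (-1) ^ t * P ^ (t * (t + 1)) * (1 + P ^ (2 * t + 2)) := by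
  rw [kappa₁_eq hq, kappa₁_eq hq]
  ring

theorem kappa₂_sub (t : ℕ) : kappa₂ t - kappa₂ (t + 1) = (-1) ^ t := by
  rw [kappa₂, kappa₂]
  ring

theorem zpow_eq_pow (P : ℂ) {e : ℤ} {n : ℕ} (h : e = n) : P ^ e = P ^ n := by
  rw [h, zpow_natCast]

/-- The signs (-1)^N cancel. The outer exponents become 4N² + 3N and 4N² + 5N + 1 = 4(N+1)² -
3(N+1), those of the rows N and -(N+1). -/
theorem heckeSeries_kappa₁ {P q : ℂ} (hq : P ^ 2 = q)
    (h : Summable (thetaTerm 4 3 β γ x y P)) (hy : 0 ≤ y) (hyx : y < x) (hxy : x + y < 1 / 2) :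
    heckeSeries P β γ (kappa₁ q) = thetaSum 4 3 β γ x y P := by
  rw [thetaSum_eq_tsum_innerSum h hy hyx hxy]
  refine tsum_congr fun N => ?_
  rw [zpow_eq_pow P (n := 4 * N ^ 2 + 3 * N) (by push_cast; ring),
    zpow_eq_pow P (n := 4 * N ^ 2 + 5 * N + 1) (by push_cast; ring), heckeCoeff, kappa₁_eq hq]
  linear_combination (P ^ (4 * N ^ 2 + 3 * N) + P ^ (4 * N ^ 2 + 5 * N + 1)) *
    innerSum P β γ N * neg_one_pow_mul_self N

theorem heckeSeries_kappa₂ {P : ℂ}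
    (h : Summable (thetaTerm 3 2 β γ x y P)) (hy : 0 ≤ y) (hyx : y < x) (hxy : x + y < 1 / 2) :
    heckeSeries P β γ kappa₂ = thetaSum 3 2 β γ x y P / 2 := by
  rw [thetaSum_eq_tsum_innerSum h hy hyx hxy, ← tsum_div_const]
  refine tsum_congr fun N => ?_
  rw [zpow_eq_pow P (n := 3 * N ^ 2 + 2 * N) (by push_cast; ring),
    zpow_eq_pow P (n := 3 * N ^ 2 + 4 * N + 1) (by push_cast; ring), heckeCoeff, kappa₂]
  linear_combination (P ^ (3 * N ^ 2 + 2 * N) + P ^ (3 * N ^ 2 + 4 * N + 1)) *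
    innerSum P β γ N / 2 * neg_one_pow_mul_self N

theorem heckeCoeff'_succ (P : ℂ) (S : ℕ → ℂ) (t : ℕ) :
    heckeCoeff' P S (t + 1) = (-1) ^ t * P ^ (3 * t ^ 2 + 4 * t + 1) * S (t + 1) := by
  rw [heckeCoeff', show 3 * (t + 1) ^ 2 - 2 * (t + 1) = 3 * t ^ 2 + 4 * t + 1 by
    rw [Nat.sub_eq_iff_eq_add (by nlinarith)]
    ring]
  ring

theorem heckeSeries'_kappa₁ {P q : ℂ} (hq : P ^ 2 = q)
    (h : Summable (thetaTerm 4 1 β γ x y P)) (hx : 0 ≤ x) (hxy : x < y) (hxy' : x + y < 1 / 2) :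
    heckeSeries' P q β γ (kappa₁ q) = thetaSum 4 1 β γ x y P := by
  rw [thetaSum_eq_add_tsum h fun s M _ hM => row_of_lt hx hxy hxy' s M hM,
    row_of_lt hx hxy hxy' 0 0 (Or.inl rfl), innerSum'_zero, mul_zero, zero_add]
  refine tsum_congr fun t => ?_
  rw [zpow_eq_pow P (n := 4 * t ^ 2 + 9 * t + 5) (by push_cast; ring),
    zpow_eq_pow P (n := 4 * t ^ 2 + 7 * t + 3) (by push_cast; ring), heckeCoeff'_succ,
    kappa₁_sub hq, ← hq]
  linear_combination (P ^ (4 * t ^ 2 + 9 * t + 5) + P ^ (4 * t ^ 2 + 7 * t + 3)) *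
    innerSum' P β γ (t + 1) * neg_one_pow_mul_self t

/-- Since ξ = 0, the rows M = ±(t+1) contribute equally, while the Hecke-type series has each only
once; hence the division by 2. The row M = 0 has no counterpart and is removed. -/
theorem heckeSeries'_kappa₂ {P q : ℂ} (hq : P ^ 2 = q)
    (h : Summable (thetaTerm 3 0 β γ x y P))
    (hrow : ∀ (s : ℕ) (M : ℤ), s ≠ 0 → M = s ∨ M = -s →
      ∑' i, thetaTerm 3 0 β γ x y P (M, i) = P ^ (3 * M ^ 2 + 0 * M) * innerSum' P β γ s) :
    heckeSeries' P q β γ kappa₂ =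
      (thetaSum 3 0 β γ x y P - ∑' i, thetaTerm 3 0 β γ x y P (0, i)) / 2 := by
  rw [thetaSum_eq_add_tsum h hrow, add_sub_cancel_left, ← tsum_div_const]
  refine tsum_congr fun t => ?_
  rw [zpow_eq_pow P (n := 3 * t ^ 2 + 6 * t + 3) (by push_cast; ring),
    zpow_eq_pow P (n := 3 * t ^ 2 + 6 * t + 3) (by push_cast; ring), heckeCoeff'_succ,
    kappa₂_sub, ← hq]
  linear_combination P ^ (3 * t ^ 2 + 6 * t + 3) * innerSum' P β γ (t + 1) *
    neg_one_pow_mul_self t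

theorem heckeSeries'_kappa₂_of_lt {P q : ℂ} (hq : P ^ 2 = q)
    (h : Summable (thetaTerm 3 0 β γ x y P)) (hx : 0 ≤ x) (hxy : x < y) (hxy' : x + y < 1 / 2) :
    heckeSeries' P q β γ kappa₂ = thetaSum 3 0 β γ x y P / 2 := by
  rw [heckeSeries'_kappa₂ hq h fun s M _ hM => row_of_lt hx hxy hxy' s M hM,
    row_of_lt hx hxy hxy' 0 0 (Or.inl rfl), innerSum'_zero, mul_zero, sub_zero]

theorem heckeSeries'_kappa₂_zero {P q : ℂ} (hq : P ^ 2 = q)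
    (h : Summable (thetaTerm 3 0 β 0 0 0 P)) :
    heckeSeries' P q β 0 kappa₂ = (thetaSum 3 0 β 0 0 0 P - 1 / 2) / 2 := by
  rw [heckeSeries'_kappa₂ hq h fun s M hs hM => tsum_row_boundary hs ?_, tsum_row_origin]
  rcases hM with rfl | rfl <;> simp

end Hecke

/-! ### Evaluation of the twelve series and comparison with ϑ_μ. -/

/-! ### Evaluation as sums over lattices -/

theorem norm_nome_lt_one {τ : ℂ} (hτ : 0 < τ.im) {r : ℝ} (hr : 0 < r) : ‖nome τ r‖ < 1 := by
  rw [norm_nome, Real.exp_lt_one_iff]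
  have := Real.pi_pos
  have : 0 < 2 * Real.pi * τ.im * r := by positivity
  linarith

theorem nome_half_sq (τ : ℂ) : nome τ (1 / 2) ^ 2 = nome τ 1 := by
  rw [sq, ← nome_add]
  norm_num

theorem nome_zero (τ : ℂ) : nome τ 0 = 1 := by
  simp [nome]

theorem nome_mul_nome (τ : ℂ) {r s t : ℝ} (h : r + s = t) : nome τ r * nome τ s = nome τ t := by
  rw [← nome_add, h]

theorem thetaData_f₁ : ThetaData 8 4 (3 / 16) (1 / 8) 4 3 2 1 := by
  constructor <;> first | decide | norm_num

theorem thetaData_f₀ : ThetaData 8 4 (1 / 16) (1 / 8) 4 1 2 1 := by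
  constructor <;> first | decide | norm_num

theorem thetaData_g₁ : ThetaData 6 2 (1 / 6) 0 3 2 1 0 := by
  constructor <;> first | decide | norm_num

theorem thetaData_g₀ : ThetaData 6 2 0 0 3 0 1 0 := by
  constructor <;> first | decide | norm_num

theorem thetaData_h₁ : ThetaData 6 4 (1 / 6) (1 / 8) 3 2 2 1 := by
  constructor <;> first | decide | norm_num

theorem thetaData_h₀ : ThetaData 6 4 0 (1 / 8) 3 0 2 1 := by
  constructor <;> first | decide | norm_num

section Evaluation

variable {τ : ℂ}

theorem ThetaData.eq_of_forall {a b x y : ℝ} {A ξ β γ : ℤ} (h : ThetaData a b x y A ξ β γ)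
    (hτ : 0 < τ.im) {F G : ℂ → ℂ}
    (hF : ∀ P : ℂ, P ^ 2 = nome τ 1 → Summable (thetaTerm A ξ β γ x y P) → F P = G P) :
    F (nome τ (1 / 2)) = G (nome τ (1 / 2)) ∧ F (-nome τ (1 / 2)) = G (-nome τ (1 / 2)) := by
  have h1 := h.summable_thetaTerm hτ (σ := 1) (Or.inl rfl)
  have h2 := h.summable_thetaTerm hτ (σ := -1) (Or.inr rfl)
  rw [one_mul] at h1
  rw [neg_one_mul] at h2
  exact ⟨hF _ (nome_half_sq τ) h1, hF _ (by rw [neg_sq, nome_half_sq]) h2⟩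

/-- In each of the twelve evaluations the exponent of the prefactor, plus 1/2 or 1 when a factor p
or q stands in front of the Hecke-type series, equals a x² - b y². -/
theorem mul_L1 (hτ : 0 < τ.im) : nome τ (-17 / 32) * L1 (nome τ 1) =
    latticeSum 8 4 τ (1 / 16 + 1 / 2) (1 / 8) + latticeSum 8 4 τ (1 / 16) (1 / 8 + 1 / 2) := by
  obtain ⟨h1, h2⟩ := thetaData_f₀.eq_of_forall hτ fun P hP hs =>
    heckeSeries'_kappa₁ hP hs (by norm_num) (by norm_num) (by norm_num)
  rw [L1_eq (norm_nome_lt_one hτ one_pos) (nome_ne_zero _ _) (norm_nome_lt_one hτ one_half_pos)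
    (nome_ne_zero _ _) (nome_half_sq τ), h1, h2, ← thetaData_f₀.odd_part hτ,
    ← nome_mul_nome τ (show (-17 / 32 : ℝ) + 1 / 2 = 8 * (1 / 16) ^ 2 - 4 * (1 / 8) ^ 2 by norm_num)]
  ring

theorem mul_L3 (hτ : 0 < τ.im) : nome τ (-33 / 32) * L3 (nome τ 1) =
    latticeSum 8 4 τ (1 / 16) (1 / 8) +
      latticeSum 8 4 τ (1 / 16 + 1 / 2) (1 / 8 + 1 / 2) := by
  obtain ⟨h1, h2⟩ := thetaData_f₀.eq_of_forall hτ fun P hP hs =>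
    heckeSeries'_kappa₁ hP hs (by norm_num) (by norm_num) (by norm_num)
  rw [L3_eq (norm_nome_lt_one hτ one_pos) (nome_ne_zero _ _) (norm_nome_lt_one hτ one_half_pos)
    (nome_ne_zero _ _) (nome_half_sq τ), h1, h2, ← thetaData_f₀.even_part hτ,
    ← nome_mul_nome τ (show (-33 / 32 : ℝ) + 1 = 8 * (1 / 16) ^ 2 - 4 * (1 / 8) ^ 2 by norm_num)]
  ring

theorem mul_L2 (hτ : 0 < τ.im) : nome τ (7 / 32) * L2 (nome τ 1) =
    latticeSum 8 4 τ (3 / 16) (1 / 8) +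
      latticeSum 8 4 τ (3 / 16 + 1 / 2) (1 / 8 + 1 / 2) := by
  obtain ⟨h1, h2⟩ := thetaData_f₁.eq_of_forall hτ fun P hP hs =>
    heckeSeries_kappa₁ hP hs (by norm_num) (by norm_num) (by norm_num)
  rw [L2_eq (norm_nome_lt_one hτ one_pos) (nome_ne_zero _ _) (norm_nome_lt_one hτ one_half_pos)
    (nome_ne_zero _ _) (nome_half_sq τ), h1, h2, ← thetaData_f₁.even_part hτ,
    show (7 / 32 : ℝ) = 8 * (3 / 16) ^ 2 - 4 * (1 / 8) ^ 2 by norm_num]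

theorem mul_L4 (hτ : 0 < τ.im) : nome τ (-9 / 32) * L4 (nome τ 1) =
    latticeSum 8 4 τ (3 / 16 + 1 / 2) (1 / 8) + latticeSum 8 4 τ (3 / 16) (1 / 8 + 1 / 2) := by
  obtain ⟨h1, h2⟩ := thetaData_f₁.eq_of_forall hτ fun P hP hs =>
    heckeSeries_kappa₁ hP hs (by norm_num) (by norm_num) (by norm_num)
  rw [L4_eq (norm_nome_lt_one hτ one_pos) (nome_ne_zero _ _) (norm_nome_lt_one hτ one_half_pos)
    (nome_ne_zero _ _) (nome_half_sq τ), h1, h2, ← thetaData_f₁.odd_part hτ,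
    ← nome_mul_nome τ (show (-9 / 32 : ℝ) + 1 / 2 = 8 * (3 / 16) ^ 2 - 4 * (1 / 8) ^ 2 by norm_num)]
  ring

theorem mul_L5 (hτ : 0 < τ.im) : nome τ (-1) * L5 (nome τ 1) =
    latticeSum 6 2 τ 0 0 + latticeSum 6 2 τ (0 + 1 / 2) (0 + 1 / 2) - 1 / 2 := by
  -- The row through the origin leaves -1/2 in the even combination. In `mul_L6` the odd combination
  -- cancels it.
  obtain ⟨h1, h2⟩ := thetaData_g₀.eq_of_forall hτ fun P hP hs => heckeSeries'_kappa₂_zero hP hs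
  rw [L5_eq (norm_nome_lt_one hτ one_pos) (nome_ne_zero _ _) (norm_nome_lt_one hτ one_half_pos)
    (nome_ne_zero _ _) (nome_half_sq τ), h1, h2, ← thetaData_g₀.even_part hτ, ← mul_assoc,
    nome_mul_nome τ (show (-1 : ℝ) + 1 = 6 * 0 ^ 2 - 2 * 0 ^ 2 by norm_num),
    show (6 * 0 ^ 2 - 2 * 0 ^ 2 : ℝ) = 0 by norm_num, nome_zero]
  ring

theorem mul_L6 (hτ : 0 < τ.im) : nome τ (-1 / 2) * L6 (nome τ 1) =
    latticeSum 6 2 τ (0 + 1 / 2) 0 + latticeSum 6 2 τ 0 (0 + 1 / 2) := by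
  obtain ⟨h1, h2⟩ := thetaData_g₀.eq_of_forall hτ fun P hP hs => heckeSeries'_kappa₂_zero hP hs
  rw [L6_eq (norm_nome_lt_one hτ one_pos) (nome_ne_zero _ _) (norm_nome_lt_one hτ one_half_pos)
    (nome_ne_zero _ _) (nome_half_sq τ), h1, h2, ← thetaData_g₀.odd_part hτ,
    ← nome_mul_nome τ (show (-1 / 2 : ℝ) + 1 / 2 = 6 * 0 ^ 2 - 2 * 0 ^ 2 by norm_num)]
  ring

theorem mul_L7 (hτ : 0 < τ.im) : nome τ (1 / 6) * L7 (nome τ 1) =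
    latticeSum 6 2 τ (1 / 6) 0 + latticeSum 6 2 τ (1 / 6 + 1 / 2) (0 + 1 / 2) := by
  obtain ⟨h1, h2⟩ := thetaData_g₁.eq_of_forall hτ fun P _ hs =>
    heckeSeries_kappa₂ hs le_rfl (by norm_num) (by norm_num)
  rw [L7_eq (norm_nome_lt_one hτ one_pos) (nome_ne_zero _ _) (norm_nome_lt_one hτ one_half_pos)
    (nome_ne_zero _ _) (nome_half_sq τ), h1, h2, ← thetaData_g₁.even_part hτ,
    show (6 * (1 / 6) ^ 2 - 2 * 0 ^ 2 : ℝ) = 1 / 6 by norm_num]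
  ring

theorem mul_L8 (hτ : 0 < τ.im) : nome τ (-1 / 3) * L8 (nome τ 1) =
    latticeSum 6 2 τ (1 / 6 + 1 / 2) 0 + latticeSum 6 2 τ (1 / 6) (0 + 1 / 2) := by
  obtain ⟨h1, h2⟩ := thetaData_g₁.eq_of_forall hτ fun P _ hs =>
    heckeSeries_kappa₂ hs le_rfl (by norm_num) (by norm_num)
  rw [L8_eq (norm_nome_lt_one hτ one_pos) (nome_ne_zero _ _) (norm_nome_lt_one hτ one_half_pos)
    (nome_ne_zero _ _) (nome_half_sq τ), h1, h2, ← thetaData_g₁.odd_part hτ,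
    ← nome_mul_nome τ (show (-1 / 3 : ℝ) + 1 / 2 = 6 * (1 / 6) ^ 2 - 2 * 0 ^ 2 by norm_num)]
  ring

theorem mul_L9 (hτ : 0 < τ.im) : nome τ (-9 / 16) * L9 (nome τ 1) =
    latticeSum 6 4 τ (0 + 1 / 2) (1 / 8) + latticeSum 6 4 τ 0 (1 / 8 + 1 / 2) := by
  obtain ⟨h1, h2⟩ := thetaData_h₀.eq_of_forall hτ fun P hP hs =>
    heckeSeries'_kappa₂_of_lt hP hs le_rfl (by norm_num) (by norm_num)
  rw [L9_eq (norm_nome_lt_one hτ one_pos) (nome_ne_zero _ _) (norm_nome_lt_one hτ one_half_pos)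
    (nome_ne_zero _ _) (nome_half_sq τ), h1, h2, ← thetaData_h₀.odd_part hτ,
    ← nome_mul_nome τ (show (-9 / 16 : ℝ) + 1 / 2 = 6 * 0 ^ 2 - 4 * (1 / 8) ^ 2 by norm_num)]
  ring

theorem mul_L10 (hτ : 0 < τ.im) : nome τ (-17 / 16) * L10 (nome τ 1) =
    latticeSum 6 4 τ 0 (1 / 8) + latticeSum 6 4 τ (0 + 1 / 2) (1 / 8 + 1 / 2) := by
  obtain ⟨h1, h2⟩ := thetaData_h₀.eq_of_forall hτ fun P hP hs =>
    heckeSeries'_kappa₂_of_lt hP hs le_rfl (by norm_num) (by norm_num)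
  rw [L10_eq (norm_nome_lt_one hτ one_pos) (nome_ne_zero _ _) (norm_nome_lt_one hτ one_half_pos)
    (nome_ne_zero _ _) (nome_half_sq τ), h1, h2, ← thetaData_h₀.even_part hτ,
    ← nome_mul_nome τ (show (-17 / 16 : ℝ) + 1 = 6 * 0 ^ 2 - 4 * (1 / 8) ^ 2 by norm_num)]
  ring

theorem mul_L11 (hτ : 0 < τ.im) : nome τ (5 / 48) * L11 (nome τ 1) =
    latticeSum 6 4 τ (1 / 6) (1 / 8) +
      latticeSum 6 4 τ (1 / 6 + 1 / 2) (1 / 8 + 1 / 2) := by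
  obtain ⟨h1, h2⟩ := thetaData_h₁.eq_of_forall hτ fun P _ hs =>
    heckeSeries_kappa₂ hs (by norm_num) (by norm_num) (by norm_num)
  rw [L11_eq (norm_nome_lt_one hτ one_pos) (nome_ne_zero _ _) (norm_nome_lt_one hτ one_half_pos)
    (nome_ne_zero _ _) (nome_half_sq τ), h1, h2, ← thetaData_h₁.even_part hτ,
    show (5 / 48 : ℝ) = 6 * (1 / 6) ^ 2 - 4 * (1 / 8) ^ 2 by norm_num]
  ring

theorem mul_L12 (hτ : 0 < τ.im) : nome τ (-19 / 48) * L12 (nome τ 1) =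
    latticeSum 6 4 τ (1 / 6 + 1 / 2) (1 / 8) + latticeSum 6 4 τ (1 / 6) (1 / 8 + 1 / 2) := by
  obtain ⟨h1, h2⟩ := thetaData_h₁.eq_of_forall hτ fun P _ hs =>
    heckeSeries_kappa₂ hs (by norm_num) (by norm_num) (by norm_num)
  rw [L12_eq (norm_nome_lt_one hτ one_pos) (nome_ne_zero _ _) (norm_nome_lt_one hτ one_half_pos)
    (nome_ne_zero _ _) (nome_half_sq τ), h1, h2, ← thetaData_h₁.odd_part hτ,
    ← nome_mul_nome τ (show (-19 / 48 : ℝ) + 1 / 2 = 6 * (1 / 6) ^ 2 - 4 * (1 / 8) ^ 2 by norm_num)]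
  ring

end Evaluation

/-! ### The theta functions `vartheta` -/

/-- The condition a u = b v makes the coefficients of n₁ and n₂ equal in absolute value. -/
theorem isStandardCone_smul {a b s u v : ℝ} (hs : 0 < s) (h : a * u = b * v) (hu : 0 < a * u) :
    IsStandardCone a b (s • (-u, v)) (s • (u, v)) := by
  refine ⟨2 * s * (a * u), by positivity, fun n => ⟨?_, ?_⟩⟩
  · simp only [bilinForm, Prod.smul_mk, smul_eq_mul]
    linear_combination (2 * s * n.2) * h
  · simp only [bilinForm, Prod.smul_mk, smul_eq_mul]
    linear_combination (2 * s * n.2) * h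

theorem isStandardCone_f : IsStandardCone 8 4 cF₁ cF₂ :=
  isStandardCone_smul (by positivity) (by norm_num) (by norm_num)

theorem isStandardCone_g : IsStandardCone 6 2 cG₁ cG₂ :=
  isStandardCone_smul (by positivity) (by norm_num) (by norm_num)

theorem isStandardCone_h : IsStandardCone 6 4 cH₁ cH₂ :=
  isStandardCone_smul (by positivity) (by norm_num) (by norm_num)

theorem param_neg (a : ℝ) (u v v' : ℝ) : param a (-u, v) = -param a (u, v') := by
  rw [param, param, mul_neg, Real.arsinh_neg]

theorem param_lt_param {a : ℝ} (ha : 0 < a) {c₁ c₂ : ℝ × ℝ} (h : c₁.1 < c₂.1) :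
    param a c₁ < param a c₂ :=
  Real.arsinh_lt_arsinh.2 (mul_lt_mul_of_pos_left h (Real.sqrt_pos.2 ha))

theorem fst_smul_neg_lt {s u v v' : ℝ} (hs : 0 < s) (hu : 0 < u) :
    (s • ((-u, v) : ℝ × ℝ)).1 < (s • ((u, v') : ℝ × ℝ)).1 := by
  simp only [Prod.smul_mk, smul_eq_mul]
  nlinarith [mul_pos hs hu]

theorem param_f : param 8 cF₁ < param 8 cF₂ :=
  param_lt_param (by norm_num) (fst_smul_neg_lt (by positivity) one_pos)

theorem param_g : param 6 cG₁ < param 6 cG₂ :=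
  param_lt_param (by norm_num) (fst_smul_neg_lt (by positivity) one_pos)

theorem param_h : param 6 cH₁ < param 6 cH₂ :=
  param_lt_param (by norm_num) (fst_smul_neg_lt (by positivity) two_pos)

theorem intCast_notMem_Ioo (k : ℤ) : (k : ℝ) ∉ Set.Ioo (0 : ℝ) 1 := by
  rintro ⟨h1, h2⟩
  have h1 : 0 < k := by exact_mod_cast h1
  have h2 : k < 1 := by exact_mod_cast h2
  omega

section Vartheta

variable {a b : ℝ} {c₁ c₂ μ : ℝ × ℝ} (τ : ℂ)

/-- One coordinate strictly between 0 and 1 suffices; among the shifts in the three families, only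
the first one of `gVec 0` fails this. -/
theorem notMem_shiftedLattice_zero (hμ : μ.1 ∈ Set.Ioo (0 : ℝ) 1 ∨ μ.2 ∈ Set.Ioo (0 : ℝ) 1) :
    μ ∉ shiftedLattice (0, 0) := by
  rintro ⟨m, rfl⟩
  simp only [add_zero] at hμ
  exact hμ.elim (intCast_notMem_Ioo _) (intCast_notMem_Ioo _)

theorem zero_notMem_shiftedLattice (hμ : μ.1 ∈ Set.Ioo (0 : ℝ) 1 ∨ μ.2 ∈ Set.Ioo (0 : ℝ) 1) :
    (0, 0) ∉ shiftedLattice μ := by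
  rintro ⟨m, h⟩
  refine notMem_shiftedLattice_zero hμ ⟨-m, ?_⟩
  obtain ⟨h1, h2⟩ := Prod.mk.inj h
  refine Prod.ext ?_ ?_ <;> simp only [Prod.fst_neg, Prod.snd_neg] <;> push_cast <;> linarith

theorem vartheta_eq (hc : IsStandardCone a b c₁ c₂) (ht : param a c₁ < param a c₂) :
    vartheta a b c₁ c₂ μ τ = -(((param a c₂ - param a c₁) / Real.pi : ℝ) : ℂ) *
      (open Classical in if μ ∈ shiftedLattice (0, 0) then 1 else 0) +
        1 / 2 * falseSum a b τ (shiftedLattice μ \ {(0, 0)}) := by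
  rw [vartheta, Real.sign_of_pos (sub_pos.2 ht), falseSum]
  simp only [hc.varthetaTerm_eq]
  push_cast
  rfl

theorem vartheta_eq_latticeSum (hc : IsStandardCone a b c₁ c₂) (ht : param a c₁ < param a c₂)
    (hμ : μ.1 ∈ Set.Ioo (0 : ℝ) 1 ∨ μ.2 ∈ Set.Ioo (0 : ℝ) 1) :
    vartheta a b c₁ c₂ μ τ = latticeSum a b τ μ.1 μ.2 := by
  rw [vartheta_eq τ hc ht, if_neg (notMem_shiftedLattice_zero hμ), mul_zero, zero_add,
    Set.sdiff_singleton_eq_self (zero_notMem_shiftedLattice hμ), half_falseSum]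

end Vartheta

theorem falseTerm_zero (a b : ℝ) (τ : ℂ) : falseTerm a b τ (0, 0) = 1 := by
  simp [falseTerm, quadForm, nome_zero, Real.sign_zero]

theorem half_falseSum_punctured {a b : ℝ} (hb : 0 < b) (hab : b < a) {τ : ℂ} (hτ : 0 < τ.im) :
    1 / 2 * falseSum a b τ (shiftedLattice (0, 0) \ {(0, 0)}) =
      latticeSum a b τ 0 0 - 1 / 2 := by
  have h0 : ((0, 0) : ℝ × ℝ) ∈ shiftedLattice (0, 0) := ⟨0, by simp⟩
  have hs := summable_falseTerm_shiftedLattice hb hab hτ (0, 0)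
  have hsub : Set.Subset (shiftedLattice (0, 0) \ {(0, 0)}) (shiftedLattice (0, 0)) :=
    Set.sdiff_subset
  have hs' := hs.comp_injective (Set.inclusion_injective hsub)
  have h1 := Summable.tsum_union_disjoint (f := falseTerm a b τ) (s := {(0, 0)})
    (t := shiftedLattice (0, 0) \ {(0, 0)}) Set.disjoint_sdiff_right ((Set.toFinite _).summable _) hs'
  rw [Set.union_sdiff_cancel (Set.singleton_subset_iff.2 h0), tsum_singleton, falseTerm_zero] at h1
  have h2 : falseSum a b τ (shiftedLattice (0, 0)) =
      1 + falseSum a b τ (shiftedLattice (0, 0) \ {(0, 0)}) := h1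
  have h3 := half_falseSum a b τ (0, 0)
  rw [h2] at h3
  linear_combination h3

/-- The formula sinh(artanh t) = t/√(1 - t²) at t = 1/√3, where 1 - t² = 2/3 = (2/√6)², gives √6
times the first coordinate of `cG₂`. -/
theorem param_g_sub : param 6 cG₂ - param 6 cG₁ = 2 * Real.artanh (1 / √3) := by
  have h3 : (√3 : ℝ) ^ 2 = 3 := Real.sq_sqrt (by norm_num)
  have hpos : (0 : ℝ) < √3 := by positivity
  have hlt : 1 / √3 < 1 := by
    rw [div_lt_one hpos]
    nlinarith
  have h2 : param 6 cG₂ = Real.artanh (1 / √3) := by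
    rw [← Real.arsinh_sinh (Real.artanh (1 / √3)), Real.sinh_artanh ⟨by
      have : 0 < 1 / √3 := by positivity
      linarith, hlt⟩, param, cG₂]
    congr 1
    have e1 : (1 : ℝ) - (1 / √3) ^ 2 = (2 / √6) ^ 2 := by
      rw [div_pow, div_pow, h3, Real.sq_sqrt (by norm_num)]
      norm_num
    rw [e1, Real.sqrt_sq (by positivity)]
    simp only [Prod.smul_mk, smul_eq_mul]
    field_simp
  have h1 : param 6 cG₁ = -param 6 cG₂ := by
    rw [cG₁, cG₂, Prod.smul_mk, Prod.smul_mk, smul_neg, param_neg]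
  rw [h1, h2]
  ring

end FalseIndefiniteTheta

end

theorem mainTheorem10 (τ : ℂ) (hτ : 0 < τ.im) (q : ℂ) (hq : q = nome τ 1) :
    -- all series converge
    (HypergeometricConverge q ∧ ThetaConverge 8 4 cF₁ cF₂ τ ∧ ThetaConverge 6 2 cG₁ cG₂ τ ∧
      ThetaConverge 6 4 cH₁ cH₂ τ) ∧
    -- the first family
    (nome τ (-17 / 32) * L1 q = 1 / 2 * (falseSum 8 4 τ (shiftedLattice (1 / 16, 3 / 8)) +
        falseSum 8 4 τ (shiftedLattice (7 / 16, 1 / 8))) ∧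
      nome τ (7 / 32) * L2 q = 1 / 2 * (falseSum 8 4 τ (shiftedLattice (3 / 16, 1 / 8)) +
        falseSum 8 4 τ (shiftedLattice (5 / 16, 3 / 8))) ∧
      nome τ (-33 / 32) * L3 q = 1 / 2 * (falseSum 8 4 τ (shiftedLattice (1 / 16, 1 / 8)) +
        falseSum 8 4 τ (shiftedLattice (7 / 16, 3 / 8))) ∧
      nome τ (-9 / 32) * L4 q = 1 / 2 * (falseSum 8 4 τ (shiftedLattice (3 / 16, 3 / 8)) +
        falseSum 8 4 τ (shiftedLattice (5 / 16, 1 / 8)))) ∧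
    (nome τ (-17 / 32) * L1 q = fVec 3 τ ∧ nome τ (7 / 32) * L2 q = fVec 1 τ ∧
      nome τ (-33 / 32) * L3 q = fVec 0 τ ∧ nome τ (-9 / 32) * L4 q = fVec 2 τ) ∧
    -- the second family
    (nome τ (-1) * L5 q = 1 / 2 * (falseSum 6 2 τ (shiftedLattice (0, 0) \ {(0, 0)}) +
        falseSum 6 2 τ (shiftedLattice (1 / 2, 1 / 2))) ∧
      nome τ (-1 / 2) * L6 q = 1 / 2 * (falseSum 6 2 τ (shiftedLattice (0, 1 / 2)) +
        falseSum 6 2 τ (shiftedLattice (1 / 2, 0))) ∧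
      nome τ (1 / 6) * L7 q = 1 / 2 * (falseSum 6 2 τ (shiftedLattice (1 / 3, 1 / 2)) +
        falseSum 6 2 τ (shiftedLattice (1 / 6, 0))) ∧
      nome τ (-1 / 3) * L8 q = 1 / 2 * (falseSum 6 2 τ (shiftedLattice (1 / 6, 1 / 2)) +
        falseSum 6 2 τ (shiftedLattice (1 / 3, 0)))) ∧
    (nome τ (-1) * L5 q - ((2 / Real.pi * Real.artanh (1 / √3) : ℝ) : ℂ) = gVec 0 τ ∧
      nome τ (-1 / 2) * L6 q = gVec 3 τ ∧ nome τ (1 / 6) * L7 q = gVec 1 τ ∧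
      nome τ (-1 / 3) * L8 q = gVec 2 τ) ∧
    -- the third family
    (nome τ (-9 / 16) * L9 q = 1 / 2 * (falseSum 6 4 τ (shiftedLattice (0, 3 / 8)) +
        falseSum 6 4 τ (shiftedLattice (1 / 2, 7 / 8))) ∧
      nome τ (-17 / 16) * L10 q = 1 / 2 * (falseSum 6 4 τ (shiftedLattice (0, 1 / 8)) +
        falseSum 6 4 τ (shiftedLattice (1 / 2, 5 / 8))) ∧
      nome τ (5 / 48) * L11 q = 1 / 2 * (falseSum 6 4 τ (shiftedLattice (1 / 6, 1 / 8)) +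
        falseSum 6 4 τ (shiftedLattice (2 / 3, 5 / 8))) ∧
      nome τ (-19 / 48) * L12 q = 1 / 2 * (falseSum 6 4 τ (shiftedLattice (1 / 6, 3 / 8)) +
        falseSum 6 4 τ (shiftedLattice (2 / 3, 7 / 8)))) ∧
    (nome τ (-9 / 16) * L9 q = hVec 3 τ ∧ nome τ (-17 / 16) * L10 q = hVec 0 τ ∧
      nome τ (5 / 48) * L11 q = hVec 1 τ ∧ nome τ (-19 / 48) * L12 q = hVec 2 τ) := by
  subst hq
  have hq := norm_nome_lt_one hτ one_pos
  have hF : ∀ {μ : ℝ × ℝ}, μ.1 ∈ Set.Ioo (0 : ℝ) 1 ∨ μ.2 ∈ Set.Ioo (0 : ℝ) 1 →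
      vartheta 8 4 cF₁ cF₂ μ τ = latticeSum 8 4 τ μ.1 μ.2 := fun hμ =>
    vartheta_eq_latticeSum τ isStandardCone_f param_f hμ
  have hG : ∀ {μ : ℝ × ℝ}, μ.1 ∈ Set.Ioo (0 : ℝ) 1 ∨ μ.2 ∈ Set.Ioo (0 : ℝ) 1 →
      vartheta 6 2 cG₁ cG₂ μ τ = latticeSum 6 2 τ μ.1 μ.2 := fun hμ =>
    vartheta_eq_latticeSum τ isStandardCone_g param_g hμ
  have hH : ∀ {μ : ℝ × ℝ}, μ.1 ∈ Set.Ioo (0 : ℝ) 1 ∨ μ.2 ∈ Set.Ioo (0 : ℝ) 1 →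
      vartheta 6 4 cH₁ cH₂ μ τ = latticeSum 6 4 τ μ.1 μ.2 := fun hμ =>
    vartheta_eq_latticeSum τ isStandardCone_h param_h hμ
  refine ⟨⟨hypergeometricConverge hq (nome_ne_zero _ _) (norm_nome_lt_one hτ one_half_pos)
    (nome_ne_zero _ _) (nome_half_sq τ), thetaConverge isStandardCone_f (by norm_num)
    (by norm_num) hτ, thetaConverge isStandardCone_g (by norm_num) (by norm_num) hτ,
    thetaConverge isStandardCone_h (by norm_num) (by norm_num) hτ⟩,
    ⟨?_, ?_, ?_, ?_⟩, ⟨?_, ?_, ?_, ?_⟩, ⟨?_, ?_, ?_, ?_⟩, ⟨?_, ?_, ?_, ?_⟩, ⟨?_, ?_, ?_, ?_⟩,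
    ⟨?_, ?_, ?_, ?_⟩⟩
  · rw [mul_L1 hτ, mul_add, half_falseSum, half_falseSum, add_comm]
    -- Here and below, the integers are the translations k in `ShiftEquiv`, and `Or.inr` means that
    -- the coordinate is also negated, as in 5/8 = -3/8 + 1.
    exact congrArg₂ _
      (latticeSum_congr _ _ _ ⟨0, Or.inl (by norm_num)⟩ ⟨1, Or.inr (by norm_num)⟩)
      (latticeSum_congr _ _ _ ⟨1, Or.inr (by norm_num)⟩ ⟨0, Or.inl (by norm_num)⟩)
  · rw [mul_L2 hτ, mul_add, half_falseSum, half_falseSum]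
    exact congrArg₂ _
      (latticeSum_congr _ _ _ ⟨0, Or.inl (by norm_num)⟩ ⟨0, Or.inl (by norm_num)⟩)
      (latticeSum_congr _ _ _ ⟨1, Or.inr (by norm_num)⟩ ⟨1, Or.inr (by norm_num)⟩)
  · rw [mul_L3 hτ, mul_add, half_falseSum, half_falseSum]
    exact congrArg₂ _
      (latticeSum_congr _ _ _ ⟨0, Or.inl (by norm_num)⟩ ⟨0, Or.inl (by norm_num)⟩)
      (latticeSum_congr _ _ _ ⟨1, Or.inr (by norm_num)⟩ ⟨1, Or.inr (by norm_num)⟩)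
  · rw [mul_L4 hτ, mul_add, half_falseSum, half_falseSum, add_comm]
    exact congrArg₂ _
      (latticeSum_congr _ _ _ ⟨0, Or.inl (by norm_num)⟩ ⟨1, Or.inr (by norm_num)⟩)
      (latticeSum_congr _ _ _ ⟨1, Or.inr (by norm_num)⟩ ⟨0, Or.inl (by norm_num)⟩)
  · rw [fVec, hF (Or.inr (by norm_num [lam])), hF (Or.inr (by norm_num [lam])), mul_L1 hτ]
    exact congrArg₂ _
      (latticeSum_congr _ _ _ ⟨1, Or.inr (by norm_num [lam])⟩
        ⟨0, Or.inl (by norm_num [lam])⟩)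
      (latticeSum_congr _ _ _ ⟨1, Or.inr (by norm_num [lam])⟩
        ⟨0, Or.inl (by norm_num [lam])⟩)
  · rw [fVec, hF (Or.inr (by norm_num [lam])), hF (Or.inr (by norm_num [lam])), mul_L2 hτ]
    exact congrArg₂ _
      (latticeSum_congr _ _ _ ⟨0, Or.inl (by norm_num [lam])⟩
        ⟨0, Or.inl (by norm_num [lam])⟩)
      (latticeSum_congr _ _ _ ⟨0, Or.inl (by norm_num [lam])⟩
        ⟨0, Or.inl (by norm_num [lam])⟩)
  · rw [fVec, hF (Or.inr (by norm_num [lam])), hF (Or.inr (by norm_num [lam])), mul_L3 hτ]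
    exact congrArg₂ _
      (latticeSum_congr _ _ _ ⟨0, Or.inl (by norm_num [lam])⟩
        ⟨0, Or.inl (by norm_num [lam])⟩)
      (latticeSum_congr _ _ _ ⟨0, Or.inl (by norm_num [lam])⟩
        ⟨0, Or.inl (by norm_num [lam])⟩)
  · rw [fVec, hF (Or.inr (by norm_num [lam])), hF (Or.inr (by norm_num [lam])), mul_L4 hτ]
    exact congrArg₂ _
      (latticeSum_congr _ _ _ ⟨1, Or.inr (by norm_num [lam])⟩
        ⟨0, Or.inl (by norm_num [lam])⟩)
      (latticeSum_congr _ _ _ ⟨1, Or.inr (by norm_num [lam])⟩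
        ⟨0, Or.inl (by norm_num [lam])⟩)
  · rw [mul_L5 hτ, mul_add, half_falseSum_punctured (by norm_num) (by norm_num) hτ, half_falseSum,
      zero_add]
    ring
  · rw [mul_L6 hτ, mul_add, half_falseSum, half_falseSum, add_comm]
    exact congrArg₂ _
      (latticeSum_congr _ _ _ ⟨0, Or.inl (by norm_num)⟩ ⟨0, Or.inl (by norm_num)⟩)
      (latticeSum_congr _ _ _ ⟨0, Or.inl (by norm_num)⟩ ⟨0, Or.inl (by norm_num)⟩)
  · rw [mul_L7 hτ, mul_add, half_falseSum, half_falseSum, add_comm]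
    exact congrArg₂ _
      (latticeSum_congr _ _ _ ⟨1, Or.inr (by norm_num)⟩ ⟨0, Or.inl (by norm_num)⟩)
      (latticeSum_congr _ _ _ ⟨0, Or.inl (by norm_num)⟩ ⟨0, Or.inl (by norm_num)⟩)
  · rw [mul_L8 hτ, mul_add, half_falseSum, half_falseSum, add_comm]
    exact congrArg₂ _
      (latticeSum_congr _ _ _ ⟨0, Or.inl (by norm_num)⟩ ⟨0, Or.inl (by norm_num)⟩)
      (latticeSum_congr _ _ _ ⟨1, Or.inr (by norm_num)⟩ ⟨0, Or.inl (by norm_num)⟩)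
  -- The shift (0, 0) lies in ℤ², so the δ-term is present and supplies the arctanh; the shift (1/2,
  -- 1/2) is generic.
  · rw [mul_L5 hτ, gVec,
      hG (μ := (((0 : Fin 4) : ℝ) / 6, (0 : ℝ)) + lam) (Or.inr (by norm_num [lam])),
      show (((0 : Fin 4) : ℝ) / 6, (0 : ℝ)) = (0, 0) by simp, vartheta_eq τ isStandardCone_g param_g,
      if_pos ⟨0, by simp⟩, half_falseSum_punctured (by norm_num) (by norm_num) hτ, param_g_sub]
    simp only [lam, Prod.mk_add_mk]
    push_cast
    ring
  · rw [gVec, hG (Or.inl (by norm_num [lam])), hG (Or.inr (by norm_num [lam])), mul_L6 hτ]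
    exact congrArg₂ _
      (latticeSum_congr _ _ _ ⟨0, Or.inl (by norm_num [lam])⟩
        ⟨0, Or.inl (by norm_num [lam])⟩)
      (latticeSum_congr _ _ _ ⟨-1, Or.inl (by norm_num [lam])⟩
        ⟨0, Or.inl (by norm_num [lam])⟩)
  · rw [gVec, hG (Or.inl (by norm_num [lam])), hG (Or.inr (by norm_num [lam])), mul_L7 hτ]
    exact congrArg₂ _
      (latticeSum_congr _ _ _ ⟨0, Or.inl (by norm_num [lam])⟩
        ⟨0, Or.inl (by norm_num [lam])⟩)
      (latticeSum_congr _ _ _ ⟨0, Or.inl (by norm_num [lam])⟩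
        ⟨0, Or.inl (by norm_num [lam])⟩)
  · rw [gVec, hG (Or.inl (by norm_num [lam])), hG (Or.inr (by norm_num [lam])), mul_L8 hτ]
    exact congrArg₂ _
      (latticeSum_congr _ _ _ ⟨1, Or.inr (by norm_num [lam])⟩
        ⟨0, Or.inl (by norm_num [lam])⟩)
      (latticeSum_congr _ _ _ ⟨1, Or.inr (by norm_num [lam])⟩
        ⟨0, Or.inl (by norm_num [lam])⟩)
  · rw [mul_L9 hτ, mul_add, half_falseSum, half_falseSum, add_comm]
    exact congrArg₂ _
      (latticeSum_congr _ _ _ ⟨0, Or.inl (by norm_num)⟩ ⟨1, Or.inr (by norm_num)⟩)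
      (latticeSum_congr _ _ _ ⟨0, Or.inl (by norm_num)⟩ ⟨1, Or.inr (by norm_num)⟩)
  · rw [mul_L10 hτ, mul_add, half_falseSum, half_falseSum]
    exact congrArg₂ _
      (latticeSum_congr _ _ _ ⟨0, Or.inl (by norm_num)⟩ ⟨0, Or.inl (by norm_num)⟩)
      (latticeSum_congr _ _ _ ⟨0, Or.inl (by norm_num)⟩ ⟨0, Or.inl (by norm_num)⟩)
  · rw [mul_L11 hτ, mul_add, half_falseSum, half_falseSum]
    exact congrArg₂ _
      (latticeSum_congr _ _ _ ⟨0, Or.inl (by norm_num)⟩ ⟨0, Or.inl (by norm_num)⟩)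
      (latticeSum_congr _ _ _ ⟨0, Or.inl (by norm_num)⟩ ⟨0, Or.inl (by norm_num)⟩)
  · rw [mul_L12 hτ, mul_add, half_falseSum, half_falseSum, add_comm]
    exact congrArg₂ _
      (latticeSum_congr _ _ _ ⟨0, Or.inl (by norm_num)⟩ ⟨1, Or.inr (by norm_num)⟩)
      (latticeSum_congr _ _ _ ⟨0, Or.inl (by norm_num)⟩ ⟨1, Or.inr (by norm_num)⟩)
  · rw [hVec, hH (Or.inr (by norm_num [lam])), hH (Or.inr (by norm_num [lam])), mul_L9 hτ]
    exact congrArg₂ _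
      (latticeSum_congr _ _ _ ⟨0, Or.inl (by norm_num [lam])⟩
        ⟨0, Or.inl (by norm_num [lam])⟩)
      (latticeSum_congr _ _ _ ⟨-1, Or.inl (by norm_num [lam])⟩
        ⟨0, Or.inl (by norm_num [lam])⟩)
  · rw [hVec, hH (Or.inr (by norm_num [lam])), hH (Or.inr (by norm_num [lam])), mul_L10 hτ]
    exact congrArg₂ _
      (latticeSum_congr _ _ _ ⟨0, Or.inl (by norm_num [lam])⟩
        ⟨0, Or.inl (by norm_num [lam])⟩)
      (latticeSum_congr _ _ _ ⟨0, Or.inl (by norm_num [lam])⟩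
        ⟨0, Or.inl (by norm_num [lam])⟩)
  · rw [hVec, hH (Or.inr (by norm_num [lam])), hH (Or.inr (by norm_num [lam])), mul_L11 hτ]
    exact congrArg₂ _
      (latticeSum_congr _ _ _ ⟨0, Or.inl (by norm_num [lam])⟩
        ⟨0, Or.inl (by norm_num [lam])⟩)
      (latticeSum_congr _ _ _ ⟨0, Or.inl (by norm_num [lam])⟩
        ⟨0, Or.inl (by norm_num [lam])⟩)
  · rw [hVec, hH (Or.inr (by norm_num [lam])), hH (Or.inr (by norm_num [lam])), mul_L12 hτ]
    exact congrArg₂ _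
      (latticeSum_congr _ _ _ ⟨1, Or.inr (by norm_num [lam])⟩
        ⟨0, Or.inl (by norm_num [lam])⟩)
      (latticeSum_congr _ _ _ ⟨1, Or.inr (by norm_num [lam])⟩
        ⟨0, Or.inl (by norm_num [lam])⟩)
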